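/- Let $\mathcal X,\mathcal Y_1,\mathcal Y_2,\hat{\mathcal X}_1,\hat{\mathcal X}_2$ be finite sets, let $(X,Y_1,Y_2)$ have joint distribution $P$ on $\mathcal X\times\mathcal Y_1\times\mathcal Y_2$ with $X\leftrightarrow Y_1\leftrightarrow Y_2$ a Markov string, let $d_j:\mathcal X\times\hat{\mathcal X}_j\to[0,\infty)$, $j=1,2$, be distortion measures, extended to vectors by averaging over the letters, and let $D_1,D_2\in\mathbb R$. Let $(X^n,Y_1^n,Y_2^n)$ be $n$ independent copies of $(X,Y_1,Y_2)$. A rate pair $(R_1,R_2)$ is $(D_1,D_2)$-achievable if for every $\epsilon>0$ and all sufficiently large $n$ there are $M_1,M_2$, encoders $\phi_i:\mathcal X^n\to\{1,\dots,M_i\}$ ($i=1,2$) and decoders $\psi_1:\{1,\dots,M_1\}\times\mathcal Y_1^n\to\hat{\mathcal X}_1^n$, $\psi_2:\{1,\dots,M_1\}\times\{1,\dots,M_2\}\times\mathcal Y_2^n\to\hat{\mathcal X}_2^n$ with $\mathbb E\,d_1(X^n,\psi_1(\phi_1(X^n),Y_1^n))\le D_1+\epsilon$, $\mathbb E\,d_2(X^n,\psi_2(\phi_1(X^n),\phi_2(X^n),Y_2^n))\le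 D_2+\epsilon$ and $\frac1n\log M_i\le R_i+\epsilon$ for $i=1,2$. The Wyner–Ziv rate-distortion function $R^*_{X|Y_j}(D_j)$ is the infimum of the rates $R$ such that for every $\epsilon>0$ and all sufficiently large $n$ there are $M$, an encoder $\phi:\mathcal X^n\to\{1,\dots,M\}$ and a decoder $\psi:\{1,\dots,M\}\times\mathcal Y_j^n\to\hat{\mathcal X}_j^n$ with $\mathbb E\,d_j(X^n,\psi(\phi(X^n),Y_j^n))\le D_j+\epsilon$ and $\frac1n\log M\le R+\epsilon$ (it is $+\infty$ if there is no such $R$). The source is perfectly scalable at $(D_1,D_2)$ if both $R^*_{X|Y_j}(D_j)$ are finite and the pair $\bigl(R^*_{X|Y_1}(D_1),\,R^*_{X|Y_2}(D_2)-R^*_{X|Y_1}(D_1)\bigr)$ is $(D_1,D_2)$-achievable. **Theorem.** Assume that there is $y_1\in\mathcal Y_1$ with $P_{XY_1}(x,y_1)>0$ for every $x\in\mathcal X$. Then the source is perfectly scalable at $(D_1,D_2)$ if and only if there exist random variables $W_1,W_2$ with finite alphabets $\mathcal W_1,\mathcal W_2$, jointly distributed with $(X,Y_1,Y_2)$, and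 deterministic maps $f_j:\mathcal W_j\times\mathcal Y_j\to\hat{\mathcal X}_j$ such that simultaneously 1. $R^*_{X|Y_j}(D_j)=I(X;W_j|Y_j)$ and $\mathbb E\,d_j(X,f_j(W_j,Y_j))\le D_j$ for $j=1,2$; 2. $W_1\leftrightarrow W_2\leftrightarrow X\leftrightarrow Y_1\leftrightarrow Y_2$ is a Markov string; 3. $|\mathcal W_1|\le|\mathcal X|+3$ and $|\mathcal W_2|\le|\mathcal X|(|\mathcal X|+3)+2$. Moreover, the existence of such $W_1,W_2,f_1,f_2$ satisfying 1 and 2 with arbitrary finite alphabets already implies that the source is perfectly scalable at $(D_1,D_2)$. -/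

import Mathlib

noncomputable section

/-! A finite probability space is a finite type `Ω` with a mass function `p ∈ stdSimplex ℝ Ω`;
a random variable is a map on `Ω`. -/

open Classical in
/-- The law (mass function) of the random variable `A` under the mass function `p`. -/
def law {Ω α : Type*} [Fintype Ω] (p : Ω → ℝ) (A : Ω → α) : α → ℝ :=
  fun a => ∑ s, if A s = a then p s else 0

/-- Expectation of a real random variable. -/
def expect {Ω : Type*} [Fintype Ω] (p : Ω → ℝ) (g : Ω → ℝ) : ℝ :=
  ∑ s, p s * g s

/-- Shannon entropy `H(A)` in nats. -/
def entropyOf {Ω α : Type*} [Fintype Ω] [Fintype α] (p : Ω → ℝ) (A : Ω → α) : ℝ :=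
  ∑ a, Real.negMulLog (law p A a)

/-- Conditional mutual information `I(A;B|C) = H(A,C) + H(B,C) - H(A,B,C) - H(C)` in nats. -/
def condMutualInfo {Ω α β γ : Type*} [Fintype Ω] [Fintype α] [Fintype β] [Fintype γ]
    (p : Ω → ℝ) (A : Ω → α) (B : Ω → β) (C : Ω → γ) : ℝ :=
  entropyOf p (fun s => (A s, C s)) + entropyOf p (fun s => (B s, C s))
    - entropyOf p (fun s => (A s, B s, C s)) - entropyOf p C

/-- `A ↔ B ↔ C` is a Markov string: `P(a,b,c) P(b) = P(a,b) P(b,c)`. -/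
def IsMarkov {Ω α β γ : Type*} [Fintype Ω]
    (p : Ω → ℝ) (A : Ω → α) (B : Ω → β) (C : Ω → γ) : Prop :=
  ∀ a b c, law p (fun s => (A s, B s, C s)) (a, b, c) * law p B b =
    law p (fun s => (A s, B s)) (a, b) * law p (fun s => (B s, C s)) (b, c)

/-- `A ↔ B ↔ C ↔ D ↔ E` is a Markov string: at each inner variable, the variables before it and
those after it are conditionally independent given it. -/
def IsMarkov₅ {Ω α β γ δ ε : Type*} [Fintype Ω]
    (p : Ω → ℝ) (A : Ω → α) (B : Ω → β) (C : Ω → γ) (D : Ω → δ) (E : Ω → ε) : Prop :=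
  IsMarkov p A B (fun s => (C s, D s, E s)) ∧
  IsMarkov p (fun s => (A s, B s)) C (fun s => (D s, E s)) ∧
  IsMarkov p (fun s => (A s, B s, C s)) D E

/-- The mass function of `n` independent copies. -/
def iidLaw {α : Type*} (p : α → ℝ) (n : ℕ) : (Fin n → α) → ℝ :=
  fun s => ∏ i, p (s i)

/-- Single-letter extension of a distortion measure to vectors of length `n`. -/
def vecDist {X Z : Type*} (d : X → Z → ℝ) {n : ℕ} (x : Fin n → X) (z : Fin n → Z) : ℝ :=
  (1 / (n : ℝ)) * ∑ i, d (x i) (z i)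

/-! ### Coding with side information at one decoder -/

/-- A Wyner-Ziv code of block length `n` with `M` messages: the decoder sees the message and
the side-information vector. -/
structure WZCode (X Y Z : Type*) (n M : ℕ) where
  enc : (Fin n → X) → Fin M
  dec : Fin M → (Fin n → Y) → (Fin n → Z)

/-- Expected distortion of a Wyner-Ziv code for the source-side information law `p` on `X × Y`. -/
def WZCode.distortion {X Y Z : Type*} [Fintype X] [Fintype Y] {n M : ℕ}
    (C : WZCode X Y Z n M) (p : X × Y → ℝ) (d : X → Z → ℝ) : ℝ :=
  expect (iidLaw p n) fun s =>
    vecDist d (fun i => (s i).1) (C.dec (C.enc fun i => (s i).1) fun i => (s i).2)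

/-- The rate `R` is achievable at distortion `D` for source coding with side information at the
decoder. -/
def WZAchievable {X Y Z : Type*} [Fintype X] [Fintype Y]
    (p : X × Y → ℝ) (d : X → Z → ℝ) (D R : ℝ) : Prop :=
  ∀ ε : ℝ, 0 < ε → ∃ N : ℕ, ∀ n : ℕ, N ≤ n →
    ∃ (M : ℕ) (C : WZCode X Y Z n M),
      C.distortion p d ≤ D + ε ∧ (1 / (n : ℝ)) * Real.log M ≤ R + ε

/-- The Wyner-Ziv rate-distortion function `R*_{X|Y}(D)`: the infimum of the achievable rates
(it is `⊤` if no rate is achievable). -/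
def wzRate {X Y Z : Type*} [Fintype X] [Fintype Y]
    (p : X × Y → ℝ) (d : X → Z → ℝ) (D : ℝ) : EReal :=
  sInf (Real.toEReal '' {R : ℝ | WZAchievable p d D R})

/-! ### Side-information scalable coding -/

section Scalable

/-- A side-information scalable code: decoder one sees the first message and `Y₁`-side
information, decoder two sees both messages and `Y₂`-side information. -/
structure SICode (X Y₁ Y₂ Z₁ Z₂ : Type*) (n M₁ M₂ : ℕ) where
  enc₁ : (Fin n → X) → Fin M₁
  enc₂ : (Fin n → X) → Fin M₂
  dec₁ : Fin M₁ → (Fin n → Y₁) → (Fin n → Z₁)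
  dec₂ : Fin M₁ → Fin M₂ → (Fin n → Y₂) → (Fin n → Z₂)

variable {X Y₁ Y₂ Z₁ Z₂ : Type*} [Fintype X] [Fintype Y₁] [Fintype Y₂]

/-- Expected distortion at decoder one. -/
def SICode.distortion₁ {n M₁ M₂ : ℕ} (C : SICode X Y₁ Y₂ Z₁ Z₂ n M₁ M₂)
    (P : X × Y₁ × Y₂ → ℝ) (d₁ : X → Z₁ → ℝ) : ℝ :=
  expect (iidLaw P n) fun s =>
    vecDist d₁ (fun i => (s i).1) (C.dec₁ (C.enc₁ fun i => (s i).1) fun i => (s i).2.1)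

/-- Expected distortion at decoder two. -/
def SICode.distortion₂ {n M₁ M₂ : ℕ} (C : SICode X Y₁ Y₂ Z₁ Z₂ n M₁ M₂)
    (P : X × Y₁ × Y₂ → ℝ) (d₂ : X → Z₂ → ℝ) : ℝ :=
  expect (iidLaw P n) fun s =>
    vecDist d₂ (fun i => (s i).1)
      (C.dec₂ (C.enc₁ fun i => (s i).1) (C.enc₂ fun i => (s i).1) fun i => (s i).2.2)

/-- The rate pair `(R₁, R₂)` is `(D₁, D₂)`-achievable. -/
def SIAchievable (P : X × Y₁ × Y₂ → ℝ) (d₁ : X → Z₁ → ℝ) (d₂ : X → Z₂ → ℝ)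
    (D₁ D₂ R₁ R₂ : ℝ) : Prop :=
  ∀ ε : ℝ, 0 < ε → ∃ N : ℕ, ∀ n : ℕ, N ≤ n →
    ∃ (M₁ M₂ : ℕ) (C : SICode X Y₁ Y₂ Z₁ Z₂ n M₁ M₂),
      C.distortion₁ P d₁ ≤ D₁ + ε ∧ C.distortion₂ P d₂ ≤ D₂ + ε ∧
      (1 / (n : ℝ)) * Real.log M₁ ≤ R₁ + ε ∧ (1 / (n : ℝ)) * Real.log M₂ ≤ R₂ + ε

/-- The Wyner-Ziv function `R*_{X|Y₁}` of the first stage. -/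
def wzRate₁ (P : X × Y₁ × Y₂ → ℝ) (d₁ : X → Z₁ → ℝ) (D₁ : ℝ) : EReal :=
  wzRate (law P fun s => (s.1, s.2.1)) d₁ D₁

/-- The Wyner-Ziv function `R*_{X|Y₂}` of the second stage. -/
def wzRate₂ (P : X × Y₁ × Y₂ → ℝ) (d₂ : X → Z₂ → ℝ) (D₂ : ℝ) : EReal :=
  wzRate (law P fun s => (s.1, s.2.2)) d₂ D₂

/-- The source is perfectly scalable at `(D₁, D₂)`: both Wyner-Ziv rates are finite and
`(R*_{X|Y₁}(D₁), R*_{X|Y₂}(D₂) - R*_{X|Y₁}(D₁))` is `(D₁, D₂)`-achievable. -/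
def PerfectlyScalable (P : X × Y₁ × Y₂ → ℝ) (d₁ : X → Z₁ → ℝ) (d₂ : X → Z₂ → ℝ)
    (D₁ D₂ : ℝ) : Prop :=
  ∃ R₁ R₂ : ℝ, wzRate₁ P d₁ D₁ = R₁ ∧ wzRate₂ P d₂ D₂ = R₂ ∧
    SIAchievable P d₁ d₂ D₁ D₂ R₁ (R₂ - R₁)

/-- There are random variables `W₁`, `W₂`, with alphabets of `k₁` and `k₂` letters and jointly
distributed with `(X, Y₁, Y₂)` by `Q`, and maps `f₁`, `f₂` such that `W₁ ↔ W₂ ↔ X ↔ Y₁ ↔ Y₂`,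
`R*_{X|Yⱼ}(Dⱼ) = I(X;Wⱼ|Yⱼ)` and `E dⱼ(X, fⱼ(Wⱼ,Yⱼ)) ≤ Dⱼ` for `j = 1, 2`. -/
def HasMarkovTestChannels (P : X × Y₁ × Y₂ → ℝ) (d₁ : X → Z₁ → ℝ) (d₂ : X → Z₂ → ℝ)
    (D₁ D₂ : ℝ) (k₁ k₂ : ℕ) : Prop :=
  ∃ Q ∈ stdSimplex ℝ (Fin k₁ × Fin k₂ × X × Y₁ × Y₂),
    ∃ (f₁ : Fin k₁ × Y₁ → Z₁) (f₂ : Fin k₂ × Y₂ → Z₂),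
      law Q (fun (_, _, x, y₁, y₂) => (x, y₁, y₂)) = P ∧
      IsMarkov₅ Q (fun (w₁, _, _, _, _) => w₁) (fun (_, w₂, _, _, _) => w₂)
        (fun (_, _, x, _, _) => x) (fun (_, _, _, y₁, _) => y₁) (fun (_, _, _, _, y₂) => y₂) ∧
      wzRate₁ P d₁ D₁ = (condMutualInfo Q (fun (_, _, x, _, _) => x)
        (fun (w₁, _, _, _, _) => w₁) (fun (_, _, _, y₁, _) => y₁) : ℝ) ∧
      wzRate₂ P d₂ D₂ = (condMutualInfo Q (fun (_, _, x, _, _) => x)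
        (fun (_, w₂, _, _, _) => w₂) (fun (_, _, _, _, y₂) => y₂) : ℝ) ∧
      expect Q (fun (w₁, _, x, y₁, _) => d₁ x (f₁ (w₁, y₁))) ≤ D₁ ∧
      expect Q (fun (_, w₂, x, _, y₂) => d₂ x (f₂ (w₂, y₂))) ≤ D₂

end Scalable

end

/-! Sufficiency. Suppose W₁ ↔ W₂ ↔ X ↔ Y₁ ↔ Y₂. Random binning describes W₁ to decoder one at rate
H(W₁|Y₁) - H(W₁|X) = I(X;W₁|Y₁). Decoder two has the weaker side information, so it needs a finer
bin of W₁, at additional rate H(W₁|Y₂) - H(W₁|Y₁), and then a bin of W₂ at rate H(W₂|W₁,Y₂) -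
H(W₂|W₁,X). By the Markov property the last two rates add up to I(X;W₂|Y₂) - I(X;W₁|Y₁)
(`siAchievable_of_isMarkov₅`).

The codes come from hashing rather than from a covering argument. Part of the hash of (W₁,W₂) is
short enough to be nearly uniform whatever the source block is (`sum_abs_bin_sub_le`), so its value
can be fixed in advance and shared by all terminals (`exists_encoder`). The remaining hash values
are the messages, and each decoder searches a short list for the entry with the right hash
(`exists_code_one_shot`). Equipartition turns this into block codes (`exists_block_code`). With a
trivial second stage the same result shows that every admissible test channel bounds the Wyner-Ziv
rate from above (`wzAchievable_of_joint`).

Necessity. From a block code take as auxiliary letters the strategies: letter i of a reproduction as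
a function of letter i of the side information. They lie in finite alphabets that do not depend on
the block length, so the letter channels can be averaged, by concavity of conditional entropy, and a
limit exists by compactness (`exists_channel_of_siAchievable`). The limit satisfies I(X;W₁|Y₁) ≤ R₁
and I(X,Y₁;W₂|Y₂) + I(X;W₁|W₂,Y₁,Y₂) ≤ R₁ + (R₂ - R₁) = R₂, where Rⱼ is the Wyner-Ziv rate of stage
j. Since I(X;Wⱼ|Yⱼ) ≥ Rⱼ, all these inequalities are tight and I(X;W₁|W₂,Y₁,Y₂) = 0. At a pair
(y₁,y₂) that has positive probability together with every x, this conditional independence factors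
the channel itself as u(w₁,w₂) k(w₂,x), which is W₁ ↔ W₂ ↔ X (`exists_factorization`).

Cardinalities. Rates and distortions are sums over output letters of functionals homogeneous of
degree one, so the conic Carathéodory theorem (`exists_conic_reduction`) shrinks first the alphabet
of W₁ and then that of W₂ while keeping the product form. -/

noncomputable section

set_option linter.unusedSectionVars false

/-! ### Laws of random variables on a finite probability space. -/

section LawBasics

variable {Ω α β γ : Type*} [Fintype Ω]

theorem law_nonneg {p : Ω → ℝ} (hp : ∀ s, 0 ≤ p s) (A : Ω → α) (a : α) : 0 ≤ law p A a := by
  classical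
  exact Finset.sum_nonneg fun s _ => by split_ifs <;> simp [hp]

theorem le_law_apply {p : Ω → ℝ} (hp : ∀ s, 0 ≤ p s) (A : Ω → α) (s : Ω) :
    p s ≤ law p A (A s) := by
  classical
  unfold law
  calc p s = if A s = A s then p s else 0 := by simp
    _ ≤ _ := Finset.single_le_sum (f := fun t => if A t = A s then p t else 0)
        (fun t _ => by split_ifs <;> simp [hp]) (Finset.mem_univ s)

theorem sum_law_mul [Fintype α] (p : Ω → ℝ) (A : Ω → α) (g : α → ℝ) :
    ∑ a, law p A a * g a = ∑ s, p s * g (A s) := by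
  classical
  simp only [law, Finset.sum_mul]
  rw [Finset.sum_comm]
  refine Finset.sum_congr rfl fun s _ => ?_
  simp [ite_mul]

theorem sum_law [Fintype α] (p : Ω → ℝ) (A : Ω → α) : ∑ a, law p A a = ∑ s, p s := by
  simpa using sum_law_mul p A fun _ => 1

theorem law_eq_sum_mul (p : Ω → ℝ) (A : Ω → α) (a : α) [DecidableEq α] :
    law p A a = ∑ s, p s * (if A s = a then 1 else 0) := by
  unfold law
  refine Finset.sum_congr rfl fun s _ => ?_
  split_ifs <;> simp

theorem law_law [Fintype α] (p : Ω → ℝ) (A : Ω → α) (f : α → β) :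
    law (law p A) f = law p fun s => f (A s) := by
  classical
  funext b
  rw [law_eq_sum_mul, law_eq_sum_mul, sum_law_mul p A fun a => if f a = b then 1 else 0]

theorem law_mem_stdSimplex [Fintype α] {p : Ω → ℝ} (hp : p ∈ stdSimplex ℝ Ω) (A : Ω → α) :
    law p A ∈ stdSimplex ℝ α :=
  ⟨law_nonneg hp.1 A, (sum_law p A).trans hp.2⟩

theorem expect_law [Fintype α] (p : Ω → ℝ) (A : Ω → α) (g : α → ℝ) :
    expect (law p A) g = expect p fun s => g (A s) :=
  sum_law_mul p A g

/-- Summing a law over the second component. -/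
theorem sum_law_snd [Fintype β] (p : Ω → ℝ) (A : Ω → α) (B : Ω → β) (a : α) :
    ∑ b, law p (fun s => (A s, B s)) (a, b) = law p A a := by
  classical
  simp only [law]
  rw [Finset.sum_comm]
  refine Finset.sum_congr rfl fun s _ => ?_
  by_cases h : A s = a <;> simp [h, Prod.ext_iff]

theorem sum_law_fst [Fintype α] (p : Ω → ℝ) (A : Ω → α) (B : Ω → β) (b : β) :
    ∑ a, law p (fun s => (A s, B s)) (a, b) = law p B b := by
  classical
  simp only [law]
  rw [Finset.sum_comm]
  refine Finset.sum_congr rfl fun s _ => ?_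
  by_cases h : B s = b <;> simp [h, Prod.ext_iff]

theorem law_congr_apply {p : Ω → ℝ} {A : Ω → α} {B : Ω → β} {a : α} {b : β}
    (h : ∀ t, A t = a ↔ B t = b) : law p A a = law p B b := by
  classical
  simp only [law, h]

theorem law_mono_apply {p : Ω → ℝ} (hp : ∀ s, 0 ≤ p s) {A : Ω → α} {B : Ω → β} {a : α} {b : β}
    (h : ∀ t, A t = a → B t = b) : law p A a ≤ law p B b := by
  classical
  refine Finset.sum_le_sum fun t _ => ?_
  by_cases h1 : A t = a
  · simp [h1, h t h1]
  · simp only [h1, if_false]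
    split_ifs <;> simp [hp]

theorem law_id (p : Ω → ℝ) : law p (fun s => s) = p := by
  classical
  funext a
  simp [law]

end LawBasics

/-! ### Entropy, conditional mutual information and the equality case of its nonnegativity. -/

section Entropy

variable {Ω α β γ : Type*} [Fintype Ω]

theorem entropyOf_eq [Fintype α] (p : Ω → ℝ) (A : Ω → α) :
    entropyOf p A = -∑ s, p s * Real.log (law p A (A s)) := by
  rw [entropyOf, ← sum_law_mul p A fun a => Real.log (law p A a), ← Finset.sum_neg_distrib]
  exact Finset.sum_congr rfl fun a _ => by simp [Real.negMulLog]

theorem entropyOf_law [Fintype α] [Fintype β] (p : Ω → ℝ) (A : Ω → α) (f : α → β) :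
    entropyOf (law p A) f = entropyOf p fun s => f (A s) := by
  simp only [entropyOf, law_law]

/-- Entropy depends only on the partition that a random variable induces. -/
theorem entropyOf_congr [Fintype α] [Fintype β] (p : Ω → ℝ) {A : Ω → α} {B : Ω → β}
    (h : ∀ s t, A s = A t ↔ B s = B t) : entropyOf p A = entropyOf p B := by
  rw [entropyOf_eq, entropyOf_eq]
  congr 1
  exact Finset.sum_congr rfl fun s _ => by rw [law_congr_apply fun t => h t s]

theorem entropyOf_mono [Fintype α] [Fintype β] {p : Ω → ℝ} (hp : ∀ s, 0 ≤ p s)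
    {A : Ω → α} {B : Ω → β} (h : ∀ s t, A s = A t → B s = B t) :
    entropyOf p B ≤ entropyOf p A := by
  rw [entropyOf_eq, entropyOf_eq, neg_le_neg_iff]
  refine Finset.sum_le_sum fun s _ => ?_
  rcases (hp s).eq_or_lt with h0 | h0
  · simp [← h0]
  · exact mul_le_mul_of_nonneg_left (Real.log_le_log (h0.trans_le (le_law_apply hp A s))
      (law_mono_apply hp fun t => h t s)) (hp s)

theorem entropyOf_le_log_card [Fintype α] {p : Ω → ℝ} (hp : p ∈ stdSimplex ℝ Ω) (A : Ω → α) :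
    entropyOf p A ≤ Real.log (Fintype.card α) := by
  have hl := law_mem_stdSimplex hp A
  have hne : Nonempty α := by
    by_contra h
    rw [not_nonempty_iff] at h
    have := hl.2
    simp at this
  have hc : (0 : ℝ) < Fintype.card α := by exact_mod_cast Fintype.card_pos
  -- Tangent-line bound log t ≤ t - 1 at t = 1 / (P(a) · card α). After summation over a the first
  -- two terms cancel.
  have key : ∀ a, Real.negMulLog (law p A a) ≤
      1 / Fintype.card α - law p A a + law p A a * Real.log (Fintype.card α) := by
    intro a
    rcases (hl.1 a).eq_or_lt with h0 | h0
    · rw [← h0]; simp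
    · have h1 := Real.log_le_sub_one_of_pos (x := 1 / (law p A a * Fintype.card α)) (by positivity)
      rw [one_div, Real.log_inv, Real.log_mul h0.ne' hc.ne'] at h1
      have h2 := mul_le_mul_of_nonneg_left h1 h0.le
      have h3 : law p A a * ((law p A a * Fintype.card α)⁻¹ - 1) =
          1 / Fintype.card α - law p A a := by field_simp
      rw [h3] at h2
      simp only [Real.negMulLog]
      linarith
  calc entropyOf p A ≤ ∑ a, (1 / (Fintype.card α : ℝ) - law p A a +
        law p A a * Real.log (Fintype.card α)) := Finset.sum_le_sum fun a _ => key a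
    _ = _ := by
      rw [Finset.sum_add_distrib, Finset.sum_sub_distrib, ← Finset.sum_mul, hl.2]
      simp [hc.ne']

/-- The relative-entropy integrand. -/
def klTerm (x y : ℝ) : ℝ := x * Real.log (x / y) - x + y

/-- The correction `- x + y` makes each single summand nonnegative, by log t ≤ t - 1 at t = y / x. A
vanishing sum of such terms therefore vanishes term by term. -/
theorem klTerm_nonneg {x y : ℝ} (hx : 0 ≤ x) (hy : 0 ≤ y) (h : 0 < x → 0 < y) :
    0 ≤ klTerm x y := by
  rcases hx.eq_or_lt with h0 | h0
  · simp [klTerm, ← h0, hy]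
  · have h1 := Real.log_le_sub_one_of_pos (x := y / x) (div_pos (h h0) h0)
    have h2 := mul_le_mul_of_nonneg_left h1 hx
    rw [← inv_div, Real.log_inv] at h2
    have h3 : x * ((x / y)⁻¹ - 1) = y - x := by
      have := h h0
      field_simp
    rw [h3] at h2
    simp only [klTerm]
    linarith

theorem eq_of_klTerm_eq_zero {x y : ℝ} (hx : 0 ≤ x) (h : 0 < x → 0 < y)
    (h0 : klTerm x y = 0) : x = y := by
  rcases hx.eq_or_lt with hx0 | hx0
  · simpa [klTerm, ← hx0, eq_comm] using h0
  · by_contra hne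
    have hy := h hx0
    have h1 := Real.log_lt_sub_one_of_pos (x := y / x) (div_pos hy hx0)
      (by rw [Ne, div_eq_one_iff_eq hx0.ne']; exact fun h => hne h.symm)
    have h2 := mul_lt_mul_of_pos_left h1 hx0
    rw [← inv_div, Real.log_inv] at h2
    have h3 : x * ((x / y)⁻¹ - 1) = y - x := by field_simp
    rw [h3] at h2
    simp only [klTerm] at h0
    linarith

theorem klTerm_self (x : ℝ) : klTerm x x = 0 := by
  by_cases h : x = 0 <;> simp [klTerm, h]

variable [Fintype α] [Fintype β] [Fintype γ]

/-- Conditional mutual information as a relative entropy. -/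
theorem condMutualInfo_eq_sum_klTerm {p : Ω → ℝ} (hp : ∀ s, 0 ≤ p s)
    (A : Ω → α) (B : Ω → β) (C : Ω → γ) :
    condMutualInfo p A B C = ∑ t : α × β × γ,
      klTerm (law p (fun s => (A s, B s, C s)) t)
        (law p (fun s => (A s, C s)) (t.1, t.2.2) * law p (fun s => (B s, C s)) (t.2.1, t.2.2)
          / law p C t.2.2) := by
  -- The corrections `- x` and `+ y` have the same total mass and cancel, so only the logarithmic
  -- part remains.
  have e1 : ∑ t : α × β × γ, law p (fun s => (A s, B s, C s)) t = ∑ s, p s := sum_law _ _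
  have e2 : ∑ t : α × β × γ, (law p (fun s => (A s, C s)) (t.1, t.2.2) *
      law p (fun s => (B s, C s)) (t.2.1, t.2.2) / law p C t.2.2) = ∑ s, p s := by
    rw [← sum_law p C, Fintype.sum_prod_type]
    simp only [Fintype.sum_prod_type]
    calc _ = ∑ c, ∑ a, ∑ b, (law p (fun s => (A s, C s)) (a, c) *
      law p (fun s => (B s, C s)) (b, c) / law p C c) := by
          rw [Finset.sum_comm]
          conv_rhs => rw [Finset.sum_comm]
          rw [Finset.sum_comm]
          exact Finset.sum_congr rfl fun a _ => Finset.sum_comm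
      _ = _ := by
        refine Finset.sum_congr rfl fun c _ => ?_
        simp only [mul_div_assoc, ← Finset.mul_sum]
        simp only [← Finset.sum_div, ← Finset.sum_mul, sum_law_fst]
        by_cases h : law p C c = 0
        · simp [h]
        · field_simp
  have e3 : condMutualInfo p A B C = ∑ t : α × β × γ, law p (fun s => (A s, B s, C s)) t *
      Real.log (law p (fun s => (A s, B s, C s)) t /
      (law p (fun s => (A s, C s)) (t.1, t.2.2) * law p (fun s => (B s, C s)) (t.2.1, t.2.2)
          / law p C t.2.2)) := by
    rw [sum_law_mul p (fun s => (A s, B s, C s)) fun t =>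
      Real.log (law p (fun s => (A s, B s, C s)) t /
      (law p (fun s => (A s, C s)) (t.1, t.2.2) * law p (fun s => (B s, C s)) (t.2.1, t.2.2)
          / law p C t.2.2))]
    simp only [condMutualInfo, entropyOf_eq, ← Finset.sum_neg_distrib, ← Finset.sum_add_distrib,
      ← Finset.sum_sub_distrib]
    refine Finset.sum_congr rfl fun s _ => ?_
    rcases (hp s).eq_or_lt with h0 | h0
    · simp [← h0]
    · have p1 := h0.trans_le (le_law_apply hp (fun s => (A s, B s, C s)) s)
      have p2 := h0.trans_le (le_law_apply hp (fun s => (A s, C s)) s)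
      have p3 := h0.trans_le (le_law_apply hp (fun s => (B s, C s)) s)
      have p4 := h0.trans_le (le_law_apply hp C s)
      rw [Real.log_div p1.ne' (by positivity), Real.log_div (by positivity) p4.ne',
        Real.log_mul p2.ne' p3.ne']
      ring
  simp only [klTerm, Finset.sum_add_distrib, Finset.sum_sub_distrib, e1, e2, e3]
  ring

theorem klTerm_law_pos {p : Ω → ℝ} (hp : ∀ s, 0 ≤ p s) (A : Ω → α) (B : Ω → β) (C : Ω → γ)
    (t : α × β × γ) (h : 0 < law p (fun s => (A s, B s, C s)) t) :
    0 < law p (fun s => (A s, C s)) (t.1, t.2.2) * law p (fun s => (B s, C s)) (t.2.1, t.2.2)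
          / law p C t.2.2 := by
  refine div_pos (mul_pos ?_ ?_) ?_ <;> refine h.trans_le (law_mono_apply hp ?_) <;>
    · rintro s rfl; rfl

theorem condMutualInfo_nonneg {p : Ω → ℝ} (hp : ∀ s, 0 ≤ p s)
    (A : Ω → α) (B : Ω → β) (C : Ω → γ) : 0 ≤ condMutualInfo p A B C := by
  rw [condMutualInfo_eq_sum_klTerm hp]
  exact Finset.sum_nonneg fun t _ => klTerm_nonneg (law_nonneg hp _ _)
    (div_nonneg (mul_nonneg (law_nonneg hp _ _) (law_nonneg hp _ _)) (law_nonneg hp _ _))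
    (klTerm_law_pos hp A B C t)

/-- Equality case: all relative-entropy terms are zero, so P(a,b,c) = P(a,c) P(b,c) / P(c). Where
P(c) = 0 both sides of the claim vanish. -/
theorem isMarkov_of_condMutualInfo_eq_zero {p : Ω → ℝ} (hp : ∀ s, 0 ≤ p s)
    {A : Ω → α} {B : Ω → β} {C : Ω → γ} (h : condMutualInfo p A B C = 0) (a : α) (b : β) (c : γ) :
    law p (fun s => (A s, B s, C s)) (a, b, c) * law p C c =
      law p (fun s => (A s, C s)) (a, c) * law p (fun s => (B s, C s)) (b, c) := by
  rw [condMutualInfo_eq_sum_klTerm hp, Finset.sum_eq_zero_iff_of_nonneg] at h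
  · have := eq_of_klTerm_eq_zero (law_nonneg hp _ _) (klTerm_law_pos hp A B C (a, b, c))
      (h (a, b, c) (Finset.mem_univ _))
    rw [this]
    by_cases hc : law p C c = 0
    · have : law p (fun s => (A s, C s)) (a, c) = 0 :=
        le_antisymm (hc ▸ law_mono_apply hp fun s hs => (Prod.ext_iff.1 hs).2) (law_nonneg hp _ _)
      simp [hc, this]
    · field_simp
  · exact fun t _ => klTerm_nonneg (law_nonneg hp _ _)
      (div_nonneg (mul_nonneg (law_nonneg hp _ _) (law_nonneg hp _ _)) (law_nonneg hp _ _))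
      (klTerm_law_pos hp A B C t)

theorem condMutualInfo_eq_zero_of_isMarkov {p : Ω → ℝ} (hp : ∀ s, 0 ≤ p s)
    {A : Ω → α} {B : Ω → β} {C : Ω → γ} (h : IsMarkov p A C B) : condMutualInfo p A B C = 0 := by
  rw [condMutualInfo_eq_sum_klTerm hp]
  refine Finset.sum_eq_zero fun ⟨a, b, c⟩ _ => ?_
  have h1 := h a c b
  have e1 : law p (fun s => (A s, C s, B s)) (a, c, b) =
      law p (fun s => (A s, B s, C s)) (a, b, c) := by
    exact law_congr_apply fun s => by simp only [Prod.ext_iff]; tauto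
  have e2 : law p (fun s => (C s, B s)) (c, b) = law p (fun s => (B s, C s)) (b, c) := by
    exact law_congr_apply fun s => by simp only [Prod.ext_iff]; tauto
  rw [e1, e2] at h1
  dsimp only
  rw [← h1]
  by_cases hc : law p C c = 0
  · have : law p (fun s => (A s, B s, C s)) (a, b, c) = 0 :=
        le_antisymm (hc ▸ law_mono_apply hp fun s hs => (Prod.ext_iff.1 (Prod.ext_iff.1 hs).2).2)
          (law_nonneg hp _ _)
    simp [hc, this, klTerm]
  · rw [mul_div_cancel_right₀ _ hc, klTerm_self]

/-- Conditional entropy `H(A|B)`. -/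
def condEntropyOf (p : Ω → ℝ) (A : Ω → α) (B : Ω → β) : ℝ :=
  entropyOf p (fun s => (A s, B s)) - entropyOf p B

/-- `C` is a function of `B`, so the difference of the two sides is I(A;B|C) ≥ 0. -/
theorem condEntropyOf_anti {p : Ω → ℝ} (hp : ∀ s, 0 ≤ p s) (A : Ω → α) {B : Ω → β} {C : Ω → γ}
    (h : ∀ s t, B s = B t → C s = C t) : condEntropyOf p A B ≤ condEntropyOf p A C := by
  have h1 := condMutualInfo_nonneg hp A B C
  have e1 : entropyOf p (fun s => (A s, B s, C s)) = entropyOf p (fun s => (A s, B s)) :=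
    entropyOf_congr p fun s t => by
      simp only [Prod.ext_iff]; exact ⟨fun h => ⟨h.1, h.2.1⟩, fun g => ⟨g.1, g.2, h _ _ g.2⟩⟩
  have e2 : entropyOf p (fun s => (B s, C s)) = entropyOf p B :=
    entropyOf_congr p fun s t => by
      simp only [Prod.ext_iff]; exact ⟨fun h => h.1, fun g => ⟨g, h _ _ g⟩⟩
  simp only [condMutualInfo, condEntropyOf, e1, e2] at *
  linarith

theorem condEntropyOf_congr {α' β' : Type*} [Fintype α'] [Fintype β'] (p : Ω → ℝ)
    {A : Ω → α} {B : Ω → β} {A' : Ω → α'} {B' : Ω → β'}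
    (hB : ∀ s t, B s = B t ↔ B' s = B' t)
    (hA : ∀ s t, B s = B t → (A s = A t ↔ A' s = A' t)) :
    condEntropyOf p A B = condEntropyOf p A' B' := by
  unfold condEntropyOf
  rw [entropyOf_congr p hB, entropyOf_congr p (A := fun s => (A s, B s)) (B := fun s => (A' s, B' s))]
  intro s t
  simp only [Prod.ext_iff]
  rw [← hB s t]
  exact and_congr_left fun h => hA s t h

/-- Splitting off the last coordinate costs I(A₀,…,Aₙ₋₁; Aₙ | B) ≥ 0. -/
theorem condEntropyOf_pi_le {n : ℕ} {p : Ω → ℝ} (hp : ∀ s, 0 ≤ p s) (A : Fin n → Ω → α)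
    (B : Ω → β) : condEntropyOf p (fun s i => A i s) B ≤ ∑ i, condEntropyOf p (A i) B := by
  induction n with
  | zero =>
    have : entropyOf p (fun s => ((fun i : Fin 0 => A i s), B s)) = entropyOf p B :=
      entropyOf_congr p fun s t => by simp [Prod.ext_iff, funext_iff]
    simp [condEntropyOf, this]
  | succ n ih =>
    rw [Fin.sum_univ_castSucc]
    have h1 := ih fun i => A i.castSucc
    have h2 := condMutualInfo_nonneg hp (fun s (i : Fin n) => A i.castSucc s) (A (Fin.last n)) B
    have h3 : entropyOf p (fun s => ((fun i => A i s), B s)) =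
        entropyOf p (fun s => ((fun i : Fin n => A i.castSucc s), A (Fin.last n) s, B s)) :=
      entropyOf_congr p fun s t => by
        simp [Prod.ext_iff, funext_iff, Fin.forall_fin_succ', and_assoc]
    simp only [condEntropyOf, condMutualInfo] at *
    linarith

end Entropy

/-! ### Random hash functions and leftover hashing. -/

section Hashing

/-- Uniform weights on a finite type. -/
def unifWeight (Θ : Type*) [Fintype Θ] : ℝ := 1 / (Fintype.card Θ : ℝ)

theorem unifWeight_nonneg (Θ : Type*) [Fintype Θ] : 0 ≤ unifWeight Θ := by
  unfold unifWeight; positivity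

theorem sum_unifWeight (Θ : Type*) [Fintype Θ] [Nonempty Θ] : ∑ _θ : Θ, unifWeight Θ = 1 := by
  simp [unifWeight]

/-- Collision probability of a uniformly random function. -/
theorem sum_unifWeight_collision {A K : Type*} [Fintype A] [Fintype K] [DecidableEq A]
    [DecidableEq K] [Nonempty K] {a a' : A} (h : a ≠ a') :
    ∑ f : A → K, unifWeight (A → K) * (if f a = f a' then 1 else 0) =
      1 / (Fintype.card K : ℝ) := by
  -- Overwriting the value at `a` of a colliding function by an arbitrary `k` reaches every function
  -- exactly once, so colliding functions are a fraction 1 / card K of all.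
  let e : {f : A → K // f a = f a'} × K ≃ (A → K) :=
    { toFun := fun x => Function.update x.1.1 a x.2
      invFun := fun f => (⟨Function.update f a (f a'), by simp [h.symm]⟩, f a)
      left_inv := by
        rintro ⟨⟨f, hf⟩, k⟩
        simp [h.symm, ← hf]
      right_inv := by
        intro f
        simp }
  have h1 : (Fintype.card {f : A → K // f a = f a'} : ℝ) * Fintype.card K =
      Fintype.card (A → K) := by
    rw [← Fintype.card_congr e, Fintype.card_prod]; push_cast; ring
  rw [← Finset.mul_sum, Finset.sum_boole, ← Fintype.card_subtype, unifWeight, ← h1]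
  have hK : (Fintype.card K : ℝ) ≠ 0 := by exact_mod_cast Fintype.card_ne_zero
  have hF : (Fintype.card {f : A → K // f a = f a'} : ℝ) ≠ 0 := by
    intro h0
    rw [h0, zero_mul] at h1
    exact (by exact_mod_cast Fintype.card_ne_zero : (Fintype.card (A → K) : ℝ) ≠ 0) h1.symm
  field_simp

variable {Θ C K A G G' : Type*} [Fintype Θ] [Fintype C] [Fintype K] [Fintype A] [Fintype G]
  [Fintype G'] [DecidableEq K] [DecidableEq A] [DecidableEq G] [DecidableEq G'] [DecidableEq C]

/-- Bin masses of a random hash are nearly uniform in mean, in terms of collision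
probabilities. -/
theorem sum_abs_bin_sub_le_sqrt [Nonempty K] (μ : Θ → ℝ) (hμ : ∀ θ, 0 ≤ μ θ) (hμ1 : ∑ θ, μ θ = 1)
    (k : Θ → C → K) (r : C → ℝ) :
    ∑ θ, μ θ * ∑ κ, |(∑ c, r c) / Fintype.card K - ∑ c, r c * (if k θ c = κ then 1 else 0)| ≤
      √(∑ c, ∑ c', r c * r c' *
        (Fintype.card K * (∑ θ, μ θ * (if k θ c = k θ c' then 1 else 0)) - 1)) := by
  set N : ℝ := (Fintype.card K : ℝ) with hN
  have hN0 : N ≠ 0 := by rw [hN]; exact_mod_cast Fintype.card_ne_zero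
  set τ := ∑ c, r c with hτ
  set Z : Θ → K → ℝ := fun θ κ => ∑ c, r c * (if k θ c = κ then 1 else 0) with hZ
  have hZs : ∀ θ, ∑ κ, Z θ κ = τ := by
    intro θ
    simp only [hZ]
    rw [Finset.sum_comm]
    simp [hτ]
  have hZ2 : ∀ θ, ∑ κ, Z θ κ ^ 2 = ∑ c, ∑ c', r c * r c' * (if k θ c = k θ c' then 1 else 0) := by
    intro θ
    simp only [hZ, sq, Finset.sum_mul_sum]
    rw [Finset.sum_comm]
    refine Finset.sum_congr rfl fun c _ => ?_
    rw [Finset.sum_comm]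
    refine Finset.sum_congr rfl fun c' _ => ?_
    rw [Finset.sum_eq_single (k θ c)]
    · simp only [eq_comm]; split_ifs <;> simp
    · intro b _ hb; simp [hb.symm]
    · simp
  refine Real.le_sqrt_of_sq_le ?_
  -- Cauchy-Schwarz over pairs (hash, bin), of total weight card K. The second moment of the bin
  -- masses counts collisions, by `hZ2`.
  have cs : (∑ x : Θ × K, μ x.1 * |τ / N - Z x.1 x.2|) ^ 2 ≤
      (∑ x : Θ × K, μ x.1) * ∑ x : Θ × K, μ x.1 * (τ / N - Z x.1 x.2) ^ 2 := by
    refine Finset.sum_sq_le_sum_mul_sum_of_sq_le_mul _ (fun x _ => hμ _)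
      (fun x _ => mul_nonneg (hμ _) (sq_nonneg _)) fun x _ => ?_
    rw [mul_pow, sq_abs]; exact le_of_eq (by ring)
  have e1 : ∑ x : Θ × K, μ x.1 = N := by
    rw [Fintype.sum_prod_type_right]; simp [hμ1, hN]
  have e2 : ∑ x : Θ × K, μ x.1 * |τ / N - Z x.1 x.2| = ∑ θ, μ θ * ∑ κ, |τ / N - Z θ κ| := by
    simp only [Fintype.sum_prod_type, Finset.mul_sum]
  have e3 : ∑ x : Θ × K, μ x.1 * (τ / N - Z x.1 x.2) ^ 2 =
      ∑ θ, μ θ * (∑ κ, Z θ κ ^ 2 - τ ^ 2 / N) := by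
    rw [Fintype.sum_prod_type]
    refine Finset.sum_congr rfl fun θ _ => ?_
    dsimp only
    rw [← Finset.mul_sum]
    congr 1
    simp only [sub_sq]
    rw [Finset.sum_add_distrib, Finset.sum_sub_distrib, ← Finset.mul_sum, hZs]
    simp only [Finset.sum_const, Finset.card_univ, nsmul_eq_mul, ← hN]
    field_simp
    ring
  rw [e1, e2, e3] at cs
  refine cs.trans_eq ?_
  simp only [hZ2, mul_sub, Finset.sum_sub_distrib, ← Finset.sum_mul, hμ1, Finset.mul_sum]
  have e4 : ∑ c, ∑ c', r c * r c' = τ ^ 2 := by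
    rw [sq, hτ, Finset.sum_mul_sum]
  rw [mul_one, one_mul, e4]
  congr 1
  · rw [Finset.sum_comm]
    refine Finset.sum_congr rfl fun c _ => ?_
    rw [Finset.sum_comm]
    refine Finset.sum_congr rfl fun c' _ => ?_
    refine Finset.sum_congr rfl fun θ _ => ?_
    ring
  · field_simp

/-- Leftover hashing for a two-layer hash, after discarding the complement of `T`. -/
theorem sum_abs_bin_sub_le [Nonempty G] [Nonempty G'] (μ : Θ → ℝ) (hμ : ∀ θ, 0 ≤ μ θ)
    (hμ1 : ∑ θ, μ θ = 1) (π : C → A) (k : Θ → A → G) (k' : Θ → C → G')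
    (hk : ∀ c c', π c ≠ π c' → ∑ θ, μ θ * (if k θ (π c) = k θ (π c') ∧ k' θ c = k' θ c' then 1 else 0)
      ≤ 1 / (Fintype.card G * Fintype.card G' : ℝ))
    (hk' : ∀ c c', c ≠ c' → ∑ θ, μ θ * (if k' θ c = k' θ c' then 1 else 0)
      ≤ 1 / (Fintype.card G' : ℝ))
    (q : C → ℝ) (hq : ∀ c, 0 ≤ q c) (hq1 : ∑ c, q c = 1) (T : Finset C) {x y : ℝ}
    (hx : ∀ a, ∑ c ∈ T with π c = a, q c ≤ x) (hy : ∀ c ∈ T, q c ≤ y) (hx0 : 0 ≤ x) (hy0 : 0 ≤ y) :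
    ∑ θ, μ θ * ∑ κ : G × G', |1 / (Fintype.card (G × G') : ℝ) -
        ∑ c, q c * (if (k θ (π c), k' θ c) = κ then 1 else 0)| ≤
      2 * ∑ c, (if c ∈ T then 0 else q c) + √((Fintype.card G - 1) * x
        + (Fintype.card G * Fintype.card G' - 1) * y) := by
  set N : ℝ := (Fintype.card (G × G') : ℝ) with hN
  have hNe : N = Fintype.card G * Fintype.card G' := by rw [hN, Fintype.card_prod]; push_cast; rfl
  have hG1 : (1 : ℝ) ≤ Fintype.card G := by exact_mod_cast Fintype.card_pos
  have hG'1 : (1 : ℝ) ≤ Fintype.card G' := by exact_mod_cast Fintype.card_pos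
  have hN1 : 1 ≤ N := by rw [hNe]; nlinarith
  -- `q` is split into its part `r` on `T`, to which the second-moment bound applies, and the
  -- discarded part `r'`.
  set r : C → ℝ := fun c => if c ∈ T then q c else 0 with hr
  set r' : C → ℝ := fun c => if c ∈ T then 0 else q c with hr'
  have hrr : ∀ c, q c = r c + r' c := fun c => by simp only [hr, hr']; split_ifs <;> simp
  have hr0 : ∀ c, 0 ≤ r c := fun c => by simp only [hr]; split_ifs <;> simp [hq]
  have hr'0 : ∀ c, 0 ≤ r' c := fun c => by simp only [hr']; split_ifs <;> simp [hq]
  have hrq : ∀ c, r c ≤ q c := fun c => by rw [hrr c]; linarith [hr'0 c]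
  have hsum : ∑ c, r c + ∑ c, r' c = 1 := by
    rw [← Finset.sum_add_distrib, ← hq1]; exact Finset.sum_congr rfl fun c _ => (hrr c).symm
  have main := sum_abs_bin_sub_le_sqrt μ hμ hμ1 (fun θ c => (k θ (π c), k' θ c)) r
  have hrad : ∑ c, ∑ c', r c * r c' * (N * (∑ θ, μ θ *
      (if (k θ (π c), k' θ c) = (k θ (π c'), k' θ c') then 1 else 0)) - 1) ≤
      (Fintype.card G - 1) * x + (Fintype.card G * Fintype.card G' - 1) * y := by
    -- A pair with distinct projections contributes at most 0, a pair c ≠ c' with equal projections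
    -- at most card G - 1, and the diagonal N - 1.
    have hterm : ∀ c c', N * (∑ θ, μ θ *
      (if (k θ (π c), k' θ c) = (k θ (π c'), k' θ c') then 1 else 0)) - 1 ≤
      (Fintype.card G - 1) * (if π c' = π c then 1 else 0) + (N - 1) * (if c' = c then 1 else 0) := by
      intro c c'
      by_cases h1 : π c' = π c
      · by_cases h2 : c' = c
        · subst h2
          simp [hμ1]
          exact Fintype.card_pos
        · have h3 := hk' c c' (Ne.symm h2)
          have h4 := mul_le_mul_of_nonneg_left h3 (zero_le_one.trans hN1)
          simp only [h1, h2, if_true, if_false, Prod.mk.injEq, true_and, mul_zero, add_zero]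
          have h5 : N * (1 / (Fintype.card G' : ℝ)) = Fintype.card G := by
            rw [hNe]; field_simp
          linarith
      · have h2 : c' ≠ c := fun h => h1 (by rw [h])
        have h3 := hk c c' (Ne.symm h1)
        have h4 := mul_le_mul_of_nonneg_left h3 (zero_le_one.trans hN1)
        simp only [h1, h2, if_false, Prod.mk.injEq, mul_zero, add_zero]
        have h5 : N * (1 / (Fintype.card G * Fintype.card G' : ℝ)) = 1 := by
            rw [← hNe]; field_simp
        linarith
    calc _ ≤ ∑ c, ∑ c', r c * r c' * ((Fintype.card G - 1) * (if π c' = π c then 1 else 0) +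
          (N - 1) * (if c' = c then 1 else 0)) :=
          Finset.sum_le_sum fun c _ => Finset.sum_le_sum fun c' _ =>
            mul_le_mul_of_nonneg_left (hterm c c') (mul_nonneg (hr0 c) (hr0 c'))
      _ = ∑ c, r c * ((Fintype.card G - 1) * (∑ c', if π c' = π c then r c' else 0) +
          (N - 1) * r c) := by
          refine Finset.sum_congr rfl fun c _ => ?_
          simp only [mul_add, Finset.sum_add_distrib, Finset.mul_sum]
          congr 1
          · refine Finset.sum_congr rfl fun c' _ => ?_
            split_ifs <;> ring
          · simp only [mul_ite, mul_one, mul_zero, Finset.sum_ite_eq', Finset.mem_univ, if_true]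
            ring
      _ ≤ ∑ c, r c * ((Fintype.card G - 1) * x + (N - 1) * y) := by
          refine Finset.sum_le_sum fun c _ => mul_le_mul_of_nonneg_left ?_ (hr0 c)
          refine add_le_add (mul_le_mul_of_nonneg_left ?_ (by linarith))
            (mul_le_mul_of_nonneg_left ?_ (by linarith))
          · refine le_trans (le_of_eq ?_) (hx (π c))
            simp only [hr, ← Finset.sum_filter, Finset.filter_filter]
            refine Finset.sum_congr ?_ fun _ _ => rfl
            ext c'; simp [and_comm]
          · simp only [hr]; split_ifs with h
            · exact hy c h
            · exact hy0
      _ = (∑ c, r c) * ((Fintype.card G - 1) * x + (N - 1) * y) := by rw [Finset.sum_mul]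
      _ ≤ 1 * ((Fintype.card G - 1) * x + (N - 1) * y) := by
          refine mul_le_mul_of_nonneg_right ?_ (add_nonneg (mul_nonneg (by linarith) hx0)
            (mul_nonneg (by linarith) hy0))
          have : 0 ≤ ∑ c, r' c := Finset.sum_nonneg fun c _ => hr'0 c
          linarith
      _ = _ := by rw [one_mul, hNe]
  have main2 := main.trans (Real.sqrt_le_sqrt hrad)
  refine le_trans ?_ (add_le_add_right main2 _)
  -- The discarded mass enters twice, in the uniform value and in the bins; this is the factor 2 in
  -- the conclusion.
  have hpt : ∀ θ (κ : G × G'), |1 / N - ∑ c, q c * (if (k θ (π c), k' θ c) = κ then 1 else 0)| ≤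
      ((∑ c, r' c) / N + ∑ c, r' c * (if (k θ (π c), k' θ c) = κ then 1 else 0)) +
      |(∑ c, r c) / N - ∑ c, r c * (if (k θ (π c), k' θ c) = κ then 1 else 0)| := by
    intro θ κ
    have e : 1 / N - ∑ c, q c * (if (k θ (π c), k' θ c) = κ then 1 else 0) =
      ((∑ c, r' c) / N - ∑ c, r' c * (if (k θ (π c), k' θ c) = κ then 1 else 0)) +
      ((∑ c, r c) / N - ∑ c, r c * (if (k θ (π c), k' θ c) = κ then 1 else 0)) := by
      simp only [hrr, add_mul, Finset.sum_add_distrib]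
      rw [← hsum, add_div]
      ring
    rw [e]
    refine (abs_add_le _ _).trans (add_le_add_left ?_ _)
    have n1 : 0 ≤ (∑ c, r' c) / N :=
      div_nonneg (Finset.sum_nonneg fun c _ => hr'0 c) (by linarith)
    have n2 : 0 ≤ ∑ c, r' c * (if (k θ (π c), k' θ c) = κ then (1 : ℝ) else 0) :=
      Finset.sum_nonneg fun c _ => mul_nonneg (hr'0 c) (by split_ifs <;> simp)
    rw [abs_le]
    constructor <;> linarith
  have hsumθ : ∀ θ, ∑ κ : G × G', ((∑ c, r' c) / N +
      ∑ c, r' c * (if (k θ (π c), k' θ c) = κ then 1 else 0)) = 2 * ∑ c, r' c := by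
    intro θ
    rw [Finset.sum_add_distrib, Finset.sum_comm (s := (Finset.univ : Finset (G × G')))]
    simp only [Finset.sum_const, Finset.card_univ, nsmul_eq_mul, ← hN, mul_ite, mul_one, mul_zero,
      Finset.sum_ite_eq, Finset.mem_univ, if_true]
    rw [mul_div_cancel₀ _ (by linarith : N ≠ 0)]
    ring
  calc _ ≤ ∑ θ, μ θ * ∑ κ : G × G', (((∑ c, r' c) / N +
      ∑ c, r' c * (if (k θ (π c), k' θ c) = κ then 1 else 0)) +
      |(∑ c, r c) / N - ∑ c, r c * (if (k θ (π c), k' θ c) = κ then 1 else 0)|) :=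
        Finset.sum_le_sum fun θ _ => mul_le_mul_of_nonneg_left
          (Finset.sum_le_sum fun κ _ => hpt θ κ) (hμ θ)
    _ = _ := by
      simp only [Finset.sum_add_distrib (s := (Finset.univ : Finset (G × G'))), mul_add,
        Finset.sum_add_distrib (s := (Finset.univ : Finset Θ))]
      congr 1
      simp only [← mul_add, ← Finset.sum_add_distrib (s := (Finset.univ : Finset Θ)),
        ← Finset.sum_add_distrib (s := (Finset.univ : Finset (G × G'))), hsumθ]
      rw [← Finset.sum_mul, hμ1, one_mul]

end Hashing

/-! ### One-shot two-stage coding by random binning. -/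

section OneShot

/-- A decoder that searches a list for an entry with the given hash. -/
theorem exists_listDecoder {V A H : Type*} [Nonempty A] (L : V → Finset A) (h : A → H) :
    ∃ D : H → V → A, ∀ v a, a ∈ L v → (∀ a' ∈ L v, h a' = h a → a' = a) → D (h a) v = a := by
  classical
  refine ⟨fun k v => if hk : ∃ a ∈ L v, h a = k then hk.choose else Classical.arbitrary A, ?_⟩
  intro v a ha hu
  have hk : ∃ a' ∈ L v, h a' = h a := ⟨a, ha, rfl⟩
  dsimp only
  rw [dif_pos hk]
  exact hu _ hk.choose_spec.1 hk.choose_spec.2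

/-- Removal of the common randomness `κ` and derandomization of the encoder. -/
theorem exists_encoder {Ω S C K : Type*} [Fintype Ω] [Fintype S] [Fintype C] [Fintype K]
    [DecidableEq K] [Nonempty C] [Nonempty K] (p : Ω → ℝ) (hp : ∀ ω, 0 ≤ p ω)
    (v : Ω → S) (q : S → C → ℝ) (hq : ∀ s c, 0 ≤ q s c) (κ : C → K)
    (bad : Ω → C → Prop) [∀ ω c, Decidable (bad ω c)] :
    ∃ (k : K) (e : S → C), ∑ ω, p ω * (if κ (e (v ω)) = k ∧ ¬ bad ω (e (v ω)) then 0 else 1) ≤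
      ∑ ω, p ω * ∑ c, q (v ω) c * (if bad ω c then 1 else 0) +
      ∑ ω, p ω * ∑ k, |1 / (Fintype.card K : ℝ) -
        ∑ c, q (v ω) c * (if κ c = k then 1 else 0)| := by
  classical
  -- Probability that the source is `s` and that the word `c` fails when the shared hash value is
  -- `k`, either by lying outside bin `k` or by being bad.
  set b : S → C → K → ℝ := fun s c k =>
    ∑ ω, if v ω = s then p ω * (if κ c = k ∧ ¬ bad ω c then 0 else 1) else 0 with hb
  -- The deterministic encoder picks the word of least failure probability, which is at most the
  -- average over bin `k`.
  have hmin : ∀ s k, ∃ c, ∀ c', b s c k ≤ b s c' k := fun s k =>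
    Finite.exists_min fun c => b s c k
  choose e he using hmin
  set m : S → K → ℝ := fun s k => b s (e s k) k with hm
  set pS : S → ℝ := law p v with hpS
  set Z : S → K → ℝ := fun s k => ∑ c, q s c * (if κ c = k then 1 else 0) with hZ
  set N : ℝ := (Fintype.card K : ℝ) with hN
  have hN0 : 0 < N := by rw [hN]; exact_mod_cast Fintype.card_pos
  have hm0 : ∀ s k, 0 ≤ m s k := fun s k => Finset.sum_nonneg fun ω _ => by
    split_ifs <;> simp [hp]
  have hmp : ∀ s k, m s k ≤ pS s := fun s k => Finset.sum_le_sum fun ω _ => by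
    by_cases h : v ω = s
    · simp only [h, if_true]
      split_ifs <;> simp [hp]
    · simp [h]
  have hZm : ∀ s k, Z s k * m s k ≤ ∑ c, (if κ c = k then 1 else 0) *
      (q s c * ∑ ω, if v ω = s then p ω * (if bad ω c then 1 else 0) else 0) := by
    intro s k
    simp only [hZ]
    rw [Finset.sum_mul]
    refine Finset.sum_le_sum fun c _ => ?_
    by_cases hc : κ c = k
    · simp only [hc, if_true, mul_one, one_mul]
      refine mul_le_mul_of_nonneg_left ((he s k c).trans (Finset.sum_le_sum fun ω _ => ?_)) (hq s c)
      by_cases h : v ω = s <;> simp [h, hc, ite_not]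
    · simp [hc]
  -- Change of measure: a uniform `k` is replaced by the true hash distribution `Z s`, at the cost
  -- of their distance.
  have hterm : ∀ s k, m s k / N ≤ Z s k * m s k + |1 / N - Z s k| * pS s := by
    intro s k
    have h1 : (1 / N - Z s k) * m s k ≤ |1 / N - Z s k| * m s k :=
      mul_le_mul_of_nonneg_right (le_abs_self _) (hm0 s k)
    have h2 := mul_le_mul_of_nonneg_left (hmp s k) (abs_nonneg (1 / N - Z s k))
    have h3 : m s k / N = Z s k * m s k + (1 / N - Z s k) * m s k := by ring
    linarith
  have e1 : ∑ k, ∑ s, m s k / N ≤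
      ∑ ω, p ω * ∑ c, q (v ω) c * (if bad ω c then 1 else 0) +
      ∑ ω, p ω * ∑ k, |1 / N - Z (v ω) k| := by
    calc ∑ k, ∑ s, m s k / N ≤ ∑ k, ∑ s, ((∑ c, (if κ c = k then 1 else 0) *
      (q s c * ∑ ω, if v ω = s then p ω * (if bad ω c then 1 else 0) else 0)) +
        |1 / N - Z s k| * pS s) := Finset.sum_le_sum fun k _ => Finset.sum_le_sum fun s _ =>
          (hterm s k).trans (add_le_add_left (hZm s k) _)
      _ = _ := by
        rw [Finset.sum_comm]
        simp only [Finset.sum_add_distrib]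
        congr 1
        · calc _ = ∑ s, ∑ c, (q s c * ∑ ω, if v ω = s then p ω * (if bad ω c then 1 else 0) else 0) := by
                refine Finset.sum_congr rfl fun s _ => ?_
                rw [Finset.sum_comm]
                refine Finset.sum_congr rfl fun c _ => ?_
                rw [← Finset.sum_mul]
                simp
            _ = ∑ s, ∑ ω, if v ω = s then p ω * ∑ c, q s c * (if bad ω c then 1 else 0) else 0 := by
                refine Finset.sum_congr rfl fun s _ => ?_
                simp only [Finset.mul_sum]
                rw [Finset.sum_comm]
                refine Finset.sum_congr rfl fun ω _ => ?_
                split_ifs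
                · refine Finset.sum_congr rfl fun c _ => ?_
                  ring
                · simp
            _ = _ := by
                rw [Finset.sum_comm]
                refine Finset.sum_congr rfl fun ω _ => ?_
                simp
        · simp only [← Finset.sum_mul]
          rw [← sum_law_mul p v fun s => ∑ k, |1 / N - Z s k|]
          exact Finset.sum_congr rfl fun s _ => mul_comm _ _
  -- The bound is written as an average over `k`, so that some fixed `k` satisfies it.
  have e2 : ∑ k : K, ∑ s, m s k / N ≤ ∑ _k : K, (∑ ω, p ω * ∑ c, q (v ω) c * (if bad ω c then 1 else 0) +
      ∑ ω, p ω * ∑ k, |1 / N - Z (v ω) k|) / N := by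
    rw [Finset.sum_const, Finset.card_univ, nsmul_eq_mul, ← hN, mul_div_cancel₀ _ hN0.ne']
    exact e1
  obtain ⟨k, -, hk⟩ := Finset.exists_le_of_sum_le Finset.univ_nonempty e2
  refine ⟨k, fun s => e s k, ?_⟩
  rw [← Finset.sum_div, div_le_div_iff_of_pos_right hN0] at hk
  refine le_trans (le_of_eq ?_) hk
  simp only [hm, hb]
  rw [Finset.sum_comm]
  refine Finset.sum_congr rfl fun ω _ => ?_
  simp

variable {Θ Ω S V₁ V₂ A C G Ka Kb G' Kc : Type*} [Fintype Θ] [Fintype Ω] [Fintype S]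
  [Fintype A] [Fintype C] [Fintype G] [Fintype G']
  [DecidableEq A] [DecidableEq C] [DecidableEq G] [DecidableEq Ka] [DecidableEq Kb]
  [DecidableEq G'] [DecidableEq Kc]

/-- Two-stage coding with fixed hash functions. -/
theorem exists_code_of_hash [Nonempty A] [Nonempty C] [Nonempty G] [Nonempty G']
    (p : Ω → ℝ) (hp : ∀ ω, 0 ≤ p ω)
    (v : Ω → S) (v₁ : Ω → V₁) (v₂ : Ω → V₂) (q : S → C → ℝ) (hq : ∀ s c, 0 ≤ q s c) (π : C → A)
    (L₁ : V₁ → Finset A) (L₂ : V₂ → Finset A) (L₃ : V₂ → A → Finset C)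
    (E : Ω → C → Prop) [∀ ω c, Decidable (E ω c)]
    (hG : A → G) (ha : A → Ka) (hb : A → Kb) (hG' : C → G') (hc : C → Kc) :
    ∃ (e₁ : S → Ka) (e₂ : S → Kb × Kc) (D₁ : Ka → V₁ → A) (D₂ : Ka → Kb × Kc → V₂ → C)
      (good : Ω → Prop) (_ : ∀ ω, Decidable (good ω)),
      (∀ ω, good ω → ∃ c, E ω c ∧ D₁ (e₁ (v ω)) (v₁ ω) = π c ∧
        D₂ (e₁ (v ω)) (e₂ (v ω)) (v₂ ω) = c) ∧
      ∑ ω, p ω * (if good ω then 0 else 1) ≤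
        ∑ ω, p ω * ∑ c, q (v ω) c *
          ((if E ω c ∧ π c ∈ L₁ (v₁ ω) ∧ π c ∈ L₂ (v₂ ω) ∧ c ∈ L₃ (v₂ ω) (π c) then 0 else 1) +
          ∑ a ∈ (L₁ (v₁ ω)).erase (π c), (if hG a = hG (π c) ∧ ha a = ha (π c) then 1 else 0) +
          ∑ a ∈ (L₂ (v₂ ω)).erase (π c),
            (if hG a = hG (π c) ∧ ha a = ha (π c) ∧ hb a = hb (π c) then 1 else 0) +
          ∑ c' ∈ (L₃ (v₂ ω) (π c)).erase c, (if hG' c' = hG' c ∧ hc c' = hc c then 1 else 0)) +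
        ∑ ω, p ω * ∑ k : G × G', |1 / (Fintype.card (G × G') : ℝ) -
          ∑ c, q (v ω) c * (if (hG (π c), hG' c) = k then 1 else 0)| := by
  classical
  obtain ⟨d₁, hd₁⟩ := exists_listDecoder L₁ fun a => (hG a, ha a)
  obtain ⟨d₂, hd₂⟩ := exists_listDecoder L₂ fun a => (hG a, ha a, hb a)
  obtain ⟨d₃, hd₃⟩ := exists_listDecoder (fun x : V₂ × A => L₃ x.1 x.2) fun c => (hG' c, hc c)
  -- The word is on all three lists and no other list entry shares its hash. The complement is
  -- estimated by a union bound over the offending entries.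
  set ok : Ω → C → Prop := fun ω c =>
    (E ω c ∧ π c ∈ L₁ (v₁ ω) ∧ π c ∈ L₂ (v₂ ω) ∧ c ∈ L₃ (v₂ ω) (π c)) ∧
    (∀ a ∈ (L₁ (v₁ ω)).erase (π c), ¬ (hG a = hG (π c) ∧ ha a = ha (π c))) ∧
    (∀ a ∈ (L₂ (v₂ ω)).erase (π c), ¬ (hG a = hG (π c) ∧ ha a = ha (π c) ∧ hb a = hb (π c))) ∧
    (∀ c' ∈ (L₃ (v₂ ω) (π c)).erase c, ¬ (hG' c' = hG' c ∧ hc c' = hc c)) with hok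
  obtain ⟨k, e, he⟩ := exists_encoder p hp v q hq (fun c => (hG (π c), hG' c)) fun ω c => ¬ ok ω c
  refine ⟨fun s => ha (π (e s)), fun s => (hb (π (e s)), hc (e s)),
    fun ka w => d₁ (k.1, ka) w,
    fun ka kbc w => d₃ (k.2, kbc.2) (w, d₂ (k.1, ka, kbc.1) w),
    fun ω => (hG (π (e (v ω))), hG' (e (v ω))) = k ∧ ¬¬ ok ω (e (v ω)), fun _ => inferInstance,
    ?_, he.trans (add_le_add_left (Finset.sum_le_sum fun ω _ => mul_le_mul_of_nonneg_left
      (Finset.sum_le_sum fun c _ => mul_le_mul_of_nonneg_left ?_ (hq _ _)) (hp ω)) _)⟩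
  · rintro ω ⟨rfl, h⟩
    obtain ⟨⟨h1, h2, h3, h4⟩, h5, h6, h7⟩ := not_not.1 h
    refine ⟨e (v ω), h1, ?_, ?_⟩
    · refine hd₁ _ _ h2 fun a' ha' hh => ?_
      by_contra hne
      exact h5 a' (Finset.mem_erase.2 ⟨hne, ha'⟩) (by simpa using hh)
    · have := hd₂ _ _ h3 fun a' ha' hh => by
        by_contra hne
        exact h6 a' (Finset.mem_erase.2 ⟨hne, ha'⟩) (by simpa using hh)
      dsimp only at this ⊢
      rw [this]
      refine hd₃ (v₂ ω, π (e (v ω))) _ h4 fun a' ha' hh => ?_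
      by_contra hne
      exact h7 a' (Finset.mem_erase.2 ⟨hne, ha'⟩) (by simpa using hh)
  · have n1 : ∀ (t : Finset A) (P : A → Prop) [DecidablePred P],
        (0 : ℝ) ≤ ∑ a ∈ t, if P a then 1 else 0 := fun t P _ =>
      Finset.sum_nonneg fun a _ => by split_ifs <;> simp
    have n2 : ∀ (t : Finset C) (P : C → Prop) [DecidablePred P],
        (0 : ℝ) ≤ ∑ a ∈ t, if P a then 1 else 0 := fun t P _ =>
      Finset.sum_nonneg fun a _ => by split_ifs <;> simp
    have s1 : ∀ (t : Finset A) (P : A → Prop) [DecidablePred P], (∃ a ∈ t, P a) →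
        (1 : ℝ) ≤ ∑ a ∈ t, if P a then 1 else 0 := by
      rintro t P _ ⟨a, hat, hPa⟩
      refine le_trans (by simp [hPa]) (Finset.single_le_sum (f := fun a => if P a then (1 : ℝ) else 0)
        (fun a _ => by split_ifs <;> simp) hat)
    have s2 : ∀ (t : Finset C) (P : C → Prop) [DecidablePred P], (∃ a ∈ t, P a) →
        (1 : ℝ) ≤ ∑ a ∈ t, if P a then 1 else 0 := by
      rintro t P _ ⟨a, hat, hPa⟩
      refine le_trans (by simp [hPa]) (Finset.single_le_sum (f := fun a => if P a then (1 : ℝ) else 0)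
        (fun a _ => by split_ifs <;> simp) hat)
    have m1 := n1 ((L₁ (v₁ ω)).erase (π c)) fun a => hG a = hG (π c) ∧ ha a = ha (π c)
    have m2 := n1 ((L₂ (v₂ ω)).erase (π c)) fun a =>
      hG a = hG (π c) ∧ ha a = ha (π c) ∧ hb a = hb (π c)
    have m3 := n2 ((L₃ (v₂ ω) (π c)).erase c) fun c' => hG' c' = hG' c ∧ hc c' = hc c
    by_cases hbad : ok ω c
    · rw [if_neg (not_not.2 hbad)]
      have : (0 : ℝ) ≤ if E ω c ∧ π c ∈ L₁ (v₁ ω) ∧ π c ∈ L₂ (v₂ ω) ∧ c ∈ L₃ (v₂ ω) (π c)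
        then 0 else 1 := by split_ifs <;> simp
      linarith
    · rw [if_pos hbad]
      by_cases h0 : E ω c ∧ π c ∈ L₁ (v₁ ω) ∧ π c ∈ L₂ (v₂ ω) ∧ c ∈ L₃ (v₂ ω) (π c)
      · rw [if_pos h0]
        simp only [hok, h0, true_and, not_and_or, not_forall, exists_prop] at hbad
        simp only [← not_and_or, not_not] at hbad
        rcases hbad with h | h | h
        · have h := s1 ((L₁ (v₁ ω)).erase (π c)) (fun a => hG a = hG (π c) ∧ ha a = ha (π c)) h
          linarith
        · have h := s1 ((L₂ (v₂ ω)).erase (π c))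
            (fun a => hG a = hG (π c) ∧ ha a = ha (π c) ∧ hb a = hb (π c)) h
          linarith
        · have h := s2 ((L₃ (v₂ ω) (π c)).erase c) (fun c' => hG' c' = hG' c ∧ hc c' = hc c) h
          linarith
      · rw [if_neg h0]
        linarith

theorem weighted_sum_comm {Θ Ω : Type*} [Fintype Θ] [Fintype Ω] (μ : Θ → ℝ) (p : Ω → ℝ)
    (f : Θ → Ω → ℝ) : ∑ θ, μ θ * ∑ ω, p ω * f θ ω = ∑ ω, p ω * ∑ θ, μ θ * f θ ω := by
  simp only [Finset.mul_sum]
  rw [Finset.sum_comm]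
  exact Finset.sum_congr rfl fun ω _ => Finset.sum_congr rfl fun θ _ => by ring

theorem sum_weighted_sum_le {Θ B : Type*} [Fintype Θ] (μ : Θ → ℝ) (t : Finset B)
    (g : Θ → B → ℝ) (z β : ℝ) (hz : 0 ≤ z) (ht : (t.card : ℝ) ≤ β)
    (h : ∀ b ∈ t, ∑ θ, μ θ * g θ b ≤ z) : ∑ θ, μ θ * ∑ b ∈ t, g θ b ≤ β * z := by
  simp only [Finset.mul_sum]
  rw [Finset.sum_comm]
  calc _ ≤ ∑ b ∈ t, z := Finset.sum_le_sum h
    _ = t.card * z := by rw [Finset.sum_const, nsmul_eq_mul]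
    _ ≤ β * z := mul_le_mul_of_nonneg_right ht hz

theorem card_erase_le_of_card_le {B : Type*} [DecidableEq B] {t : Finset B} (b : B) (β : ℝ)
    (h : (t.card : ℝ) ≤ β) : ((t.erase b).card : ℝ) ≤ β :=
  le_trans (by exact_mod_cast Finset.card_le_card (Finset.erase_subset _ _)) h

/-- Independence of five uniform hash functions; factors equal to 1 integrate out, which yields the
joint collision probabilities. -/
theorem sum_prod_five {B₁ B₂ B₃ B₄ B₅ : Type*} [Fintype B₁] [Fintype B₂] [Fintype B₃] [Fintype B₄]
    [Fintype B₅] (u₁ u₂ u₃ u₄ u₅ : ℝ) (f₁ : B₁ → ℝ) (f₂ : B₂ → ℝ) (f₃ : B₃ → ℝ) (f₄ : B₄ → ℝ)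
    (f₅ : B₅ → ℝ) :
    ∑ b : B₁ × B₂ × B₃ × B₄ × B₅, (u₁ * (u₂ * (u₃ * (u₄ * u₅)))) *
      (f₁ b.1 * (f₂ b.2.1 * (f₃ b.2.2.1 * (f₄ b.2.2.2.1 * f₅ b.2.2.2.2)))) =
    (∑ b, u₁ * f₁ b) * ((∑ b, u₂ * f₂ b) * ((∑ b, u₃ * f₃ b) * ((∑ b, u₄ * f₄ b) *
      ∑ b, u₅ * f₅ b))) := by
  simp only [Fintype.sum_prod_type, Finset.sum_mul_sum]
  refine Finset.sum_congr rfl fun _ _ => Finset.sum_congr rfl fun _ _ => ?_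
  simp only [Finset.mul_sum]
  refine Finset.sum_congr rfl fun _ _ => Finset.sum_congr rfl fun _ _ =>
    Finset.sum_congr rfl fun _ _ => ?_
  ring

/-- Two-stage coding with a random hash, in terms of collision probabilities. -/
theorem exists_code_of_random_hash [Nonempty A] [Nonempty C] [Nonempty G] [Nonempty G']
    (p : Ω → ℝ) (hp : ∀ ω, 0 ≤ p ω) (hp1 : ∑ ω, p ω = 1)
    (v : Ω → S) (v₁ : Ω → V₁) (v₂ : Ω → V₂) (q : S → C → ℝ) (hq : ∀ s c, 0 ≤ q s c)
    (hq1 : ∀ s, ∑ c, q s c = 1) (π : C → A)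
    (L₁ : V₁ → Finset A) (L₂ : V₂ → Finset A) (L₃ : V₂ → A → Finset C) (T : S → Finset C)
    (E : Ω → C → Prop) [∀ ω c, Decidable (E ω c)]
    (μ : Θ → ℝ) (hμ : ∀ θ, 0 ≤ μ θ) (hμ1 : ∑ θ, μ θ = 1)
    (hG : Θ → A → G) (ha : Θ → A → Ka) (hb : Θ → A → Kb) (hG' : Θ → C → G') (hc : Θ → C → Kc)
    {β₁ β₂ β₃ x₁ x₂ x₃ x y : ℝ} (hx₁0 : 0 ≤ x₁) (hx₂0 : 0 ≤ x₂) (hx₃0 : 0 ≤ x₃)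
    (hβ₁ : ∀ w, ((L₁ w).card : ℝ) ≤ β₁) (hβ₂ : ∀ w, ((L₂ w).card : ℝ) ≤ β₂)
    (hβ₃ : ∀ w a, ((L₃ w a).card : ℝ) ≤ β₃)
    (hx₁ : ∀ a a', a ≠ a' →
      ∑ θ, μ θ * (if hG θ a = hG θ a' ∧ ha θ a = ha θ a' then 1 else 0) ≤ x₁)
    (hx₂ : ∀ a a', a ≠ a' → ∑ θ, μ θ *
      (if hG θ a = hG θ a' ∧ ha θ a = ha θ a' ∧ hb θ a = hb θ a' then 1 else 0) ≤ x₂)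
    (hx₃ : ∀ c c', c ≠ c' →
      ∑ θ, μ θ * (if hG' θ c = hG' θ c' ∧ hc θ c = hc θ c' then 1 else 0) ≤ x₃)
    (hk : ∀ c c', π c ≠ π c' →
      ∑ θ, μ θ * (if hG θ (π c) = hG θ (π c') ∧ hG' θ c = hG' θ c' then 1 else 0)
      ≤ 1 / (Fintype.card G * Fintype.card G' : ℝ))
    (hk' : ∀ c c', c ≠ c' → ∑ θ, μ θ * (if hG' θ c = hG' θ c' then 1 else 0)
      ≤ 1 / (Fintype.card G' : ℝ))
    (hx : ∀ s a, ∑ c ∈ T s with π c = a, q s c ≤ x) (hy : ∀ s, ∀ c ∈ T s, q s c ≤ y)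
    (hx0 : 0 ≤ x) (hy0 : 0 ≤ y) :
    ∃ (e₁ : S → Ka) (e₂ : S → Kb × Kc) (D₁ : Ka → V₁ → A) (D₂ : Ka → Kb × Kc → V₂ → C)
      (good : Ω → Prop) (_ : ∀ ω, Decidable (good ω)),
      (∀ ω, good ω → ∃ c, E ω c ∧ D₁ (e₁ (v ω)) (v₁ ω) = π c ∧
        D₂ (e₁ (v ω)) (e₂ (v ω)) (v₂ ω) = c) ∧
      ∑ ω, p ω * (if good ω then 0 else 1) ≤
        ∑ ω, p ω * ∑ c, q (v ω) c *
          (if E ω c ∧ π c ∈ L₁ (v₁ ω) ∧ π c ∈ L₂ (v₂ ω) ∧ c ∈ L₃ (v₂ ω) (π c) then 0 else 1) +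
        (β₁ * x₁ + β₂ * x₂ + β₃ * x₃) +
        2 * ∑ ω, p ω * ∑ c, q (v ω) c * (if c ∈ T (v ω) then 0 else 1) +
        √((Fintype.card G - 1) * x + (Fintype.card G * Fintype.card G' - 1) * y) := by
  classical
  set Φ : Θ → Ω → C → ℝ := fun θ ω c =>
    (if E ω c ∧ π c ∈ L₁ (v₁ ω) ∧ π c ∈ L₂ (v₂ ω) ∧ c ∈ L₃ (v₂ ω) (π c) then 0 else 1) +
          ∑ a ∈ (L₁ (v₁ ω)).erase (π c),
            (if hG θ a = hG θ (π c) ∧ ha θ a = ha θ (π c) then 1 else 0) +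
          ∑ a ∈ (L₂ (v₂ ω)).erase (π c),
            (if hG θ a = hG θ (π c) ∧ ha θ a = ha θ (π c) ∧ hb θ a = hb θ (π c) then 1 else 0) +
          ∑ c' ∈ (L₃ (v₂ ω) (π c)).erase c,
            (if hG' θ c' = hG' θ c ∧ hc θ c' = hc θ c then 1 else 0) with hΦ
  set Ψ : Θ → Ω → ℝ := fun θ ω => ∑ k : G × G', |1 / (Fintype.card (G × G') : ℝ) -
          ∑ c, q (v ω) c * (if (hG θ (π c), hG' θ c) = k then 1 else 0)| with hΨ
  set R := √((Fintype.card G - 1) * x + (Fintype.card G * Fintype.card G' - 1) * y) with hR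
  -- The expected number of false list entries is at most list size times collision probability.
  have hΦb : ∀ ω c, ∑ θ, μ θ * Φ θ ω c ≤
      (if E ω c ∧ π c ∈ L₁ (v₁ ω) ∧ π c ∈ L₂ (v₂ ω) ∧ c ∈ L₃ (v₂ ω) (π c) then 0 else 1) +
      (β₁ * x₁ + β₂ * x₂ + β₃ * x₃) := by
    intro ω c
    simp only [hΦ, mul_add, Finset.sum_add_distrib]
    rw [← Finset.sum_mul, hμ1, one_mul]
    have a1 := sum_weighted_sum_le μ ((L₁ (v₁ ω)).erase (π c)) (fun θ a =>
      if hG θ a = hG θ (π c) ∧ ha θ a = ha θ (π c) then 1 else 0) x₁ β₁ hx₁0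
      (card_erase_le_of_card_le _ _ (hβ₁ _))
      fun a h => hx₁ a _ (Finset.ne_of_mem_erase h)
    have a2 := sum_weighted_sum_le μ ((L₂ (v₂ ω)).erase (π c)) (fun θ a =>
      if hG θ a = hG θ (π c) ∧ ha θ a = ha θ (π c) ∧ hb θ a = hb θ (π c) then 1 else 0) x₂ β₂ hx₂0
      (card_erase_le_of_card_le _ _ (hβ₂ _)) fun a h => hx₂ a _ (Finset.ne_of_mem_erase h)
    have a3 := sum_weighted_sum_le μ ((L₃ (v₂ ω) (π c)).erase c) (fun θ c' =>
      if hG' θ c' = hG' θ c ∧ hc θ c' = hc θ c then 1 else 0) x₃ β₃ hx₃0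
      (card_erase_le_of_card_le _ _ (hβ₃ _ _))
      fun a h => hx₃ _ _ (Finset.ne_of_mem_erase h)
    linarith
  have avg : ∑ θ, μ θ * (∑ ω, p ω * ∑ c, q (v ω) c * Φ θ ω c + ∑ ω, p ω * Ψ θ ω) ≤
      ∑ ω, p ω * ∑ c, q (v ω) c *
          (if E ω c ∧ π c ∈ L₁ (v₁ ω) ∧ π c ∈ L₂ (v₂ ω) ∧ c ∈ L₃ (v₂ ω) (π c) then 0 else 1) +
        (β₁ * x₁ + β₂ * x₂ + β₃ * x₃) +
        2 * ∑ ω, p ω * ∑ c, q (v ω) c * (if c ∈ T (v ω) then 0 else 1) + R := by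
    simp only [mul_add, Finset.sum_add_distrib]
    have i1 : ∑ θ, μ θ * ∑ ω, p ω * ∑ c, q (v ω) c * Φ θ ω c ≤
        ∑ ω, p ω * ∑ c, q (v ω) c *
          (if E ω c ∧ π c ∈ L₁ (v₁ ω) ∧ π c ∈ L₂ (v₂ ω) ∧ c ∈ L₃ (v₂ ω) (π c) then 0 else 1) +
        (β₁ * x₁ + β₂ * x₂ + β₃ * x₃) := by
      rw [weighted_sum_comm μ p]
      simp only [weighted_sum_comm μ]
      calc _ ≤ ∑ ω, p ω * ∑ c, q (v ω) c *
          ((if E ω c ∧ π c ∈ L₁ (v₁ ω) ∧ π c ∈ L₂ (v₂ ω) ∧ c ∈ L₃ (v₂ ω) (π c) then 0 else 1) +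
            (β₁ * x₁ + β₂ * x₂ + β₃ * x₃)) :=
          Finset.sum_le_sum fun ω _ => mul_le_mul_of_nonneg_left (Finset.sum_le_sum fun c _ =>
            mul_le_mul_of_nonneg_left (hΦb ω c) (hq _ _)) (hp ω)
        _ = _ := by
          simp only [mul_add _ _ (β₁ * x₁ + β₂ * x₂ + β₃ * x₃), Finset.sum_add_distrib,
            ← Finset.sum_mul, hq1, hp1, one_mul]
    have i2 : ∑ θ, μ θ * ∑ ω, p ω * Ψ θ ω ≤
        2 * ∑ ω, p ω * ∑ c, q (v ω) c * (if c ∈ T (v ω) then 0 else 1) + R := by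
      rw [weighted_sum_comm μ p]
      calc _ ≤ ∑ ω, p ω * (2 * ∑ c, (if c ∈ T (v ω) then 0 else q (v ω) c) + R) :=
            Finset.sum_le_sum fun ω _ => mul_le_mul_of_nonneg_left
              (sum_abs_bin_sub_le μ hμ hμ1 π hG hG' hk hk' (q (v ω)) (hq _) (hq1 _) (T (v ω))
                (hx _) (hy _) hx0 hy0) (hp ω)
        _ = _ := by
          simp only [mul_add, Finset.sum_add_distrib, ← Finset.sum_mul, hp1, one_mul]
          congr 1
          rw [Finset.mul_sum]
          refine Finset.sum_congr rfl fun ω _ => ?_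
          rw [mul_left_comm]
          simp only [mul_ite, mul_one, mul_zero]
    linarith
  have : ∃ θ, ∑ ω, p ω * ∑ c, q (v ω) c * Φ θ ω c + ∑ ω, p ω * Ψ θ ω ≤
      ∑ ω, p ω * ∑ c, q (v ω) c *
          (if E ω c ∧ π c ∈ L₁ (v₁ ω) ∧ π c ∈ L₂ (v₂ ω) ∧ c ∈ L₃ (v₂ ω) (π c) then 0 else 1) +
        (β₁ * x₁ + β₂ * x₂ + β₃ * x₃) +
        2 * ∑ ω, p ω * ∑ c, q (v ω) c * (if c ∈ T (v ω) then 0 else 1) + R := by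
    by_contra hcon
    push Not at hcon
    -- A hash of positive weight makes the averaged inequality strict, which gives the
    -- contradiction.
    obtain ⟨θ₀, -, hθ₀⟩ : ∃ θ ∈ Finset.univ, 0 < μ θ := by
      refine Finset.exists_lt_of_sum_lt (f := fun _ => (0 : ℝ)) ?_
      simp [hμ1]
    have := Finset.sum_lt_sum (s := Finset.univ)
      (fun θ _ => mul_le_mul_of_nonneg_left (hcon θ).le (hμ θ))
      ⟨θ₀, Finset.mem_univ _, mul_lt_mul_of_pos_left (hcon θ₀) hθ₀⟩
    rw [← Finset.sum_mul, hμ1, one_mul] at this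
    linarith
  obtain ⟨θ, hθ⟩ := this
  obtain ⟨e₁, e₂, D₁, D₂, good, dg, h1, h2⟩ := exists_code_of_hash p hp v v₁ v₂ q hq π L₁ L₂ L₃ E
    (hG θ) (ha θ) (hb θ) (hG' θ) (hc θ)
  exact ⟨e₁, e₂, D₁, D₂, good, dg, h1, h2.trans hθ⟩

/-- One-shot two-stage coding. -/
theorem exists_code_one_shot [Nonempty A] [Nonempty C] [Nonempty G] [Nonempty G']
    [Fintype Ka] [Fintype Kb] [Fintype Kc] [Nonempty Ka] [Nonempty Kb] [Nonempty Kc]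
    (p : Ω → ℝ) (hp : ∀ ω, 0 ≤ p ω) (hp1 : ∑ ω, p ω = 1)
    (v : Ω → S) (v₁ : Ω → V₁) (v₂ : Ω → V₂) (q : S → C → ℝ) (hq : ∀ s c, 0 ≤ q s c)
    (hq1 : ∀ s, ∑ c, q s c = 1) (π : C → A)
    (L₁ : V₁ → Finset A) (L₂ : V₂ → Finset A) (L₃ : V₂ → A → Finset C) (T : S → Finset C)
    (E : Ω → C → Prop) [∀ ω c, Decidable (E ω c)]
    {β₁ β₂ β₃ x y : ℝ}
    (hβ₁ : ∀ w, ((L₁ w).card : ℝ) ≤ β₁) (hβ₂ : ∀ w, ((L₂ w).card : ℝ) ≤ β₂)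
    (hβ₃ : ∀ w a, ((L₃ w a).card : ℝ) ≤ β₃)
    (hx : ∀ s a, ∑ c ∈ T s with π c = a, q s c ≤ x) (hy : ∀ s, ∀ c ∈ T s, q s c ≤ y)
    (hx0 : 0 ≤ x) (hy0 : 0 ≤ y) :
    ∃ (e₁ : S → Ka) (e₂ : S → Kb × Kc) (D₁ : Ka → V₁ → A) (D₂ : Ka → Kb × Kc → V₂ → C)
      (good : Ω → Prop) (_ : ∀ ω, Decidable (good ω)),
      (∀ ω, good ω → ∃ c, E ω c ∧ D₁ (e₁ (v ω)) (v₁ ω) = π c ∧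
        D₂ (e₁ (v ω)) (e₂ (v ω)) (v₂ ω) = c) ∧
      ∑ ω, p ω * (if good ω then 0 else 1) ≤
        ∑ ω, p ω * ∑ c, q (v ω) c *
          (if E ω c ∧ π c ∈ L₁ (v₁ ω) ∧ π c ∈ L₂ (v₂ ω) ∧ c ∈ L₃ (v₂ ω) (π c) then 0 else 1) +
        (β₁ / (Fintype.card G * Fintype.card Ka) +
          β₂ / (Fintype.card G * Fintype.card Ka * Fintype.card Kb) +
          β₃ / (Fintype.card G' * Fintype.card Kc)) +
        2 * ∑ ω, p ω * ∑ c, q (v ω) c * (if c ∈ T (v ω) then 0 else 1) +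
        √((Fintype.card G - 1) * x + (Fintype.card G * Fintype.card G' - 1) * y) := by
  classical
  have key := exists_code_of_random_hash (Θ := (A → G) × (A → Ka) × (A → Kb) × (C → G') × (C → Kc))
    p hp hp1 v v₁ v₂ q hq hq1 π L₁ L₂ L₃ T E
    (fun _ => unifWeight (A → G) * (unifWeight (A → Ka) * (unifWeight (A → Kb) *
      (unifWeight (C → G') * unifWeight (C → Kc)))))
    (fun _ => mul_nonneg (unifWeight_nonneg _) (mul_nonneg (unifWeight_nonneg _)
      (mul_nonneg (unifWeight_nonneg _) (mul_nonneg (unifWeight_nonneg _) (unifWeight_nonneg _)))))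
    (by
      have := sum_prod_five (B₁ := A → G) (B₂ := A → Ka) (B₃ := A → Kb)
        (B₄ := C → G') (B₅ := C → Kc) (unifWeight (A → G)) (unifWeight (A → Ka)) (unifWeight (A → Kb))
        (unifWeight (C → G')) (unifWeight (C → Kc)) (fun _ => 1) (fun _ => 1) (fun _ => 1)
        (fun _ => 1) (fun _ => 1)
      simpa only [mul_one, sum_unifWeight] using this)
    (fun θ => θ.1) (fun θ => θ.2.1) (fun θ => θ.2.2.1) (fun θ => θ.2.2.2.1) (fun θ => θ.2.2.2.2)
    (β₁ := β₁) (β₂ := β₂) (β₃ := β₃)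
    (x₁ := 1 / Fintype.card G * (1 / Fintype.card Ka))
    (x₂ := 1 / Fintype.card G * (1 / Fintype.card Ka * (1 / Fintype.card Kb)))
    (x₃ := 1 / Fintype.card G' * (1 / Fintype.card Kc)) (x := x) (y := y)
    (by positivity) (by positivity) (by positivity) hβ₁ hβ₂ hβ₃
    ?_ ?_ ?_ ?_ ?_ hx hy hx0 hy0
  · obtain ⟨e₁, e₂, D₁, D₂, good, dg, h1, h2⟩ := key
    refine ⟨e₁, e₂, D₁, D₂, good, dg, h1, h2.trans (le_of_eq ?_)⟩
    congr 4 <;> ring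
  · intro a a' h
    refine le_of_eq ?_
    have := sum_prod_five (B₁ := A → G) (B₂ := A → Ka) (B₃ := A → Kb)
        (B₄ := C → G') (B₅ := C → Kc) (unifWeight (A → G)) (unifWeight (A → Ka)) (unifWeight (A → Kb))
      (unifWeight (C → G')) (unifWeight (C → Kc))
      (fun f => if f a = f a' then 1 else 0)
      (fun f => if f a = f a' then 1 else 0)
      (fun _ => 1)
      (fun _ => 1)
      (fun _ => 1)
    simp only [mul_one, sum_unifWeight, sum_unifWeight_collision h] at this
    rw [← this]
    refine Finset.sum_congr rfl fun θ _ => ?_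
    congr 1
    split_ifs <;> simp_all
  · intro a a' h
    refine le_of_eq ?_
    have := sum_prod_five (B₁ := A → G) (B₂ := A → Ka) (B₃ := A → Kb)
        (B₄ := C → G') (B₅ := C → Kc) (unifWeight (A → G)) (unifWeight (A → Ka)) (unifWeight (A → Kb))
      (unifWeight (C → G')) (unifWeight (C → Kc))
      (fun f => if f a = f a' then 1 else 0)
      (fun f => if f a = f a' then 1 else 0)
      (fun f => if f a = f a' then 1 else 0)
      (fun _ => 1)
      (fun _ => 1)
    simp only [mul_one, sum_unifWeight, sum_unifWeight_collision h] at this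
    rw [← this]
    refine Finset.sum_congr rfl fun θ _ => ?_
    congr 1
    split_ifs <;> simp_all
  · intro a a' h
    refine le_of_eq ?_
    have := sum_prod_five (B₁ := A → G) (B₂ := A → Ka) (B₃ := A → Kb)
        (B₄ := C → G') (B₅ := C → Kc) (unifWeight (A → G)) (unifWeight (A → Ka)) (unifWeight (A → Kb))
      (unifWeight (C → G')) (unifWeight (C → Kc))
      (fun _ => 1)
      (fun _ => 1)
      (fun _ => 1)
      (fun f => if f a = f a' then 1 else 0)
      (fun f => if f a = f a' then 1 else 0)
    simp only [mul_one, one_mul, sum_unifWeight, sum_unifWeight_collision h] at this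
    rw [← this]
    refine Finset.sum_congr rfl fun θ _ => ?_
    congr 1
    split_ifs <;> simp_all
  · intro a a' h
    refine le_of_eq ?_
    have := sum_prod_five (B₁ := A → G) (B₂ := A → Ka) (B₃ := A → Kb)
        (B₄ := C → G') (B₅ := C → Kc) (unifWeight (A → G)) (unifWeight (A → Ka)) (unifWeight (A → Kb))
      (unifWeight (C → G')) (unifWeight (C → Kc))
      (fun f => if f (π a) = f (π a') then 1 else 0)
      (fun _ => 1)
      (fun _ => 1)
      (fun f => if f a = f a' then 1 else 0)
      (fun _ => 1)
    simp only [mul_one, one_mul, sum_unifWeight, sum_unifWeight_collision h,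
      sum_unifWeight_collision (fun e => h (congrArg π e) : a ≠ a')] at this
    rw [← one_div_mul_one_div]
    rw [← this]
    refine Finset.sum_congr rfl fun θ _ => ?_
    congr 1
    split_ifs <;> simp_all
  · intro a a' h
    refine le_of_eq ?_
    have := sum_prod_five (B₁ := A → G) (B₂ := A → Ka) (B₃ := A → Kb)
        (B₄ := C → G') (B₅ := C → Kc) (unifWeight (A → G)) (unifWeight (A → Ka)) (unifWeight (A → Kb))
      (unifWeight (C → G')) (unifWeight (C → Kc))
      (fun _ => 1)
      (fun _ => 1)
      (fun _ => 1)
      (fun f => if f a = f a' then 1 else 0)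
      (fun _ => 1)
    simp only [mul_one, one_mul, sum_unifWeight, sum_unifWeight_collision h] at this
    rw [← this]

end OneShot

/-! ### Independent copies: weak law, equipartition, list sizes. -/

section IID

variable {Γ α β : Type*} [Fintype Γ]

theorem iidLaw_nonneg {p : Γ → ℝ} (hp : ∀ s, 0 ≤ p s) (n : ℕ) (s : Fin n → Γ) :
    0 ≤ iidLaw p n s := Finset.prod_nonneg fun _ _ => hp _

theorem sum_iidLaw (p : Γ → ℝ) (n : ℕ) : ∑ s, iidLaw p n s = (∑ a, p a) ^ n := by
  classical
  have := Finset.prod_univ_sum (fun _ : Fin n => (Finset.univ : Finset Γ)) fun _ a => p a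
  simp only [Finset.prod_const, Finset.card_univ, Fintype.card_fin, Fintype.piFinset_univ] at this
  exact this.symm

theorem iidLaw_mem_stdSimplex {p : Γ → ℝ} (hp : p ∈ stdSimplex ℝ Γ) (n : ℕ) :
    iidLaw p n ∈ stdSimplex ℝ (Fin n → Γ) :=
  ⟨iidLaw_nonneg hp.1 n, by rw [sum_iidLaw, hp.2, one_pow]⟩

theorem law_iidLaw (p : Γ → ℝ) (n : ℕ) (f : Γ → α) :
    law (iidLaw p n) (fun s i => f (s i)) = iidLaw (law p f) n := by
  classical
  funext t
  have := Finset.prod_univ_sum (fun _ : Fin n => (Finset.univ : Finset Γ))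
    fun i a => if f a = t i then p a else 0
  simp only [Fintype.piFinset_univ] at this
  simp only [iidLaw, law]
  rw [this]
  refine Finset.sum_congr rfl fun s _ => ?_
  by_cases h : ∀ i, f (s i) = t i
  · rw [if_pos (funext h)]
    exact Finset.prod_congr rfl fun i _ => by rw [if_pos (h i)]
  · rw [if_neg fun h' => h fun i => congrFun h' i]
    push Not at h
    obtain ⟨i, hi⟩ := h
    exact (Finset.prod_eq_zero (Finset.mem_univ i) (by rw [if_neg hi])).symm

/-- Isolating coordinate `i` of an i.i.d. block. -/
theorem sum_iidLaw_insertNth (p : Γ → ℝ) (n : ℕ) (i : Fin (n + 1)) (F : (Fin (n + 1) → Γ) → ℝ) :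
    ∑ s, iidLaw p (n + 1) s * F s =
      ∑ a, p a * ∑ s, iidLaw p n s * F (i.insertNth a s) := by
  rw [← (Fin.insertNthEquiv (fun _ => Γ) i).sum_comp, Fintype.sum_prod_type]
  refine Finset.sum_congr rfl fun a _ => ?_
  rw [Finset.mul_sum]
  refine Finset.sum_congr rfl fun s _ => ?_
  change iidLaw p (n + 1) (i.insertNth a s) * F (i.insertNth a s) = _
  simp only [iidLaw]
  rw [Fin.prod_univ_succAbove _ i]
  simp [mul_assoc]

theorem expect_iidLaw_coord {p : Γ → ℝ} (hp : ∑ a, p a = 1) {n : ℕ} (i : Fin n) (g : Γ → ℝ) :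
    expect (iidLaw p n) (fun s => g (s i)) = expect p g := by
  cases n with
  | zero => exact i.elim0
  | succ n =>
    unfold expect
    rw [sum_iidLaw_insertNth p n i]
    simp [← Finset.sum_mul, sum_iidLaw, hp]

/-- Variance of a sum of independent centred variables: once coordinate 0 is isolated, the cross
term has mean zero. -/
theorem expect_iidLaw_sum_sq {p : Γ → ℝ} (hp : ∑ a, p a = 1) (g : Γ → ℝ) (hg : expect p g = 0)
    (n : ℕ) : expect (iidLaw p n) (fun s => (∑ i, g (s i)) ^ 2) = n * expect p fun a => g a ^ 2 := by
  induction n with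
  | zero => simp [expect]
  | succ n ih =>
    have h0 : expect (iidLaw p n) (fun s => ∑ i, g (s i)) = 0 := by
      have : ∀ i : Fin n, expect (iidLaw p n) (fun s => g (s i)) = 0 := fun i => by
        rw [expect_iidLaw_coord hp, hg]
      simp only [expect, Finset.mul_sum] at this ⊢
      rw [Finset.sum_comm]
      exact Finset.sum_eq_zero fun i _ => this i
    unfold expect at *
    rw [sum_iidLaw_insertNth p n 0]
    have : ∀ a, ∑ s, iidLaw p n s * (∑ i, g (Fin.insertNth (α := fun _ => Γ) 0 a s i)) ^ 2 =
        g a ^ 2 + ∑ s, iidLaw p n s * (∑ i, g (s i)) ^ 2 := by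
      intro a
      simp only [Fin.sum_univ_succ, Fin.insertNth_zero', Fin.cons_zero, Fin.cons_succ]
      have e : ∀ s : Fin n → Γ, iidLaw p n s * (g a + ∑ i, g (s i)) ^ 2 =
        iidLaw p n s * g a ^ 2 + 2 * g a * (iidLaw p n s * ∑ i, g (s i)) +
          iidLaw p n s * (∑ i, g (s i)) ^ 2 := fun s => by ring
      simp only [e, Finset.sum_add_distrib, ← Finset.mul_sum, ← Finset.sum_mul, h0, sum_iidLaw, hp]
      simp
    simp only [this, mul_add, Finset.sum_add_distrib, ← Finset.sum_mul, hp, ih]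
    push_cast
    ring

/-- Weak law of large numbers. -/
theorem weak_law {p : Γ → ℝ} (hp : p ∈ stdSimplex ℝ Γ) (f : Γ → ℝ) {δ η : ℝ} (hδ : 0 < δ)
    (hη : 0 < η) : ∃ N : ℕ, ∀ n ≥ N, ∑ s, iidLaw p n s *
      (if |∑ i, f (s i) - n * expect p f| ≤ n * δ then 0 else 1) ≤ η := by
  set g : Γ → ℝ := fun a => f a - expect p f with hg
  have hg0 : expect p g = 0 := by
    simp only [hg, expect, mul_sub, Finset.sum_sub_distrib, ← Finset.sum_mul, hp.2]
    ring
  set V := expect p fun a => g a ^ 2 with hV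
  have hV0 : 0 ≤ V := Finset.sum_nonneg fun a _ => mul_nonneg (hp.1 a) (sq_nonneg _)
  obtain ⟨N, hN⟩ := exists_nat_gt (V / (η * δ ^ 2))
  refine ⟨N + 1, fun n hn => ?_⟩
  have hn1 : (N : ℝ) + 1 ≤ n := by exact_mod_cast hn
  have hn0 : (0 : ℝ) < n := lt_of_lt_of_le (by positivity) hn1
  -- Chebyshev's inequality, pointwise.
  have hpt : ∀ s : Fin n → Γ, (if |∑ i, f (s i) - n * expect p f| ≤ n * δ then (0 : ℝ) else 1) ≤
      (∑ i, g (s i)) ^ 2 / (n * δ) ^ 2 := by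
    intro s
    have e : ∑ i, g (s i) = ∑ i, f (s i) - n * expect p f := by simp [hg]
    split_ifs with h
    · positivity
    · rw [le_div_iff₀ (by positivity), one_mul, e, ← sq_abs (∑ i, f (s i) - n * expect p f)]
      exact pow_le_pow_left₀ (by positivity) (not_le.1 h).le 2
  calc _ ≤ ∑ s : Fin n → Γ, iidLaw p n s * ((∑ i, g (s i)) ^ 2 / (n * δ) ^ 2) :=
        Finset.sum_le_sum fun s _ => mul_le_mul_of_nonneg_left (hpt s) (iidLaw_nonneg hp.1 n s)
    _ = (n * V) / (n * δ) ^ 2 := by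
        rw [hV, ← expect_iidLaw_sum_sq hp.2 g hg0, expect, Finset.sum_div]
        exact Finset.sum_congr rfl fun s _ => by rw [mul_div_assoc]
    _ ≤ η := by
        rw [div_lt_iff₀ (by positivity)] at hN
        rw [div_le_iff₀ (by positivity)]
        have : N * (η * δ ^ 2) ≤ n * (η * δ ^ 2) :=
          mul_le_mul_of_nonneg_right (by linarith) (by positivity)
        nlinarith

/-- Conditional mass function. -/
def condLaw (p : Γ → ℝ) (A : Γ → α) (B : Γ → β) (a : α) (b : β) : ℝ :=
  law p (fun s => (A s, B s)) (a, b) / law p B b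

theorem condLaw_nonneg {p : Γ → ℝ} (hp : ∀ s, 0 ≤ p s) (A : Γ → α) (B : Γ → β) (a : α) (b : β) :
    0 ≤ condLaw p A B a b := div_nonneg (law_nonneg hp _ _) (law_nonneg hp _ _)

/-- Only an inequality, since the quotient is 0 by convention when `b` has mass zero. An upper bound
is all that list counting needs. -/
theorem sum_condLaw_le [Fintype α] (p : Γ → ℝ) (A : Γ → α) (B : Γ → β) (b : β) :
    ∑ a, condLaw p A B a b ≤ 1 := by
  simp only [condLaw]
  rw [← Finset.sum_div, sum_law_fst]
  exact div_self_le_one _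

theorem expect_log_condLaw [Fintype α] [Fintype β] {p : Γ → ℝ} (hp : ∀ s, 0 ≤ p s) (A : Γ → α)
    (B : Γ → β) : expect p (fun s => Real.log (condLaw p A B (A s) (B s))) =
      -condEntropyOf p A B := by
  simp only [expect, condEntropyOf, entropyOf_eq, condLaw]
  rw [neg_sub_neg, neg_sub, ← Finset.sum_sub_distrib]
  refine Finset.sum_congr rfl fun s _ => ?_
  rcases (hp s).eq_or_lt with h0 | h0
  · simp [← h0]
  · have p1 := h0.trans_le (le_law_apply hp (fun s => (A s, B s)) s)
    have p2 := h0.trans_le (le_law_apply hp B s)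
    rw [Real.log_div p1.ne' p2.ne']
    ring

/-- Conditional equipartition. -/
theorem conditional_aep [Fintype α] [Fintype β] {p : Γ → ℝ} (hp : p ∈ stdSimplex ℝ Γ) (A : Γ → α)
    (B : Γ → β) {δ η : ℝ} (hδ : 0 < δ) (hη : 0 < η) :
    ∃ N : ℕ, ∀ n ≥ N, ∑ s, iidLaw p n s *
      (if Real.exp (-(n * (condEntropyOf p A B + δ))) ≤ ∏ i, condLaw p A B (A (s i)) (B (s i)) ∧
        ∏ i, condLaw p A B (A (s i)) (B (s i)) ≤ Real.exp (-(n * (condEntropyOf p A B - δ)))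
        then 0 else 1) ≤ η := by
  obtain ⟨N, hN⟩ := weak_law hp (fun s => Real.log (condLaw p A B (A s) (B s))) hδ hη
  refine ⟨N, fun n hn => (Finset.sum_le_sum fun s _ => ?_).trans (hN n hn)⟩
  rcases (iidLaw_nonneg hp.1 n s).eq_or_lt with h0 | h0
  · simp [← h0]
  refine mul_le_mul_of_nonneg_left ?_ h0.le
  -- On a block of positive mass all conditional probabilities are positive, so their product is the
  -- exponential of a sum of logarithms and the weak law applies.
  have hs : ∀ i, 0 < condLaw p A B (A (s i)) (B (s i)) := by
    intro i
    have hi : 0 < p (s i) := (hp.1 _).lt_of_ne fun h =>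
      h0.ne' (Finset.prod_eq_zero (Finset.mem_univ i) h.symm)
    exact div_pos (hi.trans_le (le_law_apply hp.1 (fun s => (A s, B s)) _))
      (hi.trans_le (le_law_apply hp.1 B _))
  have e : ∏ i, condLaw p A B (A (s i)) (B (s i)) =
      Real.exp (∑ i, Real.log (condLaw p A B (A (s i)) (B (s i)))) := by
    rw [Real.exp_sum]
    exact Finset.prod_congr rfl fun i _ => (Real.exp_log (hs i)).symm
  simp only [e, Real.exp_le_exp, expect_log_condLaw hp.1]
  split_ifs with h1 h2 h2
  · exact le_rfl
  · exact zero_le_one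
  · refine absurd ?_ h1
    rw [abs_le] at h2
    constructor <;> linarith [h2.1, h2.2]
  · exact le_rfl

/-- A list of words of large conditional mass is short. -/
theorem card_filter_condLaw_le [Fintype α] {p : Γ → ℝ} (hp : ∀ s, 0 ≤ p s) (A : Γ → α) (B : Γ → β)
    {n : ℕ} (b : Fin n → β) (t : ℝ) (s : Finset (Fin n → α))
    (hs : ∀ a ∈ s, Real.exp (-t) ≤ ∏ i, condLaw p A B (a i) (b i)) : (s.card : ℝ) ≤ Real.exp t := by
  classical
  have h1 : ∑ a : Fin n → α, ∏ i, condLaw p A B (a i) (b i) ≤ 1 := by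
    have := Finset.prod_univ_sum (fun _ : Fin n => (Finset.univ : Finset α))
      fun i a => condLaw p A B a (b i)
    simp only [Fintype.piFinset_univ] at this
    rw [← this]
    exact Finset.prod_le_one (fun i _ => Finset.sum_nonneg fun a _ => condLaw_nonneg hp _ _ _ _)
      fun i _ => sum_condLaw_le _ _ _ _
  have h2 : s.card * Real.exp (-t) ≤ 1 := by
    calc s.card * Real.exp (-t) = ∑ a ∈ s, Real.exp (-t) := by simp
      _ ≤ ∑ a ∈ s, ∏ i, condLaw p A B (a i) (b i) := Finset.sum_le_sum hs
      _ ≤ _ := (Finset.sum_le_sum_of_subset_of_nonneg (Finset.subset_univ s) fun a _ _ =>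
          Finset.prod_nonneg fun i _ => condLaw_nonneg hp _ _ _ _).trans h1
  rwa [Real.exp_neg, ← div_eq_mul_inv, div_le_one (Real.exp_pos t)] at h2

/-- Attaching i.i.d. channel outputs to an i.i.d. source. -/
theorem sum_iidLaw_channel {Ω S C : Type*} [Fintype Ω] [Fintype C] (p : Ω → ℝ) (v : Ω → S)
    (q : S → C → ℝ) (n : ℕ) (F : (Fin n → Ω) → (Fin n → C) → ℝ) :
    ∑ ω, iidLaw p n ω * ∑ c : Fin n → C, (∏ i, q (v (ω i)) (c i)) * F ω c =
      ∑ s : Fin n → Ω × C, iidLaw (fun x => p x.1 * q (v x.1) x.2) n s *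
        F (fun i => (s i).1) fun i => (s i).2 := by
  rw [← (Equiv.arrowProdEquivProdArrow (Fin n) (fun _ => Ω) (fun _ => C)).symm.sum_comp,
    Fintype.sum_prod_type]
  refine Finset.sum_congr rfl fun ω _ => ?_
  rw [Finset.mul_sum]
  refine Finset.sum_congr rfl fun c _ => ?_
  simp [iidLaw, Finset.prod_mul_distrib, Equiv.arrowProdEquivProdArrow, mul_assoc]

end IID

/-! ### Choice of the hash sizes. -/

section Numerics

theorem ceil_exp_le {t : ℝ} (ht : 0 ≤ t) : (⌈Real.exp t⌉₊ : ℝ) ≤ 2 * Real.exp t := by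
  have h1 := (Nat.ceil_lt_add_one (Real.exp_pos t).le).le
  have h2 := Real.one_le_exp ht
  linarith

theorem log_ceil_exp_le {t : ℝ} (ht : 0 ≤ t) : Real.log (⌈Real.exp t⌉₊ : ℝ) ≤ t + Real.log 2 := by
  have h0 : (0 : ℝ) < ⌈Real.exp t⌉₊ := by exact_mod_cast Nat.ceil_pos.2 (Real.exp_pos t)
  calc _ ≤ Real.log (2 * Real.exp t) := Real.log_le_log h0 (ceil_exp_le ht)
    _ = _ := by rw [Real.log_mul two_ne_zero (Real.exp_pos t).ne', Real.log_exp, add_comm]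

/-- Hash sizes for which all error terms decay exponentially. -/
theorem exists_hash_sizes {t δ g₁ g₁₂ h₁ h₂ h₃ ra rb rc : ℝ} (ht : 0 ≤ t) (hδ : 0 < δ)
    (hg₁ : 0 ≤ g₁) (hg₁₂ : g₁ ≤ g₁₂) (hra : 0 ≤ ra) (hrb : 0 ≤ rb) (hrc : 0 ≤ rc)
    (h1 : h₁ - g₁ ≤ ra) (h2 : h₂ - g₁ ≤ ra + rb) (h3 : h₃ - (g₁₂ - g₁) ≤ rc) :
    ∃ G G' Ka Kb Kc : ℕ, 0 < G ∧ 0 < G' ∧ 0 < Ka ∧ 0 < Kb ∧ 0 < Kc ∧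
      Real.exp (t * (h₁ + δ)) / (G * Ka) + Real.exp (t * (h₂ + δ)) / (G * Ka * Kb) +
        Real.exp (t * (h₃ + δ)) / (G' * Kc) ≤ 4 * Real.exp (-(t * δ)) ∧
      (G - 1) * Real.exp (-(t * (g₁ - δ))) + (G * G' - 1) * Real.exp (-(t * (g₁₂ - δ))) ≤
        3 * Real.exp (-(t * δ)) ∧
      Real.log Ka ≤ t * (ra + 4 * δ) + Real.log 2 ∧
      Real.log (Kb * Kc : ℝ) ≤ t * (rb + rc + 4 * δ) + 2 * Real.log 2 := by
  -- `u` is the target for `G` and `w` the target for `G * G'`, both slightly below the randomness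
  -- available given the source. Rounding as floor plus one keeps the sizes positive and still gives
  -- G - 1 ≤ u.
  set u := Real.exp (t * (g₁ - 2 * δ)) with hu
  set w := Real.exp (t * (g₁₂ - 2 * δ)) with hw
  have hu0 : 0 < u := Real.exp_pos _
  have hw0 : 0 < w := Real.exp_pos _
  set G := ⌊u⌋₊ + 1 with hG
  have hGpos : (0 : ℝ) < G := by rw [hG]; positivity
  have hGl : u ≤ G := by rw [hG]; push_cast; exact (Nat.lt_floor_add_one u).le
  have hGu : (G : ℝ) - 1 ≤ u := by rw [hG]; push_cast; linarith [Nat.floor_le hu0.le]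
  set G' := ⌊w / G⌋₊ + 1 with hG'
  have hG'pos : (0 : ℝ) < G' := by rw [hG']; positivity
  have hG'l : w / G ≤ G' := by rw [hG']; push_cast; exact (Nat.lt_floor_add_one _).le
  have hG'u : (G' : ℝ) - 1 ≤ w / G := by
    rw [hG']; push_cast; linarith [Nat.floor_le (div_pos hw0 hGpos).le]
  have hGG' : (G : ℝ) * G' - 1 ≤ w + u := by
    have := mul_le_mul_of_nonneg_left hG'u hGpos.le
    rw [mul_div_cancel₀ _ hGpos.ne'] at this
    linarith
  have ea : 0 ≤ t * (ra + 4 * δ) := by positivity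
  have eb : 0 ≤ t * rb := by positivity
  have ec : 0 ≤ t * (rc + 4 * δ) := by positivity
  -- Of the 4δ, 2δ makes up for the deficit in `G`, δ for the list size, and δ is left for
  -- exponential decay.
  set Ka := ⌈Real.exp (t * (ra + 4 * δ))⌉₊ with hKa
  set Kb := ⌈Real.exp (t * rb)⌉₊ with hKb
  set Kc := ⌈Real.exp (t * (rc + 4 * δ))⌉₊ with hKc
  have kal : Real.exp (t * (ra + 4 * δ)) ≤ Ka := Nat.le_ceil _
  have kbl : Real.exp (t * rb) ≤ Kb := Nat.le_ceil _
  have kcl : Real.exp (t * (rc + 4 * δ)) ≤ Kc := Nat.le_ceil _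
  have ka0 : (0 : ℝ) < Ka := (Real.exp_pos _).trans_le kal
  have kb0 : (0 : ℝ) < Kb := (Real.exp_pos _).trans_le kbl
  have kc0 : (0 : ℝ) < Kc := (Real.exp_pos _).trans_le kcl
  refine ⟨G, G', Ka, Kb, Kc, by exact_mod_cast hGpos, by exact_mod_cast hG'pos,
    by exact_mod_cast ka0, by exact_mod_cast kb0, by exact_mod_cast kc0, ?_, ?_,
    log_ceil_exp_le ea, ?_⟩
  · have b1 : Real.exp (t * (h₁ + δ)) / (G * Ka) ≤ Real.exp (-(t * δ)) := by
      rw [div_le_iff₀ (by positivity)]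
      calc Real.exp (t * (h₁ + δ)) ≤ Real.exp (-(t * δ)) * (u * Real.exp (t * (ra + 4 * δ))) := by
            rw [hu, ← Real.exp_add, ← Real.exp_add, Real.exp_le_exp]
            linarith [mul_nonneg ht (sub_nonneg.2 h1)]
        _ ≤ _ := by gcongr
    have b2 : Real.exp (t * (h₂ + δ)) / (G * Ka * Kb) ≤ Real.exp (-(t * δ)) := by
      rw [div_le_iff₀ (by positivity)]
      calc Real.exp (t * (h₂ + δ)) ≤ Real.exp (-(t * δ)) *
            (u * Real.exp (t * (ra + 4 * δ)) * Real.exp (t * rb)) := by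
            rw [hu, ← Real.exp_add, ← Real.exp_add, ← Real.exp_add, Real.exp_le_exp]
            linarith [mul_nonneg ht (sub_nonneg.2 h2)]
        _ ≤ _ := by gcongr
    have b3 : Real.exp (t * (h₃ + δ)) / (G' * Kc) ≤ 2 * Real.exp (-(t * δ)) := by
      -- The rounding of `G` may double it when `u` is small. This halves the guarantee on `G'` and
      -- produces the total constant 4 = 1 + 1 + 2.
      have hG2 : (G : ℝ) ≤ 2 * Real.exp (t * g₁) := by
        have i1 : u ≤ Real.exp (t * g₁) := Real.exp_le_exp.2
          (by linarith [mul_nonneg ht hδ.le])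
        have i2 : 1 ≤ Real.exp (t * g₁) := Real.one_le_exp (by positivity)
        linarith
      have hG'2 : w ≤ G' * (2 * Real.exp (t * g₁)) := by
        rw [div_le_iff₀ hGpos] at hG'l
        exact hG'l.trans (by gcongr)
      have hG'3 : Real.exp (t * (g₁₂ - g₁ - 2 * δ)) ≤ 2 * G' := by
        have : w = Real.exp (t * (g₁₂ - g₁ - 2 * δ)) * Real.exp (t * g₁) := by
          rw [hw, ← Real.exp_add]; ring_nf
        rw [this] at hG'2
        refine le_of_mul_le_mul_right (hG'2.trans_eq ?_) (Real.exp_pos (t * g₁))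
        ring
      rw [div_le_iff₀ (by positivity)]
      calc Real.exp (t * (h₃ + δ)) ≤ Real.exp (-(t * δ)) *
            (Real.exp (t * (g₁₂ - g₁ - 2 * δ)) * Real.exp (t * (rc + 4 * δ))) := by
            rw [← Real.exp_add, ← Real.exp_add, Real.exp_le_exp]
            linarith [mul_nonneg ht (sub_nonneg.2 h3)]
        _ ≤ Real.exp (-(t * δ)) * ((2 * G') * Kc) := by gcongr
        _ = _ := by ring
    linarith
  · have e1 : u * Real.exp (-(t * (g₁ - δ))) = Real.exp (-(t * δ)) := by
      rw [hu, ← Real.exp_add]; ring_nf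
    have e2 : w * Real.exp (-(t * (g₁₂ - δ))) = Real.exp (-(t * δ)) := by
      rw [hw, ← Real.exp_add]; ring_nf
    have e3 : u * Real.exp (-(t * (g₁₂ - δ))) ≤ Real.exp (-(t * δ)) := by
      rw [hu, ← Real.exp_add, Real.exp_le_exp]
      linarith [mul_nonneg ht (sub_nonneg.2 hg₁₂)]
    have i1 := mul_le_mul_of_nonneg_right hGu (Real.exp_pos (-(t * (g₁ - δ)))).le
    have i2 := mul_le_mul_of_nonneg_right hGG' (Real.exp_pos (-(t * (g₁₂ - δ)))).le
    rw [add_mul] at i2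
    linarith
  · rw [Real.log_mul kb0.ne' kc0.ne']
    have j1 := log_ceil_exp_le eb
    have j2 := log_ceil_exp_le ec
    linarith

end Numerics

/-! ### Source fed through a memoryless test channel. -/

section Channel

variable {U X C : Type*} [Fintype U] [Fintype C]

/-- The joint law of a source and the output of a channel fed by the component `v` of the source. -/
def channelJoint (P : U → ℝ) (v : U → X) (q : X → C → ℝ) : U × C → ℝ :=
  fun t => P t.1 * q (v t.1) t.2

theorem channelJoint_mem_stdSimplex {P : U → ℝ} (hP : P ∈ stdSimplex ℝ U) (v : U → X)
    {q : X → C → ℝ} (hq : ∀ x, q x ∈ stdSimplex ℝ C) :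
    channelJoint P v q ∈ stdSimplex ℝ (U × C) := by
  refine ⟨fun t => mul_nonneg (hP.1 _) ((hq _).1 _), ?_⟩
  simp only [channelJoint, Fintype.sum_prod_type, ← Finset.mul_sum, (hq _).2, mul_one, hP.2]

theorem law_channelJoint_output {α : Type*} [DecidableEq α] (P : U → ℝ) (v : U → X) (q : X → C → ℝ)
    (g : C → α) (a : α) (x : X) :
    law (channelJoint P v q) (fun t => (g t.2, v t.1)) (a, x) =
      law P v x * ∑ c, if g c = a then q x c else 0 := by
  classical
  unfold law channelJoint
  rw [Fintype.sum_prod_type, Finset.sum_mul]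
  refine Finset.sum_congr rfl fun u _ => ?_
  by_cases h : v u = x
  · rw [if_pos h, Finset.mul_sum]
    refine Finset.sum_congr rfl fun c _ => ?_
    by_cases h' : g c = a <;> simp [h, h']
  · simp [h]

theorem law_channelJoint_source {β : Type*} (P : U → ℝ) (v : U → X) {q : X → C → ℝ}
    (hq : ∀ x, q x ∈ stdSimplex ℝ C) (r : U → β) :
    law (channelJoint P v q) (fun t => r t.1) = law P r := by
  classical
  funext b
  unfold law channelJoint
  rw [Fintype.sum_prod_type]
  refine Finset.sum_congr rfl fun u _ => ?_
  by_cases h : r u = b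
  · simp [h, ← Finset.mul_sum, (hq _).2]
  · simp [h]

theorem condLaw_channelJoint {α : Type*} [DecidableEq α] {P : U → ℝ} {v : U → X} {q : X → C → ℝ}
    (hq : ∀ x, q x ∈ stdSimplex ℝ C) (g : C → α) (a : α) {x : X} (hx : 0 < law P v x) :
    condLaw (channelJoint P v q) (fun t => g t.2) (fun t => v t.1) a x =
      ∑ c, if g c = a then q x c else 0 := by
  rw [condLaw, law_channelJoint_output, law_channelJoint_source P v hq v]
  field_simp

end Channel

/-! ### Block codes from the one-shot theorem and equipartition. -/

section BlockCode

theorem ite_and_le (P Q : Prop) [Decidable P] [Decidable Q] :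
    (if P ∧ Q then (0 : ℝ) else 1) ≤ (if P then 0 else 1) + (if Q then 0 else 1) := by
  by_cases hP : P <;> by_cases hQ : Q <;> simp [hP, hQ]

theorem ite_le_of_imp {P Q : Prop} [Decidable P] [Decidable Q] (h : Q → P) :
    (if P then (0 : ℝ) else 1) ≤ (if Q then 0 else 1) := by
  by_cases hP : P <;> by_cases hQ : Q <;> simp [hP, hQ]
  exact absurd (h hQ) hP

theorem sum_channel_block_eq_one {X C : Type*} [Fintype C] {q : X → C → ℝ}
    (hq : ∀ x, q x ∈ stdSimplex ℝ C) {n : ℕ} (x : Fin n → X) :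
    ∑ c : Fin n → C, ∏ i, q (x i) (c i) = 1 := by
  classical
  have := Finset.prod_univ_sum (fun _ : Fin n => (Finset.univ : Finset C)) fun i c => q (x i) c
  simp only [Fintype.piFinset_univ] at this
  rw [← this]
  exact Finset.prod_eq_one fun i _ => (hq _).2

theorem sum_channel_block_fiber {X C A : Type*} [Fintype C] [DecidableEq A] (q : X → C → ℝ)
    (g : C → A) {n : ℕ} (x : Fin n → X) (a : Fin n → A) :
    ∑ c : Fin n → C, (if (fun i => g (c i)) = a then ∏ i, q (x i) (c i) else 0) =
      ∏ i, ∑ c, if g c = a i then q (x i) c else 0 := by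
  classical
  have := Finset.prod_univ_sum (fun _ : Fin n => (Finset.univ : Finset C))
    fun i c => if g c = a i then q (x i) c else 0
  simp only [Fintype.piFinset_univ] at this
  rw [this]
  refine Finset.sum_congr rfl fun c _ => ?_
  by_cases h : ∀ i, g (c i) = a i
  · rw [if_pos (funext h)]
    exact Finset.prod_congr rfl fun i _ => by rw [if_pos (h i)]
  · rw [if_neg fun h' => h fun i => congrFun h' i]
    push Not at h
    obtain ⟨i, hi⟩ := h
    exact (Finset.prod_eq_zero (Finset.mem_univ i) (by rw [if_neg hi])).symm

variable {X Y₁ Y₂ W₁ W₂ : Type*} [Fintype X] [Fintype Y₁] [Fintype Y₂] [Fintype W₁] [Fintype W₂]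

/-- Block codes built from a two-layer test channel: with high probability both decoders recover
words for which a given property `E`, of high probability under the test channel, holds. -/
theorem exists_block_code {P : X × Y₁ × Y₂ → ℝ} (hP : P ∈ stdSimplex ℝ (X × Y₁ × Y₂))
    (hPX : ∀ x, 0 < law P (fun s => s.1) x)
    {q : X → W₁ × W₂ → ℝ} (hq : ∀ x, q x ∈ stdSimplex ℝ (W₁ × W₂))
    {J : (X × Y₁ × Y₂) × (W₁ × W₂) → ℝ} (hJ : J = channelJoint P (fun s => s.1) q)
    {ra rb rc : ℝ} (hra : 0 ≤ ra) (hrb : 0 ≤ rb) (hrc : 0 ≤ rc)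
    (h1 : condEntropyOf J (fun t => t.2.1) (fun t => t.1.2.1) -
      condEntropyOf J (fun t => t.2.1) (fun t => t.1.1) ≤ ra)
    (h2 : condEntropyOf J (fun t => t.2.1) (fun t => t.1.2.2) -
      condEntropyOf J (fun t => t.2.1) (fun t => t.1.1) ≤ ra + rb)
    (h3 : condEntropyOf J (fun t => t.2.2) (fun t => (t.2.1, t.1.2.2)) -
      (condEntropyOf J (fun t => t.2) (fun t => t.1.1) -
        condEntropyOf J (fun t => t.2.1) (fun t => t.1.1)) ≤ rc)
    {δ η : ℝ} (hδ : 0 < δ) (hη : 0 < η) :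
    ∃ N : ℕ, ∀ n ≥ N, ∀ (E : (Fin n → X × Y₁ × Y₂) → (Fin n → W₁ × W₂) → Prop)
      [∀ ω c, Decidable (E ω c)],
      ∑ s, iidLaw J n s * (if E (fun i => (s i).1) (fun i => (s i).2) then 0 else 1) ≤ η →
      ∃ (Ka Kb Kc : ℕ) (e₁ : (Fin n → X) → Fin Ka) (e₂ : (Fin n → X) → Fin Kb × Fin Kc)
        (D₁ : Fin Ka → (Fin n → Y₁) → (Fin n → W₁))
        (D₂ : Fin Ka → Fin Kb × Fin Kc → (Fin n → Y₂) → (Fin n → W₁ × W₂))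
        (good : (Fin n → X × Y₁ × Y₂) → Prop) (_ : ∀ ω, Decidable (good ω)),
        Real.log Ka ≤ n * (ra + 4 * δ) + Real.log 2 ∧
        Real.log (Kb * Kc : ℝ) ≤ n * (rb + rc + 4 * δ) + 2 * Real.log 2 ∧
        (∀ ω, good ω → ∃ c, E ω c ∧
          D₁ (e₁ fun i => (ω i).1) (fun i => (ω i).2.1) = (fun i => (c i).1) ∧
          D₂ (e₁ fun i => (ω i).1) (e₂ fun i => (ω i).1) (fun i => (ω i).2.2) = c) ∧
        ∑ ω, iidLaw P n ω * (if good ω then 0 else 1) ≤ 8 * η +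
          (4 * Real.exp (-(n * δ)) + √(3 * Real.exp (-(n * δ)))) := by
  classical
  have hJs : J ∈ stdSimplex ℝ _ := hJ ▸ channelJoint_mem_stdSimplex hP (fun s => s.1) hq
  have hJ0 := hJs.1
  have hX : Nonempty X := by
    by_contra hne
    rw [not_nonempty_iff] at hne
    have := hP.2
    simp at this
  have hW : Nonempty (W₁ × W₂) := by
    by_contra hne
    have := (hq hX.some).2
    rw [not_nonempty_iff] at hne
    simp at this
  have hW₁ : Nonempty W₁ := hW.map Prod.fst
  set γ₁ := condEntropyOf J (fun t => t.2.1) (fun t => t.1.1) with hγ₁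
  set γ₂ := condEntropyOf J (fun t => t.2) (fun t => t.1.1) with hγ₂
  set χ₁ := condEntropyOf J (fun t => t.2.1) (fun t => t.1.2.1) with hχ₁
  set χ₂ := condEntropyOf J (fun t => t.2.1) (fun t => t.1.2.2) with hχ₂
  set χ₃ := condEntropyOf J (fun t => t.2.2) (fun t => (t.2.1, t.1.2.2)) with hχ₃
  have hγ₁0 : 0 ≤ γ₁ := sub_nonneg.2 (entropyOf_mono hJ0 fun s t h => (Prod.ext_iff.1 h).2)
  have hγ₁₂ : γ₁ ≤ γ₂ := sub_le_sub_right (entropyOf_mono hJ0 fun s t h => by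
    simp only [Prod.ext_iff] at h ⊢; exact ⟨h.1.1, h.2⟩) _
  obtain ⟨N₁, hN₁⟩ := conditional_aep hJs (fun t => t.2.1) (fun t => t.1.2.1) hδ hη
  obtain ⟨N₂, hN₂⟩ := conditional_aep hJs (fun t => t.2.1) (fun t => t.1.2.2) hδ hη
  obtain ⟨N₃, hN₃⟩ := conditional_aep hJs (fun t => t.2.2) (fun t => (t.2.1, t.1.2.2)) hδ hη
  obtain ⟨N₄, hN₄⟩ := conditional_aep hJs (fun t => t.2.1) (fun t => t.1.1) hδ hη
  obtain ⟨N₅, hN₅⟩ := conditional_aep hJs (fun t => t.2) (fun t => t.1.1) hδ hη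
  refine ⟨N₁ + N₂ + N₃ + N₄ + N₅, fun n hn E _ hE => ?_⟩
  obtain ⟨G, G', Ka, Kb, Kc, G0, G'0, Ka0, Kb0, Kc0, hs1, hs2, hs3, hs4⟩ :=
    exists_hash_sizes (t := n) (Nat.cast_nonneg n) hδ hγ₁0 hγ₁₂ hra hrb hrc h1 h2 h3
  have : Nonempty (Fin G) := ⟨⟨0, G0⟩⟩
  have : Nonempty (Fin G') := ⟨⟨0, G'0⟩⟩
  have : Nonempty (Fin Ka) := ⟨⟨0, Ka0⟩⟩
  have : Nonempty (Fin Kb) := ⟨⟨0, Kb0⟩⟩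
  have : Nonempty (Fin Kc) := ⟨⟨0, Kc0⟩⟩
  set κ₁ := condLaw J (fun t => t.2.1) (fun t => t.1.2.1) with hκ₁
  set κ₂ := condLaw J (fun t => t.2.1) (fun t => t.1.2.2) with hκ₂
  set κ₃ := condLaw J (fun t => t.2.2) (fun t => (t.2.1, t.1.2.2)) with hκ₃
  set κ₄ := condLaw J (fun t => t.2.1) (fun t => t.1.1) with hκ₄
  set κ₅ := condLaw J (fun t => t.2) (fun t => t.1.1) with hκ₅
  -- The lists use the lower equipartition bound, which makes them short; `T` below uses the upper
  -- bound, which makes the channel output sufficiently random given the source.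
  set L₁ : (Fin n → Y₁) → Finset (Fin n → W₁) := fun y =>
    {a | Real.exp (-(n * (χ₁ + δ))) ≤ ∏ i, κ₁ (a i) (y i)} with hL₁
  set L₂ : (Fin n → Y₂) → Finset (Fin n → W₁) := fun y =>
    {a | Real.exp (-(n * (χ₂ + δ))) ≤ ∏ i, κ₂ (a i) (y i)} with hL₂
  set L₃ : (Fin n → Y₂) → (Fin n → W₁) → Finset (Fin n → W₁ × W₂) := fun y a =>
    {c | (∀ i, (c i).1 = a i) ∧
      Real.exp (-(n * (χ₃ + δ))) ≤ ∏ i, κ₃ (c i).2 (a i, y i)} with hL₃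
  set T : (Fin n → X) → Finset (Fin n → W₁ × W₂) := fun x =>
    {c | ∏ i, κ₄ (c i).1 (x i) ≤ Real.exp (-(n * (γ₁ - δ))) ∧
      ∏ i, κ₅ (c i) (x i) ≤ Real.exp (-(n * (γ₂ - δ)))} with hT
  -- Positivity of every source letter lets conditional laws be read off the channel for all `x`.
  have hκ₄e : ∀ a x, κ₄ a x = ∑ c, if c.1 = a then q x c else 0 := fun a x => by
    rw [hκ₄, hJ]
    exact condLaw_channelJoint hq (fun c => c.1) a (hPX x)
  have hκ₅e : ∀ c x, κ₅ c x = q x c := fun c x => by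
    rw [hκ₅, hJ]
    refine (condLaw_channelJoint hq (fun c => c) c (hPX x)).trans (by simp)
  obtain ⟨e₁, e₂, D₁, D₂, good, dg, hgood, hbound⟩ := exists_code_one_shot
    (G := Fin G) (G' := Fin G') (Ka := Fin Ka) (Kb := Fin Kb) (Kc := Fin Kc)
    (iidLaw P n) (iidLaw_nonneg hP.1 n) (iidLaw_mem_stdSimplex hP n).2
    (fun ω (i : Fin n) => (ω i).1) (fun ω (i : Fin n) => (ω i).2.1) (fun ω (i : Fin n) => (ω i).2.2)
    (fun (s : Fin n → X) (c : Fin n → W₁ × W₂) => ∏ i, q (s i) (c i))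
    (fun s c => Finset.prod_nonneg fun i _ => (hq _).1 _)
    (fun s => sum_channel_block_eq_one hq s)
    (fun (c : Fin n → W₁ × W₂) i => (c i).1) L₁ L₂ L₃ T E
    (β₁ := Real.exp (n * (χ₁ + δ))) (β₂ := Real.exp (n * (χ₂ + δ)))
    (β₃ := Real.exp (n * (χ₃ + δ)))
    (x := Real.exp (-(n * (γ₁ - δ)))) (y := Real.exp (-(n * (γ₂ - δ))))
    (fun y => card_filter_condLaw_le hJ0 _ _ y _ _ fun a ha => (Finset.mem_filter.1 ha).2)
    (fun y => card_filter_condLaw_le hJ0 _ _ y _ _ fun a ha => (Finset.mem_filter.1 ha).2)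
    (by
      intro y a
      -- On `L₃ y a` the first components are fixed to `a`, so it suffices to count second
      -- components.
      have hinj : Set.InjOn (fun (c : Fin n → W₁ × W₂) i => (c i).2) (L₃ y a) := by
        intro c hc c' hc' h
        have m := (Finset.mem_filter.1 hc).2.1
        have m' := (Finset.mem_filter.1 hc').2.1
        funext i
        exact Prod.ext ((m i).trans (m' i).symm) (congrFun h i)
      rw [← Finset.card_image_of_injOn hinj]
      refine card_filter_condLaw_le hJ0 (fun t => t.2.2) (fun t => (t.2.1, t.1.2.2))
        (fun i => (a i, y i)) _ _ fun b hb => ?_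
      obtain ⟨c, hc, rfl⟩ := Finset.mem_image.1 hb
      exact (Finset.mem_filter.1 hc).2.2)
    (by
      intro s a
      by_cases hne : ∃ c ∈ T s, (fun i => (c i).1) = a
      · obtain ⟨c, hc, rfl⟩ := hne
        refine le_trans ?_ (Finset.mem_filter.1 hc).2.1
        -- The part of the fibre in `T` is enlarged to the whole fibre, whose mass is the product of
        -- first-marginal probabilities; one member of `T` bounds that product.
        calc _ ≤ ∑ c' : Fin n → W₁ × W₂ with (fun i => (c' i).1) = (fun i => (c i).1),
              ∏ i, q (s i) (c' i) :=
              Finset.sum_le_sum_of_subset_of_nonneg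
                (Finset.filter_subset_filter _ (Finset.subset_univ _))
                fun c' _ _ => Finset.prod_nonneg fun i _ => (hq _).1 _
          _ = _ := by
            rw [Finset.sum_filter, sum_channel_block_fiber q (fun c => c.1)]
            simp only [hκ₄e]
      · rw [Finset.sum_eq_zero]
        · exact (Real.exp_pos _).le
        · intro c hc
          rw [Finset.mem_filter] at hc
          exact absurd ⟨c, hc.1, hc.2⟩ hne)
    (by
      intro s c hc
      have := (Finset.mem_filter.1 hc).2.2
      simpa only [hκ₅e] using this)
    (Real.exp_pos _).le (Real.exp_pos _).le
  refine ⟨Ka, Kb, Kc, e₁, e₂, D₁, D₂, good, dg, hs3, hs4, hgood, hbound.trans ?_⟩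
  have hpush : ∀ F : (Fin n → X × Y₁ × Y₂) → (Fin n → W₁ × W₂) → ℝ,
      ∑ ω, iidLaw P n ω * ∑ c : Fin n → W₁ × W₂, (∏ i, q (ω i).1 (c i)) * F ω c =
      ∑ s, iidLaw J n s * F (fun i => (s i).1) fun i => (s i).2 := fun F => by
    rw [hJ]
    exact sum_iidLaw_channel P (fun s => s.1) q n F
  have t1 : ∑ ω, iidLaw P n ω * ∑ c : Fin n → W₁ × W₂, (∏ i, q (ω i).1 (c i)) *
      (if E ω c ∧ (fun i => (c i).1) ∈ L₁ (fun i => (ω i).2.1) ∧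
        (fun i => (c i).1) ∈ L₂ (fun i => (ω i).2.2) ∧
        c ∈ L₃ (fun i => (ω i).2.2) (fun i => (c i).1) then 0 else 1) ≤ 4 * η := by
    rw [hpush fun ω c => if E ω c ∧ (fun i => (c i).1) ∈ L₁ (fun i => (ω i).2.1) ∧
        (fun i => (c i).1) ∈ L₂ (fun i => (ω i).2.2) ∧
        c ∈ L₃ (fun i => (ω i).2.2) (fun i => (c i).1) then 0 else 1]
    have m1 := hN₁ n (by omega)
    have m2 := hN₂ n (by omega)
    have m3 := hN₃ n (by omega)
    have e : 4 * η = η + (η + (η + η)) := by ring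
    rw [e]
    refine le_trans ?_ (add_le_add hE (add_le_add m1 (add_le_add m2 m3)))
    simp only [← Finset.sum_add_distrib, ← mul_add]
    refine Finset.sum_le_sum fun s _ => mul_le_mul_of_nonneg_left ?_ (iidLaw_nonneg hJ0 n s)
    refine (ite_and_le _ _).trans (add_le_add le_rfl ((ite_and_le _ _).trans
      (add_le_add (ite_le_of_imp ?_) ((ite_and_le _ _).trans
        (add_le_add (ite_le_of_imp ?_) (ite_le_of_imp ?_))))))
    · exact fun h => Finset.mem_filter.2 ⟨Finset.mem_univ _, h.1⟩
    · exact fun h => Finset.mem_filter.2 ⟨Finset.mem_univ _, h.1⟩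
    · exact fun h => Finset.mem_filter.2 ⟨Finset.mem_univ _, fun _ => rfl, h.1⟩
  have t2 : ∑ ω, iidLaw P n ω * ∑ c : Fin n → W₁ × W₂, (∏ i, q (ω i).1 (c i)) *
      (if c ∈ T (fun i => (ω i).1) then 0 else 1) ≤ 2 * η := by
    rw [hpush fun ω c => if c ∈ T (fun i => (ω i).1) then 0 else 1]
    have m1 := hN₄ n (by omega)
    have m2 := hN₅ n (by omega)
    rw [two_mul]
    refine le_trans ?_ (add_le_add m1 m2)
    simp only [← Finset.sum_add_distrib, ← mul_add]
    refine Finset.sum_le_sum fun s _ => mul_le_mul_of_nonneg_left ?_ (iidLaw_nonneg hJ0 n s)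
    refine le_trans (ite_le_of_imp ?_) (ite_and_le _ _)
    exact fun h => Finset.mem_filter.2 ⟨Finset.mem_univ _, h.1.2, h.2.2⟩
  -- The total 8η is 4η from `E` and the three lists, plus twice the 2η from `T`.
  simp only [Fintype.card_fin]
  have t3 := Real.sqrt_le_sqrt hs2
  linarith

end BlockCode

/-! ### Achievability of scalable coding and of Wyner-Ziv coding. -/

section Achievability

theorem expect_le_of_good {Ω : Type*} [Fintype Ω] {p : Ω → ℝ} (hp : p ∈ stdSimplex ℝ Ω)
    {g : Ω → ℝ} {good : Ω → Prop} [∀ ω, Decidable (good ω)] {a B : ℝ} (ha : 0 ≤ a)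
    (hgood : ∀ ω, good ω → g ω ≤ a) (hB : ∀ ω, g ω ≤ B) :
    expect p g ≤ a + B * ∑ ω, p ω * (if good ω then 0 else 1) := by
  calc expect p g ≤ ∑ ω, p ω * (a + B * (if good ω then 0 else 1)) := by
        refine Finset.sum_le_sum fun ω _ => mul_le_mul_of_nonneg_left ?_ (hp.1 ω)
        split_ifs with h
        · simpa using hgood ω h
        · linarith [hB ω]
    _ = _ := by
        simp only [mul_add, Finset.sum_add_distrib, ← Finset.sum_mul, hp.2, one_mul]
        rw [Finset.mul_sum]
        congr 1
        exact Finset.sum_congr rfl fun ω _ => by ring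

theorem expect_nonneg {Ω : Type*} [Fintype Ω] {p : Ω → ℝ} (hp : ∀ s, 0 ≤ p s) {g : Ω → ℝ}
    (hg : ∀ s, 0 ≤ g s) : 0 ≤ expect p g :=
  Finset.sum_nonneg fun s _ => mul_nonneg (hp s) (hg s)

theorem vecDist_le {X Z : Type*} {d : X → Z → ℝ} {B : ℝ} (hB0 : 0 ≤ B) (hB : ∀ x z, d x z ≤ B)
    {n : ℕ} (x : Fin n → X) (z : Fin n → Z) : vecDist d x z ≤ B := by
  unfold vecDist
  rcases Nat.eq_zero_or_pos n with rfl | hn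
  · simpa using hB0
  · have hn' : (0 : ℝ) < n := by exact_mod_cast hn
    rw [one_div, inv_mul_le_iff₀ hn']
    calc _ ≤ ∑ _i : Fin n, B := Finset.sum_le_sum fun i _ => hB _ _
      _ = _ := by simp

theorem exists_distortion_bound {X Z : Type*} [Fintype X] [Fintype Z] (d : X → Z → ℝ) :
    ∃ B, 0 ≤ B ∧ ∀ x z, d x z ≤ B := by
  refine ⟨∑ x, ∑ z, |d x z|, by positivity, fun x z => ?_⟩
  calc d x z ≤ |d x z| := le_abs_self _
    _ ≤ ∑ z, |d x z| := Finset.single_le_sum (f := fun z => |d x z|) (fun _ _ => abs_nonneg _)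
        (Finset.mem_univ z)
    _ ≤ _ := Finset.single_le_sum (f := fun x => ∑ z, |d x z|)
        (fun _ _ => Finset.sum_nonneg fun _ _ => abs_nonneg _) (Finset.mem_univ x)

theorem exists_forall_exp_sqrt_le {δ η : ℝ} (hδ : 0 < δ) (hη : 0 < η) :
    ∃ N : ℕ, ∀ n ≥ N, 4 * Real.exp (-((n : ℝ) * δ)) + √(3 * Real.exp (-((n : ℝ) * δ))) ≤ η := by
  have h0 : Filter.Tendsto (fun n : ℕ => Real.exp (-((n : ℝ) * δ))) Filter.atTop (nhds 0) :=
    Real.tendsto_exp_neg_atTop_nhds_zero.comp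
      (Filter.Tendsto.atTop_mul_const hδ tendsto_natCast_atTop_atTop)
  have h1 := (h0.const_mul 4).add (Real.continuous_sqrt.continuousAt.tendsto.comp (h0.const_mul 3))
  simp only [mul_zero, Real.sqrt_zero, add_zero] at h1
  exact Filter.eventually_atTop.1 (h1.eventually (ge_mem_nhds hη))

variable {X Y₁ Y₂ Z₁ Z₂ W₁ W₂ : Type*} [Fintype X] [Fintype Y₁] [Fintype Y₂] [Fintype Z₁]
  [Fintype Z₂] [Fintype W₁] [Fintype W₂]

/-- Achievability for side-information scalable coding, with the test channel as a kernel. -/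
theorem siAchievable_of_channel {P : X × Y₁ × Y₂ → ℝ} (hP : P ∈ stdSimplex ℝ (X × Y₁ × Y₂))
    (hPX : ∀ x, 0 < law P (fun s => s.1) x)
    {q : X → W₁ × W₂ → ℝ} (hq : ∀ x, q x ∈ stdSimplex ℝ (W₁ × W₂))
    {J : (X × Y₁ × Y₂) × (W₁ × W₂) → ℝ} (hJ : J = channelJoint P (fun s => s.1) q)
    {ra rb rc : ℝ} (hra : 0 ≤ ra) (hrb : 0 ≤ rb) (hrc : 0 ≤ rc)
    (h1 : condEntropyOf J (fun t => t.2.1) (fun t => t.1.2.1) -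
      condEntropyOf J (fun t => t.2.1) (fun t => t.1.1) ≤ ra)
    (h2 : condEntropyOf J (fun t => t.2.1) (fun t => t.1.2.2) -
      condEntropyOf J (fun t => t.2.1) (fun t => t.1.1) ≤ ra + rb)
    (h3 : condEntropyOf J (fun t => t.2.2) (fun t => (t.2.1, t.1.2.2)) -
      (condEntropyOf J (fun t => t.2) (fun t => t.1.1) -
        condEntropyOf J (fun t => t.2.1) (fun t => t.1.1)) ≤ rc)
    {d₁ : X → Z₁ → ℝ} {d₂ : X → Z₂ → ℝ} (hd₁ : ∀ x z, 0 ≤ d₁ x z) (hd₂ : ∀ x z, 0 ≤ d₂ x z)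
    (f₁ : W₁ × Y₁ → Z₁) (f₂ : W₂ × Y₂ → Z₂) {D₁ D₂ : ℝ}
    (hD₁ : expect J (fun t => d₁ t.1.1 (f₁ (t.2.1, t.1.2.1))) ≤ D₁)
    (hD₂ : expect J (fun t => d₂ t.1.1 (f₂ (t.2.2, t.1.2.2))) ≤ D₂) :
    SIAchievable P d₁ d₂ D₁ D₂ ra (rb + rc) := by
  classical
  intro ε hε
  have hJs : J ∈ stdSimplex ℝ _ := hJ ▸ channelJoint_mem_stdSimplex hP (fun s => s.1) hq
  obtain ⟨B₁, hB₁0, hB₁⟩ := exists_distortion_bound d₁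
  obtain ⟨B₂, hB₂0, hB₂⟩ := exists_distortion_bound d₂
  set B := B₁ + B₂ + 1 with hB
  have hB0 : 0 < B := by positivity
  -- The rate excess 4δ is ε/2, which leaves ε/2 for the log 2 terms. With η = ε/(32B) the bad event
  -- costs at most B(8η + ε/(4B)) = ε/2 in distortion.
  set δ := ε / 8 with hδ
  have hδ0 : 0 < δ := by positivity
  set η := ε / (32 * B) with hη
  have hη0 : 0 < η := by positivity
  set g₁ : (X × Y₁ × Y₂) × (W₁ × W₂) → ℝ := fun t => d₁ t.1.1 (f₁ (t.2.1, t.1.2.1)) with hg₁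
  set g₂ : (X × Y₁ × Y₂) × (W₁ × W₂) → ℝ := fun t => d₂ t.1.1 (f₂ (t.2.2, t.1.2.2)) with hg₂
  have hD₁0 : 0 ≤ D₁ := (expect_nonneg hJs.1 fun t => hd₁ _ _).trans hD₁
  have hD₂0 : 0 ≤ D₂ := (expect_nonneg hJs.1 fun t => hd₂ _ _).trans hD₂
  obtain ⟨N₁, hN₁⟩ := exists_block_code hP hPX hq hJ hra hrb hrc h1 h2 h3 hδ0 hη0
  obtain ⟨N₂, hN₂⟩ := weak_law hJs g₁ hδ0 (half_pos hη0)
  obtain ⟨N₃, hN₃⟩ := weak_law hJs g₂ hδ0 (half_pos hη0)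
  obtain ⟨N₄, hN₄⟩ := exists_forall_exp_sqrt_le hδ0 (by positivity : 0 < ε / (4 * B))
  obtain ⟨N₅, hN₅⟩ := exists_nat_gt (4 * Real.log 2 / ε)
  refine ⟨N₁ + N₂ + N₃ + N₄ + N₅ + 1, fun n hn => ?_⟩
  have hn0 : (0 : ℝ) < n := by exact_mod_cast (by omega : 0 < n)
  -- The property to be preserved by the code: both empirical distortions are close to their means.
  set E : (Fin n → X × Y₁ × Y₂) → (Fin n → W₁ × W₂) → Prop := fun ω c =>
    |∑ i, g₁ (ω i, c i) - n * expect J g₁| ≤ n * δ ∧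
    |∑ i, g₂ (ω i, c i) - n * expect J g₂| ≤ n * δ with hE
  obtain ⟨Ka, Kb, Kc, e₁, e₂, dec₁, dec₂, good, dg, k1, k2, hgood, hbad⟩ :=
    hN₁ n (by omega) E (by
      have m1 := hN₂ n (by omega)
      have m2 := hN₃ n (by omega)
      rw [← add_halves η]
      refine le_trans ?_ (add_le_add m1 m2)
      simp only [← Finset.sum_add_distrib, ← mul_add]
      exact Finset.sum_le_sum fun s _ =>
        mul_le_mul_of_nonneg_left (ite_and_le _ _) (iidLaw_nonneg hJs.1 n s))
  have hbad' : B * ∑ ω, iidLaw P n ω * (if good ω then 0 else 1) ≤ ε / 2 := by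
    have := hbad.trans (add_le_add_right (hN₄ n (by omega)) _)
    calc _ ≤ B * (8 * η + ε / (4 * B)) := mul_le_mul_of_nonneg_left this hB0.le
      _ = ε / 2 := by rw [hη]; field_simp; ring
  have hbn : 0 ≤ ∑ ω, iidLaw P n ω * (if good ω then (0 : ℝ) else 1) :=
    Finset.sum_nonneg fun ω _ => mul_nonneg (iidLaw_nonneg hP.1 n ω) (by split_ifs <;> simp)
  have hlog : 2 * Real.log 2 ≤ n * (ε / 2) := by
    have : (N₅ : ℝ) ≤ n := by exact_mod_cast (by omega : N₅ ≤ n)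
    have h := hN₅.trans_le this
    rw [div_lt_iff₀ hε] at h
    linarith
  have hlog2 : 0 ≤ Real.log 2 := Real.log_nonneg one_le_two
  have avg : ∀ {s e D : ℝ}, |s - n * e| ≤ n * δ → e ≤ D → (1 / (n : ℝ)) * s ≤ D + δ := by
    intro s e D h he
    rw [abs_le] at h
    rw [one_div, inv_mul_le_iff₀ hn0]
    have := mul_le_mul_of_nonneg_left he hn0.le
    linarith [h.2]
  refine ⟨Ka, Kb * Kc, ⟨e₁, fun x => finProdFinEquiv (e₂ x), fun m y i => f₁ (dec₁ m y i, y i),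
    fun m₁ m₂ y i => f₂ ((dec₂ m₁ (finProdFinEquiv.symm m₂) y i).2, y i)⟩, ?_, ?_, ?_, ?_⟩
  · refine (expect_le_of_good (iidLaw_mem_stdSimplex hP n) (good := good) (a := D₁ + δ) (B := B)
      (by positivity) ?_ ?_).trans ?_
    · intro ω hω
      obtain ⟨c, hc, r1, r2⟩ := hgood ω hω
      dsimp only
      rw [r1]
      exact avg hc.1 hD₁
    · intro ω
      exact (vecDist_le hB₁0 hB₁ _ _).trans (by rw [hB]; linarith)
    · linarith
  · refine (expect_le_of_good (iidLaw_mem_stdSimplex hP n) (good := good) (a := D₂ + δ) (B := B)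
      (by positivity) ?_ ?_).trans ?_
    · intro ω hω
      obtain ⟨c, hc, r1, r2⟩ := hgood ω hω
      simp only [Equiv.symm_apply_apply]
      rw [r2]
      exact avg hc.2 hD₂
    · intro ω
      exact (vecDist_le hB₂0 hB₂ _ _).trans (by rw [hB]; linarith)
    · linarith
  · rw [one_div, inv_mul_le_iff₀ hn0]
    have : (n : ℝ) * (ra + 4 * δ) = n * (ra + ε) - n * (ε / 2) := by rw [hδ]; ring
    linarith
  · rw [one_div, inv_mul_le_iff₀ hn0]
    push_cast
    have : (n : ℝ) * (rb + rc + 4 * δ) = n * (rb + rc + ε) - n * (ε / 2) := by rw [hδ]; ring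
    linarith

/-- A Markov string through `X` is generated by a channel. -/
theorem law_eq_channelJoint {Ω X Y C : Type*} [Fintype Ω] [Fintype X] [Fintype Y] [Fintype C]
    {Q : Ω → ℝ} (W : Ω → C) (A : Ω → X) (B : Ω → Y) (hA : ∀ x, 0 < law Q A x)
    (hM : IsMarkov Q W A B) :
    law Q (fun s => ((A s, B s), W s)) = channelJoint (law Q fun s => (A s, B s)) (fun s => s.1)
      fun x c => law Q (fun s => (W s, A s)) (c, x) / law Q A x := by
  funext ⟨⟨x, y⟩, c⟩
  have h := hM c x y
  simp only [channelJoint]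
  rw [mul_div_assoc', eq_div_iff (hA x).ne', mul_comm (law Q (fun s => (A s, B s)) (x, y)), ← h]
  congr 1
  exact law_congr_apply fun t => by simp only [Prod.ext_iff]; tauto

theorem condChannel_mem_stdSimplex {Ω X C : Type*} [Fintype Ω] [Fintype X] [Fintype C]
    {Q : Ω → ℝ} (hQ : ∀ s, 0 ≤ Q s) (W : Ω → C) (A : Ω → X) (hA : ∀ x, 0 < law Q A x) (x : X) :
    (fun c => law Q (fun s => (W s, A s)) (c, x) / law Q A x) ∈ stdSimplex ℝ C := by
  refine ⟨fun c => div_nonneg (law_nonneg hQ _ _) (law_nonneg hQ _ _), ?_⟩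
  rw [← Finset.sum_div, sum_law_fst, div_self (hA x).ne']

theorem condEntropyOf_law {Ω δ α β : Type*} [Fintype Ω] [Fintype δ] [Fintype α] [Fintype β]
    (p : Ω → ℝ) (T : Ω → δ) (A : δ → α) (B : δ → β) :
    condEntropyOf (law p T) A B = condEntropyOf p (fun s => A (T s)) fun s => B (T s) := by
  simp only [condEntropyOf, entropyOf_law]

/-- Achievability for side-information scalable coding, for jointly distributed variables. -/
theorem siAchievable_of_joint {Ω : Type*} [Fintype Ω] {Q : Ω → ℝ} (hQ : Q ∈ stdSimplex ℝ Ω)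
    (V₁ : Ω → W₁) (V₂ : Ω → W₂) (A : Ω → X) (B₁ : Ω → Y₁) (B₂ : Ω → Y₂)
    (hA : ∀ x, 0 < law Q A x)
    (hM : IsMarkov Q (fun s => (V₁ s, V₂ s)) A fun s => (B₁ s, B₂ s))
    {ra rb rc : ℝ} (hra : 0 ≤ ra) (hrb : 0 ≤ rb) (hrc : 0 ≤ rc)
    (h1 : condEntropyOf Q V₁ B₁ - condEntropyOf Q V₁ A ≤ ra)
    (h2 : condEntropyOf Q V₁ B₂ - condEntropyOf Q V₁ A ≤ ra + rb)
    (h3 : condEntropyOf Q V₂ (fun s => (V₁ s, B₂ s)) -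
      (condEntropyOf Q (fun s => (V₁ s, V₂ s)) A - condEntropyOf Q V₁ A) ≤ rc)
    {d₁ : X → Z₁ → ℝ} {d₂ : X → Z₂ → ℝ} (hd₁ : ∀ x z, 0 ≤ d₁ x z) (hd₂ : ∀ x z, 0 ≤ d₂ x z)
    (f₁ : W₁ × Y₁ → Z₁) (f₂ : W₂ × Y₂ → Z₂) {D₁ D₂ : ℝ}
    (hD₁ : expect Q (fun s => d₁ (A s) (f₁ (V₁ s, B₁ s))) ≤ D₁)
    (hD₂ : expect Q (fun s => d₂ (A s) (f₂ (V₂ s, B₂ s))) ≤ D₂) :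
    SIAchievable (law Q fun s => (A s, B₁ s, B₂ s)) d₁ d₂ D₁ D₂ ra (rb + rc) := by
  have hJ := law_eq_channelJoint (fun s => (V₁ s, V₂ s)) A (fun s => (B₁ s, B₂ s)) hA hM
  refine siAchievable_of_channel (law_mem_stdSimplex hQ _) ?_
    (condChannel_mem_stdSimplex hQ.1 (fun s => (V₁ s, V₂ s)) A hA) hJ hra hrb hrc ?_ ?_ ?_
    hd₁ hd₂ f₁ f₂ ?_ ?_
  · intro x
    rw [law_law]
    exact hA x
  · simpa only [condEntropyOf_law] using h1
  · simpa only [condEntropyOf_law] using h2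
  · simpa only [condEntropyOf_law] using h3
  · simpa only [expect_law] using hD₁
  · simpa only [expect_law] using hD₂

theorem wzAchievable_of_siAchievable {P : X × Y₁ × Y₂ → ℝ} {d₁ : X → Z₁ → ℝ} {d₂ : X → Z₂ → ℝ}
    {D₁ D₂ R₁ R₂ : ℝ} (h : SIAchievable P d₁ d₂ D₁ D₂ R₁ R₂) :
    WZAchievable (law P fun s => (s.1, s.2.1)) d₁ D₁ R₁ := by
  intro ε hε
  obtain ⟨N, hN⟩ := h ε hε
  refine ⟨N, fun n hn => ?_⟩
  obtain ⟨M₁, M₂, C, c1, -, c3, -⟩ := hN n hn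
  refine ⟨M₁, ⟨C.enc₁, C.dec₁⟩, le_trans (le_of_eq ?_) c1, c3⟩
  simp only [WZCode.distortion, SICode.distortion₁]
  rw [← law_iidLaw, expect_law]

/-- Achievability in the Wyner-Ziv problem. -/
theorem wzAchievable_of_joint {Ω Y Z W : Type*} [Fintype Ω] [Fintype Y] [Fintype Z] [Fintype W]
    {Q : Ω → ℝ} (hQ : Q ∈ stdSimplex ℝ Ω)
    (V : Ω → W) (A : Ω → X) (B : Ω → Y) (hA : ∀ x, 0 < law Q A x) (hM : IsMarkov Q V A B)
    {d : X → Z → ℝ} (hd : ∀ x z, 0 ≤ d x z) (f : W × Y → Z) {D : ℝ}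
    (hD : expect Q (fun s => d (A s) (f (V s, B s))) ≤ D) :
    WZAchievable (law Q fun s => (A s, B s)) d D (condMutualInfo Q A V B) := by
  have hI := condMutualInfo_nonneg hQ.1 A V B
  have hM0 := condMutualInfo_eq_zero_of_isMarkov hQ.1 hM
  have key : condEntropyOf Q V B - condEntropyOf Q V A = condMutualInfo Q A V B := by
    have e1 : entropyOf Q (fun s => (V s, B s, A s)) = entropyOf Q (fun s => (A s, V s, B s)) :=
      entropyOf_congr Q fun s t => by simp only [Prod.ext_iff]; tauto
    have e2 : entropyOf Q (fun s => (B s, A s)) = entropyOf Q (fun s => (A s, B s)) :=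
      entropyOf_congr Q fun s t => by simp only [Prod.ext_iff]; tauto
    simp only [condMutualInfo, condEntropyOf] at *
    linarith
  -- The second stage is trivial, with one-point alphabets and zero distortion. Its rate is
  -- irrelevant here, so any sufficiently large number serves.
  have hsi := siAchievable_of_joint hQ V (fun _ => ()) A B (fun _ => ()) hA ?_ hI
    (abs_nonneg (condEntropyOf Q V (fun _ => ()) - condEntropyOf Q V A)) le_rfl key.le ?_ ?_
    hd (fun (_ : X) (_ : Unit) => le_rfl) f (fun _ => ()) hD (D₂ := 0) ?_
  · have := wzAchievable_of_siAchievable hsi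
    rwa [law_law] at this
  · rintro ⟨v, u⟩ x ⟨y, u'⟩
    have := hM v x y
    have e1 : law Q (fun s => ((V s, ()), A s, B s, ())) ((v, u), x, y, u') =
        law Q (fun s => (V s, A s, B s)) (v, x, y) := law_congr_apply fun s => by
      simp [Prod.ext_iff]
    have e2 : law Q (fun s => ((V s, ()), A s)) ((v, u), x) =
        law Q (fun s => (V s, A s)) (v, x) := law_congr_apply fun s => by simp [Prod.ext_iff]
    have e3 : law Q (fun s => (A s, B s, ())) (x, y, u') =
        law Q (fun s => (A s, B s)) (x, y) := law_congr_apply fun s => by simp [Prod.ext_iff]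
    rw [e1, e2, e3]
    exact this
  · exact (le_abs_self _).trans (le_add_of_nonneg_left hI)
  · have e1 : entropyOf Q (fun s => ((), V s, ())) = entropyOf Q (fun s => (V s, ())) :=
      entropyOf_congr Q fun s t => by simp [Prod.ext_iff]
    have e2 : entropyOf Q (fun s => ((V s, ()), A s)) = entropyOf Q (fun s => (V s, A s)) :=
      entropyOf_congr Q fun s t => by simp [Prod.ext_iff]
    simp only [condEntropyOf, e1, e2]
    simp
  · simp [expect]

theorem wzRate_le_of_achievable {Y Z : Type*} [Fintype Y] {p : X × Y → ℝ} {d : X → Z → ℝ}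
    {D R : ℝ} (h : WZAchievable p d D R) : wzRate p d D ≤ R :=
  sInf_le ⟨R, h, rfl⟩

end Achievability

/-! ### Data processing and conditional independence. -/

section InformationInequalities

variable {Ω α β γ α' β' : Type*} [Fintype Ω] [Fintype α] [Fintype β] [Fintype γ] [Fintype α']
  [Fintype β']

theorem condMutualInfo_eq_sub (p : Ω → ℝ) (A : Ω → α) (B : Ω → β) (C : Ω → γ) :
    condMutualInfo p A B C = condEntropyOf p A C - condEntropyOf p A (fun s => (B s, C s)) := by
  simp only [condMutualInfo, condEntropyOf]
  ring

theorem condMutualInfo_comm (p : Ω → ℝ) (A : Ω → α) (B : Ω → β) (C : Ω → γ) :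
    condMutualInfo p A B C = condMutualInfo p B A C := by
  have : entropyOf p (fun s => (A s, B s, C s)) = entropyOf p (fun s => (B s, A s, C s)) :=
    entropyOf_congr p fun s t => by simp only [Prod.ext_iff]; tauto
  simp only [condMutualInfo, this]
  ring

theorem condMutualInfo_mono {p : Ω → ℝ} (hp : ∀ s, 0 ≤ p s) {A : Ω → α} {B : Ω → β}
    {A' : Ω → α'} {B' : Ω → β'} (C : Ω → γ) (hA : ∀ s t, A s = A t → A' s = A' t)
    (hB : ∀ s t, B s = B t → B' s = B' t) :
    condMutualInfo p A' B' C ≤ condMutualInfo p A B C := by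
  have h1 : condMutualInfo p A' B' C ≤ condMutualInfo p A' B C := by
    rw [condMutualInfo_eq_sub, condMutualInfo_eq_sub]
    have := condEntropyOf_anti hp A' (B := fun s => (B s, C s)) (C := fun s => (B' s, C s))
      fun s t h => by simp only [Prod.ext_iff] at h ⊢; exact ⟨hB _ _ h.1, h.2⟩
    linarith
  have h2 : condMutualInfo p A' B C ≤ condMutualInfo p A B C := by
    rw [condMutualInfo_comm p A', condMutualInfo_comm p A, condMutualInfo_eq_sub,
      condMutualInfo_eq_sub]
    have := condEntropyOf_anti hp B (B := fun s => (A s, C s)) (C := fun s => (A' s, C s))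
      fun s t h => by simp only [Prod.ext_iff] at h ⊢; exact ⟨hA _ _ h.1, h.2⟩
    linarith
  exact h1.trans h2

/-- Under conditional independence, further conditioning does not change conditional entropy. -/
theorem condEntropyOf_eq_of_condMutualInfo_eq_zero {p : Ω → ℝ} {A : Ω → α} {B : Ω → β} {C : Ω → γ}
    (h : condMutualInfo p A B C = 0) :
    condEntropyOf p A (fun s => (B s, C s)) = condEntropyOf p A C := by
  rw [condMutualInfo_eq_sub] at h
  linarith

theorem condMutualInfo_eq_zero_mono {p : Ω → ℝ} (hp : ∀ s, 0 ≤ p s) {A : Ω → α} {B : Ω → β}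
    {A' : Ω → α'} {B' : Ω → β'} {C : Ω → γ} (h : condMutualInfo p A B C = 0)
    (hA : ∀ s t, A s = A t → A' s = A' t) (hB : ∀ s t, B s = B t → B' s = B' t) :
    condMutualInfo p A' B' C = 0 :=
  le_antisymm ((condMutualInfo_mono hp C hA hB).trans h.le) (condMutualInfo_nonneg hp _ _ _)

end InformationInequalities

/-! ### A Markov string of test channels gives perfect scalability. -/

section Sufficiency

variable {X Y₁ Y₂ Z₁ Z₂ : Type*} [Fintype X] [Fintype Y₁] [Fintype Y₂] [Fintype Z₁]
  [Fintype Z₂]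

/-- The second-stage rate splits as [H(W₁|Y₂) - H(W₁|Y₁)] + [H(W₂|W₁,Y₂) - H(W₂|W₁,X)]. The first
bracket is nonnegative because Y₂ is a degraded version of Y₁ with respect to W₁, the second because
(W₁,W₂) depends on Y₂ only through X. The link W₁ ↔ W₂ ↔ X collapses I(X;W₁,W₂|Y₂) to I(X;W₂|Y₂). -/
theorem siAchievable_of_isMarkov₅ {Ω W₁ W₂ : Type*} [Fintype Ω] [Fintype W₁] [Fintype W₂]
    {Q : Ω → ℝ} (hQ : Q ∈ stdSimplex ℝ Ω)
    (V₁ : Ω → W₁) (V₂ : Ω → W₂) (A : Ω → X) (B₁ : Ω → Y₁) (B₂ : Ω → Y₂)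
    (hA : ∀ x, 0 < law Q A x) (hM : IsMarkov₅ Q V₁ V₂ A B₁ B₂)
    {d₁ : X → Z₁ → ℝ} {d₂ : X → Z₂ → ℝ} (hd₁ : ∀ x z, 0 ≤ d₁ x z) (hd₂ : ∀ x z, 0 ≤ d₂ x z)
    (f₁ : W₁ × Y₁ → Z₁) (f₂ : W₂ × Y₂ → Z₂) {D₁ D₂ : ℝ}
    (hD₁ : expect Q (fun s => d₁ (A s) (f₁ (V₁ s, B₁ s))) ≤ D₁)
    (hD₂ : expect Q (fun s => d₂ (A s) (f₂ (V₂ s, B₂ s))) ≤ D₂) :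
    SIAchievable (law Q fun s => (A s, B₁ s, B₂ s)) d₁ d₂ D₁ D₂ (condMutualInfo Q A V₁ B₁)
      (condMutualInfo Q A V₂ B₂ - condMutualInfo Q A V₁ B₁) := by
  obtain ⟨m1, m2, m3⟩ := hM
  have i1 := condMutualInfo_eq_zero_of_isMarkov hQ.1 m1
  have i2 := condMutualInfo_eq_zero_of_isMarkov hQ.1 m2
  have i3 := condMutualInfo_eq_zero_of_isMarkov hQ.1 m3
  have a1 : condEntropyOf Q V₁ (fun s => (B₁ s, A s)) = condEntropyOf Q V₁ A :=
    condEntropyOf_eq_of_condMutualInfo_eq_zero (condMutualInfo_eq_zero_mono hQ.1 i2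
      (fun s t h => (Prod.ext_iff.1 h).1) fun s t h => (Prod.ext_iff.1 h).1)
  have a2 : condEntropyOf Q V₁ (fun s => (B₂ s, B₁ s)) = condEntropyOf Q V₁ B₁ :=
    condEntropyOf_eq_of_condMutualInfo_eq_zero (condMutualInfo_eq_zero_mono hQ.1 i3
      (fun s t h => (Prod.ext_iff.1 h).1) fun s t h => h)
  have a2' : condEntropyOf Q V₁ (fun s => (B₂ s, B₁ s)) ≤ condEntropyOf Q V₁ B₂ :=
    condEntropyOf_anti hQ.1 V₁ fun s t h => (Prod.ext_iff.1 h).1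
  have a3 : condEntropyOf Q (fun s => (V₁ s, V₂ s)) (fun s => (B₂ s, A s)) =
      condEntropyOf Q (fun s => (V₁ s, V₂ s)) A :=
    condEntropyOf_eq_of_condMutualInfo_eq_zero (condMutualInfo_eq_zero_mono hQ.1 i2
      (fun s t h => h) fun s t h => (Prod.ext_iff.1 h).2)
  have a4 : condEntropyOf Q V₁ (fun s => (B₂ s, A s)) = condEntropyOf Q V₁ A :=
    condEntropyOf_eq_of_condMutualInfo_eq_zero (condMutualInfo_eq_zero_mono hQ.1 i2
      (fun s t h => (Prod.ext_iff.1 h).1) fun s t h => (Prod.ext_iff.1 h).2)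
  have a5 : condEntropyOf Q V₂ (fun s => (V₁ s, B₂ s, A s)) ≤
      condEntropyOf Q V₂ (fun s => (V₁ s, B₂ s)) :=
    condEntropyOf_anti hQ.1 V₂ fun s t h => by simp only [Prod.ext_iff] at h ⊢; tauto
  have a6 : condEntropyOf Q V₁ (fun s => (A s, V₂ s)) = condEntropyOf Q V₁ V₂ :=
    condEntropyOf_eq_of_condMutualInfo_eq_zero (condMutualInfo_eq_zero_mono hQ.1 i1
      (fun s t h => h) fun s t h => (Prod.ext_iff.1 h).1)
  have a7 : condEntropyOf Q V₁ (fun s => (B₂ s, V₂ s)) = condEntropyOf Q V₁ V₂ :=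
    condEntropyOf_eq_of_condMutualInfo_eq_zero (condMutualInfo_eq_zero_mono hQ.1 i1
      (fun s t h => h) fun s t h => by simp only [Prod.ext_iff] at h; exact h.2.2)
  have a8 : condEntropyOf Q V₂ (fun s => (B₂ s, A s)) = condEntropyOf Q V₂ A :=
    condEntropyOf_eq_of_condMutualInfo_eq_zero (condMutualInfo_eq_zero_mono hQ.1 i2
      (fun s t h => (Prod.ext_iff.1 h).2) fun s t h => (Prod.ext_iff.1 h).2)
  have n1 := condMutualInfo_nonneg hQ.1 A V₁ B₁
  -- Joint entropies are brought to a common order of the variables, so that the remaining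
  -- identities are linear in them.
  have e1 : entropyOf Q (fun s => (V₁ s, B₁ s, A s)) = entropyOf Q (fun s => (A s, V₁ s, B₁ s)) :=
    entropyOf_congr Q fun s t => by simp only [Prod.ext_iff]; tauto
  have e2 : entropyOf Q (fun s => (B₁ s, A s)) = entropyOf Q (fun s => (A s, B₁ s)) :=
    entropyOf_congr Q fun s t => by simp only [Prod.ext_iff]; tauto
  have e3 : entropyOf Q (fun s => (V₂ s, B₂ s, A s)) = entropyOf Q (fun s => (A s, V₂ s, B₂ s)) :=
    entropyOf_congr Q fun s t => by simp only [Prod.ext_iff]; tauto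
  have e4 : entropyOf Q (fun s => (B₂ s, A s)) = entropyOf Q (fun s => (A s, B₂ s)) :=
    entropyOf_congr Q fun s t => by simp only [Prod.ext_iff]; tauto
  have e5 : entropyOf Q (fun s => (V₂ s, V₁ s, B₂ s, A s)) =
      entropyOf Q (fun s => ((V₁ s, V₂ s), B₂ s, A s)) :=
    entropyOf_congr Q fun s t => by simp only [Prod.ext_iff]; tauto
  have e6 : entropyOf Q (fun s => (V₁ s, A s, V₂ s)) = entropyOf Q (fun s => ((V₁ s, V₂ s), A s)) :=
    entropyOf_congr Q fun s t => by simp only [Prod.ext_iff]; tauto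
  have e7 : entropyOf Q (fun s => (A s, V₂ s)) = entropyOf Q (fun s => (V₂ s, A s)) :=
    entropyOf_congr Q fun s t => by simp only [Prod.ext_iff]; tauto
  have e8 : entropyOf Q (fun s => (V₁ s, B₂ s, V₂ s)) =
      entropyOf Q (fun s => (V₂ s, V₁ s, B₂ s)) :=
    entropyOf_congr Q fun s t => by simp only [Prod.ext_iff]; tauto
  have e9 : entropyOf Q (fun s => (B₂ s, V₂ s)) = entropyOf Q (fun s => (V₂ s, B₂ s)) :=
    entropyOf_congr Q fun s t => by simp only [Prod.ext_iff]; tauto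
  simp only [condEntropyOf, e1, e2, e3, e4, e5, e6, e7, e8, e9] at *
  have hsum : condMutualInfo Q A V₂ B₂ - condMutualInfo Q A V₁ B₁ =
      (condEntropyOf Q V₁ B₂ - condEntropyOf Q V₁ B₁) +
      (condEntropyOf Q V₂ (fun s => (V₁ s, B₂ s)) -
      (condEntropyOf Q (fun s => (V₁ s, V₂ s)) A - condEntropyOf Q V₁ A)) := by
    simp only [condEntropyOf, condMutualInfo]
    linarith
  rw [hsum]
  refine siAchievable_of_joint hQ V₁ V₂ A B₁ B₂ hA m2 n1 ?_ ?_ ?_ ?_ le_rfl hd₁ hd₂ f₁ f₂ hD₁ hD₂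
  · simp only [condEntropyOf]; linarith
  · simp only [condEntropyOf]; linarith
  · simp only [condEntropyOf, condMutualInfo]; linarith
  · simp only [condEntropyOf, condMutualInfo]; linarith

theorem law_fst_pos_of_support {P : X × Y₁ × Y₂ → ℝ} (hP : ∀ s, 0 ≤ P s)
    (hSupport : ∃ y₁ : Y₁, ∀ x : X, 0 < law P (fun s => (s.1, s.2.1)) (x, y₁)) (x : X) :
    0 < law P (fun s => s.1) x := by
  obtain ⟨y, hy⟩ := hSupport
  exact (hy x).trans_le (law_mono_apply hP fun t h => (Prod.ext_iff.1 h).1)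

theorem perfectlyScalable_of_hasMarkovTestChannels {P : X × Y₁ × Y₂ → ℝ}
    (hP : P ∈ stdSimplex ℝ (X × Y₁ × Y₂)) {d₁ : X → Z₁ → ℝ} {d₂ : X → Z₂ → ℝ}
    (hd₁ : ∀ x z, 0 ≤ d₁ x z) (hd₂ : ∀ x z, 0 ≤ d₂ x z)
    (hSupport : ∃ y₁ : Y₁, ∀ x : X, 0 < law P (fun s => (s.1, s.2.1)) (x, y₁))
    {D₁ D₂ : ℝ} {k₁ k₂ : ℕ} (h : HasMarkovTestChannels P d₁ d₂ D₁ D₂ k₁ k₂) :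
    PerfectlyScalable P d₁ d₂ D₁ D₂ := by
  obtain ⟨Q, hQ, f₁, f₂, hlaw, hM, hR₁, hR₂, hD₁, hD₂⟩ := h
  refine ⟨_, _, hR₁, hR₂, ?_⟩
  have hA : ∀ x, 0 < law Q (fun s => s.2.2.1) x := by
    intro x
    have := law_fst_pos_of_support hP.1 hSupport x
    rw [← hlaw, law_law] at this
    exact this
  have := siAchievable_of_isMarkov₅ hQ (fun s => s.1) (fun s => s.2.1) (fun s => s.2.2.1)
    (fun s => s.2.2.2.1) (fun s => s.2.2.2.2) hA hM hd₁ hd₂ f₁ f₂ hD₁ hD₂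
  rw [← hlaw]
  exact this

end Sufficiency

/-! ### Entropy of blocks, messages and mixtures. -/

section EntropyOfBlocks

variable {Ω Γ α β γ ι : Type*} [Fintype Ω] [Fintype Γ] [Fintype α] [Fintype β] [Fintype γ]
  [Fintype ι]

theorem entropyOf_iidLaw {p : Γ → ℝ} (hp : p ∈ stdSimplex ℝ Γ) (n : ℕ) (f : Γ → α) :
    entropyOf (iidLaw p n) (fun s i => f (s i)) = n * entropyOf p f := by
  rw [entropyOf_eq, entropyOf_eq, law_iidLaw]
  have h1 : ∀ s : Fin n → Γ, iidLaw p n s * Real.log (iidLaw (law p f) n fun i => f (s i)) =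
      ∑ i, iidLaw p n s * Real.log (law p f (f (s i))) := by
    intro s
    rw [← Finset.mul_sum]
    rcases (iidLaw_nonneg hp.1 n s).eq_or_lt with h0 | h0
    · rw [← h0]; simp
    · rw [iidLaw, iidLaw, Real.log_prod]
      intro i _
      have hi : 0 < p (s i) := (hp.1 _).lt_of_ne fun h =>
        h0.ne' (Finset.prod_eq_zero (Finset.mem_univ i) h.symm)
      exact (hi.trans_le (le_law_apply hp.1 f _)).ne'
  simp only [h1]
  rw [Finset.sum_comm]
  have h2 : ∀ i : Fin n, ∑ s, iidLaw p n s * Real.log (law p f (f (s i))) =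
      ∑ a, p a * Real.log (law p f (f a)) := fun i =>
    expect_iidLaw_coord hp.2 i fun a => Real.log (law p f (f a))
  simp [h2]

/-- I(A;B|C) ≤ H(B|C) ≤ H(B). In the converse `B` is the message, so this is a lower bound on the
rate. -/
theorem condMutualInfo_le_log_card {p : Ω → ℝ} (hp : p ∈ stdSimplex ℝ Ω) (A : Ω → α) (B : Ω → β)
    (C : Ω → γ) : condMutualInfo p A B C ≤ Real.log (Fintype.card β) := by
  have h1 := entropyOf_le_log_card hp B
  have h2 := condEntropyOf_anti hp.1 B (B := C) (C := fun _ => ()) fun _ _ _ => rfl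
  have h3 : entropyOf p (fun s => (A s, C s)) ≤ entropyOf p (fun s => (A s, B s, C s)) :=
    entropyOf_mono hp.1 fun s t h => by simp only [Prod.ext_iff] at h ⊢; tauto
  have h4 : entropyOf p (fun s => (B s, ())) = entropyOf p B :=
    entropyOf_congr p fun s t => by simp [Prod.ext_iff]
  have h5 : entropyOf p (fun _ => ()) = 0 := by
    simp [entropyOf, law, hp.2]
  simp only [condEntropyOf, condMutualInfo, h4, h5] at *
  linarith

/-- Entropy of a mixture together with its index. -/
theorem entropyOf_mixture {δ : Type*} [Fintype δ] (c : ι → ℝ) {Q : ι → Γ → ℝ}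
    (hQ : ∀ i, ∑ s, Q i s = 1) (D : Γ → δ) :
    entropyOf (fun x : ι × Γ => c x.1 * Q x.1 x.2) (fun x => (D x.2, x.1)) =
      ∑ i, c i * entropyOf (Q i) D + ∑ i, Real.negMulLog (c i) := by
  classical
  rw [entropyOf, Fintype.sum_prod_type_right, ← Finset.sum_add_distrib]
  refine Finset.sum_congr rfl fun i _ => ?_
  have h3 : ∀ d, law (fun x : ι × Γ => c x.1 * Q x.1 x.2) (fun x => (D x.2, x.1)) (d, i) =
      c i * law (Q i) D d := by
    intro d
    simp only [law, Fintype.sum_prod_type, Finset.mul_sum]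
    rw [Finset.sum_eq_single i]
    · refine Finset.sum_congr rfl fun s _ => ?_
      by_cases h : D s = d <;> simp [h]
    · intro j _ hj
      simp [hj]
    · simp
  simp only [h3, Real.negMulLog_mul, Finset.sum_add_distrib, ← Finset.mul_sum, ← Finset.sum_mul]
  rw [sum_law, hQ i, entropyOf]
  ring

/-- Concavity of conditional entropy. -/
theorem condEntropyOf_concave {c : ι → ℝ} (hc : c ∈ stdSimplex ℝ ι) {Q : ι → Γ → ℝ}
    (hQ : ∀ i, Q i ∈ stdSimplex ℝ Γ) (A : Γ → α) (B : Γ → β) :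
    ∑ i, c i * condEntropyOf (Q i) A B ≤ condEntropyOf (fun s => ∑ i, c i * Q i s) A B := by
  classical
  set p : ι × Γ → ℝ := fun x => c x.1 * Q x.1 x.2 with hp
  have hp0 : ∀ x, 0 ≤ p x := fun x => mul_nonneg (hc.1 _) ((hQ _).1 _)
  have h1 : law p (fun x => x.2) = fun s => ∑ i, c i * Q i s := by
    funext s
    simp only [law, hp, Fintype.sum_prod_type]
    refine Finset.sum_congr rfl fun i _ => ?_
    simp
  -- Forgetting the mixture index can only increase the conditional entropy.
  have h4 := condEntropyOf_anti hp0 (fun x => A x.2) (B := fun x => (B x.2, x.1))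
    (C := fun x => B x.2) fun s t h => (Prod.ext_iff.1 h).1
  rw [← condEntropyOf_law p (fun x => x.2) A B, h1] at h4
  refine le_trans (le_of_eq ?_) h4
  have h5 : entropyOf p (fun x => (A x.2, B x.2, x.1)) =
      entropyOf p (fun x => ((A x.2, B x.2), x.1)) :=
    entropyOf_congr p fun s t => by simp only [Prod.ext_iff]; tauto
  rw [condEntropyOf, h5, entropyOf_mixture c (fun i => (hQ i).2) fun s => (A s, B s),
    entropyOf_mixture c (fun i => (hQ i).2) B]
  simp only [condEntropyOf, mul_sub, Finset.sum_sub_distrib]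
  ring

theorem condEntropyOf_prod {p : Ω → ℝ} (A : Ω → α) (B : Ω → β)
    (C : Ω → γ) : condEntropyOf p (fun s => (A s, B s)) C =
      condEntropyOf p B C + condEntropyOf p A (fun s => (B s, C s)) := by
  have : entropyOf p (fun s => ((A s, B s), C s)) = entropyOf p (fun s => (A s, B s, C s)) :=
    entropyOf_congr p fun s t => by simp only [Prod.ext_iff]; tauto
  simp only [condEntropyOf, this]
  ring

end EntropyOfBlocks

/-! ### Single-letter outer bound with strategies as auxiliary letters. -/

section OuterBound

variable {X Y₁ Y₂ Z₁ Z₂ : Type*} [Fintype X] [Fintype Y₁] [Fintype Y₂] [Fintype Z₁]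
  [Fintype Z₂] [DecidableEq Y₁] [DecidableEq Y₂]

/-- The reproduction strategies induced at letter `i` by a code: letter `i` of each reproduction
as a function of letter `i` of the side information. -/
def SICode.strategy {n M₁ M₂ : ℕ} (C : SICode X Y₁ Y₂ Z₁ Z₂ n M₁ M₂) (i : Fin n)
    (s : Fin n → X × Y₁ × Y₂) : (Y₁ → Z₁) × (Y₂ → Z₂) :=
  (fun y => C.dec₁ (C.enc₁ fun j => (s j).1) (Function.update (fun j => (s j).2.1) i y) i,
   fun y => C.dec₂ (C.enc₁ fun j => (s j).1) (C.enc₂ fun j => (s j).1)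
    (Function.update (fun j => (s j).2.2) i y) i)

/-- The true side letter i is overwritten, so it does not influence the strategy. Hence the strategy
depends on letter i of the source triple through its `X` component alone. -/
theorem SICode.strategy_insertNth {n M₁ M₂ : ℕ} (C : SICode X Y₁ Y₂ Z₁ Z₂ (n + 1) M₁ M₂)
    (i : Fin (n + 1)) (x : X) (y y' : Y₁ × Y₂) (s : Fin n → X × Y₁ × Y₂) :
    C.strategy i (i.insertNth (x, y) s) = C.strategy i (i.insertNth (x, y') s) := by
  have h : ∀ j : Fin (n + 1), j = i ∨ ∃ k, j = i.succAbove k := fun j => by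
    by_cases hj : j = i
    · exact Or.inl hj
    · exact Or.inr ((Fin.exists_succAbove_eq hj).imp fun _ h => h.symm)
  have e0 : (fun j => (i.insertNth (α := fun _ => X × Y₁ × Y₂) (x, y) s j).1) =
      fun j => (i.insertNth (α := fun _ => X × Y₁ × Y₂) (x, y') s j).1 := by
    funext j
    rcases h j with rfl | ⟨k, rfl⟩ <;> simp
  have e1 : ∀ z, Function.update (fun j => (i.insertNth (α := fun _ => X × Y₁ × Y₂) (x, y) s j).2.1) i z =
      Function.update (fun j => (i.insertNth (α := fun _ => X × Y₁ × Y₂) (x, y') s j).2.1) i z := by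
    intro z
    funext j
    rcases h j with rfl | ⟨k, rfl⟩ <;> simp
  have e2 : ∀ z, Function.update (fun j => (i.insertNth (α := fun _ => X × Y₁ × Y₂) (x, y) s j).2.2) i z =
      Function.update (fun j => (i.insertNth (α := fun _ => X × Y₁ × Y₂) (x, y') s j).2.2) i z := by
    intro z
    funext j
    rcases h j with rfl | ⟨k, rfl⟩ <;> simp
  simp only [SICode.strategy, e0, e1, e2]

/-- The letter-`i` strategies of a code are generated from `X i` by a channel. -/
theorem SICode.exists_channel {P : X × Y₁ × Y₂ → ℝ} (hP : P ∈ stdSimplex ℝ (X × Y₁ × Y₂))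
    {n M₁ M₂ : ℕ} (C : SICode X Y₁ Y₂ Z₁ Z₂ n M₁ M₂) (i : Fin n) :
    ∃ q : X → (Y₁ → Z₁) × (Y₂ → Z₂) → ℝ, (∀ x, q x ∈ stdSimplex ℝ ((Y₁ → Z₁) × (Y₂ → Z₂))) ∧
      law (iidLaw P n) (fun s => (s i, C.strategy i s)) = channelJoint P (fun s => s.1) q := by
  classical
  cases n with
  | zero => exact i.elim0
  | succ n =>
    have hne : Nonempty (X × Y₁ × Y₂) := by
      by_contra hne
      rw [not_nonempty_iff] at hne
      have := hP.2
      simp at this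
    obtain ⟨x₀, y₀⟩ := hne
    refine ⟨fun x => law (iidLaw P n) fun s => C.strategy i (i.insertNth (x, y₀) s),
      fun x => law_mem_stdSimplex (iidLaw_mem_stdSimplex hP n) _, ?_⟩
    funext ⟨u, w⟩
    rw [law_eq_sum_mul, sum_iidLaw_insertNth P n i, Finset.sum_eq_single u]
    · simp only [channelJoint, Fin.insertNth_apply_same, Prod.mk.injEq, true_and]
      rw [law_eq_sum_mul]
      congr 1
      refine Finset.sum_congr rfl fun s _ => ?_
      rw [← C.strategy_insertNth i u.1 u.2 y₀ s]
    · intro a _ ha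
      simp [ha]
    · simp

/-- log M₁ ≥ I(Xⁿ; message | Y₁ⁿ). The message together with the whole side-information block
determines every strategy of decoder one, so conditioning on the strategy and letter i alone is
weaker. -/
theorem SICode.rate_bound₁ {P : X × Y₁ × Y₂ → ℝ} (hP : P ∈ stdSimplex ℝ (X × Y₁ × Y₂))
    {n M₁ M₂ : ℕ} (C : SICode X Y₁ Y₂ Z₁ Z₂ n M₁ M₂) :
    n * condEntropyOf P (fun u => u.1) (fun u => u.2.1) - ∑ i, condEntropyOf (iidLaw P n)
      (fun s => (s i).1) (fun s => ((C.strategy i s).1, (s i).2.1)) ≤ Real.log M₁ := by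
  have hμ := iidLaw_mem_stdSimplex hP n
  have h1 := condMutualInfo_le_log_card hμ (fun s (i : Fin n) => (s i).1)
    (fun s => C.enc₁ fun j => (s j).1) (fun s (i : Fin n) => (s i).2.1)
  rw [Fintype.card_fin, condMutualInfo_eq_sub] at h1
  have h2 : condEntropyOf (iidLaw P n) (fun s (i : Fin n) => (s i).1)
      (fun s (i : Fin n) => (s i).2.1) = n * condEntropyOf P (fun u => u.1) (fun u => u.2.1) := by
    have e1 : entropyOf (iidLaw P n) (fun s => ((fun i => (s i).1), (fun i => (s i).2.1))) =
        entropyOf (iidLaw P n) (fun s i => ((s i).1, (s i).2.1)) :=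
      entropyOf_congr _ fun s t => by simp only [Prod.ext_iff, funext_iff, forall_and]
    rw [condEntropyOf, e1, entropyOf_iidLaw hP n fun u => (u.1, u.2.1),
      entropyOf_iidLaw hP n fun u => u.2.1, condEntropyOf]
    ring
  have h3 := condEntropyOf_pi_le hμ.1 (fun (i : Fin n) s => (s i).1)
    (fun s => (C.enc₁ fun j => (s j).1, fun i => (s i).2.1))
  have h4 : ∀ i : Fin n, condEntropyOf (iidLaw P n) (fun s => (s i).1)
      (fun s => (C.enc₁ fun j => (s j).1, fun i => (s i).2.1)) ≤ condEntropyOf (iidLaw P n)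
      (fun s => (s i).1) (fun s => ((C.strategy i s).1, (s i).2.1)) := fun i =>
    condEntropyOf_anti hμ.1 _ fun s t h => by
      simp only [Prod.mk.injEq] at h
      obtain ⟨ha, hb⟩ := h
      refine Prod.ext ?_ (congrFun hb i)
      simp only [SICode.strategy, ha, hb]
  have h5 := Finset.sum_le_sum fun i (_ : i ∈ Finset.univ) => h4 i
  linarith

/-- log(M₁M₂) ≥ I(Xⁿ,Y₁ⁿ; messages | Y₂ⁿ), with Y₁ⁿ revealed before Xⁿ in the chain rule. Messages
and Y₂ⁿ determine the second strategy; once Y₁ⁿ is also known, both strategies are determined. The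
last term is what later forces I(X;W₁|W₂,Y₁,Y₂) = 0. -/
theorem SICode.rate_bound₂ {P : X × Y₁ × Y₂ → ℝ} (hP : P ∈ stdSimplex ℝ (X × Y₁ × Y₂))
    {n M₁ M₂ : ℕ} (C : SICode X Y₁ Y₂ Z₁ Z₂ n M₁ M₂) :
    n * condEntropyOf P (fun u => (u.1, u.2.1)) (fun u => u.2.2) - ∑ i, (condEntropyOf (iidLaw P n)
      (fun s => (s i).2.1) (fun s => ((C.strategy i s).2, (s i).2.2)) + condEntropyOf (iidLaw P n)
      (fun s => (s i).1) (fun s => (C.strategy i s, (s i).2))) ≤ Real.log (M₁ * M₂ : ℝ) := by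
  have hμ := iidLaw_mem_stdSimplex hP n
  have h1 := condMutualInfo_le_log_card hμ
    (fun s => ((fun i : Fin n => (s i).1), (fun i : Fin n => (s i).2.1)))
    (fun s => (C.enc₁ fun j => (s j).1, C.enc₂ fun j => (s j).1)) (fun s (i : Fin n) => (s i).2.2)
  rw [Fintype.card_prod, Fintype.card_fin, Fintype.card_fin, condMutualInfo_eq_sub] at h1
  push_cast at h1
  have h2 : condEntropyOf (iidLaw P n)
      (fun s => ((fun i : Fin n => (s i).1), (fun i : Fin n => (s i).2.1)))
      (fun s (i : Fin n) => (s i).2.2) =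
      n * condEntropyOf P (fun u => (u.1, u.2.1)) (fun u => u.2.2) := by
    have e1 : entropyOf (iidLaw P n) (fun s => (((fun i => (s i).1), (fun i => (s i).2.1)),
        (fun i => (s i).2.2))) =
        entropyOf (iidLaw P n) (fun s i => (((s i).1, (s i).2.1), (s i).2.2)) :=
      entropyOf_congr _ fun s t => by simp only [Prod.ext_iff, funext_iff, forall_and]
    rw [condEntropyOf, e1, entropyOf_iidLaw hP n fun u => ((u.1, u.2.1), u.2.2),
      entropyOf_iidLaw hP n fun u => u.2.2, condEntropyOf]
    ring
  rw [condEntropyOf_prod (p := iidLaw P n) (fun s (i : Fin n) => (s i).1)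
    (fun s (i : Fin n) => (s i).2.1)
    (fun s => ((C.enc₁ fun j => (s j).1, C.enc₂ fun j => (s j).1), fun i => (s i).2.2))] at h1
  have h3 := condEntropyOf_pi_le hμ.1 (fun (i : Fin n) s => (s i).2.1)
    (fun s => ((C.enc₁ fun j => (s j).1, C.enc₂ fun j => (s j).1), fun i => (s i).2.2))
  have h4 := condEntropyOf_pi_le hμ.1 (fun (i : Fin n) s => (s i).1)
    (fun s => ((fun i : Fin n => (s i).2.1), (C.enc₁ fun j => (s j).1, C.enc₂ fun j => (s j).1),
      fun i => (s i).2.2))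
  have h5 : ∀ i : Fin n, condEntropyOf (iidLaw P n) (fun s => (s i).2.1)
      (fun s => ((C.enc₁ fun j => (s j).1, C.enc₂ fun j => (s j).1), fun i => (s i).2.2)) ≤
      condEntropyOf (iidLaw P n)
      (fun s => (s i).2.1) (fun s => ((C.strategy i s).2, (s i).2.2)) := fun i =>
    condEntropyOf_anti hμ.1 _ fun s t h => by
      simp only [Prod.mk.injEq] at h
      obtain ⟨⟨ha1, ha2⟩, hb⟩ := h
      refine Prod.ext ?_ (congrFun hb i)
      simp only [SICode.strategy, ha1, ha2, hb]
  have h6 : ∀ i : Fin n, condEntropyOf (iidLaw P n) (fun s => (s i).1)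
      (fun s => ((fun i : Fin n => (s i).2.1), (C.enc₁ fun j => (s j).1, C.enc₂ fun j => (s j).1),
      fun i => (s i).2.2)) ≤ condEntropyOf (iidLaw P n)
      (fun s => (s i).1) (fun s => (C.strategy i s, (s i).2)) := fun i =>
    condEntropyOf_anti hμ.1 _ fun s t h => by
      simp only [Prod.mk.injEq] at h
      obtain ⟨hc, ⟨ha1, ha2⟩, hb⟩ := h
      refine Prod.ext ?_ (Prod.ext (congrFun hc i) (congrFun hb i))
      simp only [SICode.strategy, ha1, ha2, hb, hc]
  have h7 := Finset.sum_le_sum fun i (_ : i ∈ Finset.univ) => h5 i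
  have h8 := Finset.sum_le_sum fun i (_ : i ∈ Finset.univ) => h6 i
  rw [Finset.sum_add_distrib]
  linarith

/-- Single-letter outer bound for a block code. -/
theorem SICode.exists_single_letter {P : X × Y₁ × Y₂ → ℝ} (hP : P ∈ stdSimplex ℝ (X × Y₁ × Y₂))
    {n M₁ M₂ : ℕ} (hn : 0 < n) (C : SICode X Y₁ Y₂ Z₁ Z₂ n M₁ M₂) (d₁ : X → Z₁ → ℝ)
    (d₂ : X → Z₂ → ℝ) :
    ∃ q : X → (Y₁ → Z₁) × (Y₂ → Z₂) → ℝ, (∀ x, q x ∈ stdSimplex ℝ ((Y₁ → Z₁) × (Y₂ → Z₂))) ∧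
      condEntropyOf P (fun u => u.1) (fun u => u.2.1) -
        condEntropyOf (channelJoint P (fun s => s.1) q) (fun t => t.1.1)
          (fun t => (t.2.1, t.1.2.1)) ≤ (1 / (n : ℝ)) * Real.log M₁ ∧
      condEntropyOf P (fun u => (u.1, u.2.1)) (fun u => u.2.2) -
        (condEntropyOf (channelJoint P (fun s => s.1) q) (fun t => t.1.2.1)
          (fun t => (t.2.2, t.1.2.2)) +
        condEntropyOf (channelJoint P (fun s => s.1) q) (fun t => t.1.1)
          (fun t => (t.2, t.1.2))) ≤ (1 / (n : ℝ)) * Real.log (M₁ * M₂ : ℝ) ∧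
      expect (channelJoint P (fun s => s.1) q) (fun t => d₁ t.1.1 (t.2.1 t.1.2.1)) =
        C.distortion₁ P d₁ ∧
      expect (channelJoint P (fun s => s.1) q) (fun t => d₂ t.1.1 (t.2.2 t.1.2.2)) =
        C.distortion₂ P d₂ := by
  have hn' : (0 : ℝ) < n := by exact_mod_cast hn
  choose q hq hqe using C.exists_channel hP
  -- Uniform mixture of the n letter channels. All have the same output alphabet, so no time-sharing
  -- variable has to be recorded.
  have hc : (fun _ : Fin n => 1 / (n : ℝ)) ∈ stdSimplex ℝ (Fin n) :=
    ⟨fun _ => by positivity, by simp [hn'.ne']⟩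
  have hJ : channelJoint P (fun s => s.1) (fun x w => ∑ i, 1 / (n : ℝ) * q i x w) =
      fun t => ∑ i, 1 / (n : ℝ) * channelJoint P (fun s => s.1) (q i) t := by
    funext t
    simp only [channelJoint, Finset.mul_sum]
    exact Finset.sum_congr rfl fun i _ => by ring
  have hex : ∀ g : (X × Y₁ × Y₂) × ((Y₁ → Z₁) × (Y₂ → Z₂)) → ℝ,
      expect (channelJoint P (fun s => s.1) (fun x w => ∑ i, 1 / (n : ℝ) * q i x w)) g =
      1 / (n : ℝ) * ∑ i, expect (iidLaw P n) (fun s => g (s i, C.strategy i s)) := by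
    intro g
    rw [hJ]
    simp only [← hqe, ← expect_law]
    simp only [expect, Finset.sum_mul, Finset.mul_sum]
    rw [Finset.sum_comm]
    exact Finset.sum_congr rfl fun i _ => Finset.sum_congr rfl fun t _ => by ring
  refine ⟨fun x w => ∑ i, 1 / (n : ℝ) * q i x w, fun x => ⟨fun w => Finset.sum_nonneg fun i _ =>
    mul_nonneg (by positivity) ((hq i x).1 w), ?_⟩, ?_, ?_, ?_, ?_⟩
  · rw [Finset.sum_comm]
    simp only [← Finset.mul_sum, (hq _ _).2]
    simp [hn'.ne']
  · have h1 := C.rate_bound₁ hP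
    have h2 := condEntropyOf_concave hc (fun i => channelJoint_mem_stdSimplex hP
      (fun s => s.1) (hq i)) (fun t => t.1.1) (fun t => (t.2.1, t.1.2.1))
    rw [hJ]
    simp only [← hqe, condEntropyOf_law, ← Finset.mul_sum] at h2 ⊢
    rw [one_div, inv_mul_le_iff₀ hn'] at h2
    rw [one_div, le_inv_mul_iff₀ hn']
    linarith
  · have h1 := C.rate_bound₂ hP
    have h2 := condEntropyOf_concave hc (fun i => channelJoint_mem_stdSimplex hP
      (fun s => s.1) (hq i)) (fun t => t.1.2.1) (fun t => (t.2.2, t.1.2.2))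
    have h3 := condEntropyOf_concave hc (fun i => channelJoint_mem_stdSimplex hP
      (fun s => s.1) (hq i)) (fun t => t.1.1) (fun t => (t.2, t.1.2))
    rw [hJ]
    simp only [← hqe, condEntropyOf_law, ← Finset.mul_sum] at h2 h3 ⊢
    rw [one_div, inv_mul_le_iff₀ hn'] at h2 h3
    rw [one_div, le_inv_mul_iff₀ hn']
    rw [Finset.sum_add_distrib] at h1
    linarith
  · rw [hex, SICode.distortion₁]
    -- A strategy evaluated at the true side letter returns the actual reproduction, so the
    -- distortions agree exactly.
    simp only [SICode.strategy, Function.update_eq_self, vecDist, expect, Finset.mul_sum]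
    rw [Finset.sum_comm]
    exact Finset.sum_congr rfl fun s _ => Finset.sum_congr rfl fun i _ => by ring
  · rw [hex, SICode.distortion₂]
    simp only [SICode.strategy, Function.update_eq_self, vecDist, expect, Finset.mul_sum]
    rw [Finset.sum_comm]
    exact Finset.sum_congr rfl fun s _ => Finset.sum_congr rfl fun i _ => by ring

end OuterBound

/-! ### Criteria for Markov strings. -/

section MarkovCriteria

variable {Ω α β γ α' β' : Type*} [Fintype Ω] [Fintype α] [Fintype β] [Fintype γ] [Fintype α']
  [Fintype β']

theorem isMarkov_iff_condMutualInfo_eq_zero {p : Ω → ℝ} (hp : ∀ s, 0 ≤ p s) {A : Ω → α} {B : Ω → β}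
    {C : Ω → γ} : IsMarkov p A C B ↔ condMutualInfo p A B C = 0 := by
  refine ⟨condMutualInfo_eq_zero_of_isMarkov hp, fun h a c b => ?_⟩
  have h1 := isMarkov_of_condMutualInfo_eq_zero hp h a b c
  have e1 : law p (fun s => (A s, C s, B s)) (a, c, b) =
      law p (fun s => (A s, B s, C s)) (a, b, c) :=
    law_congr_apply fun s => by simp only [Prod.ext_iff]; tauto
  have e2 : law p (fun s => (C s, B s)) (c, b) = law p (fun s => (B s, C s)) (b, c) :=
    law_congr_apply fun s => by simp only [Prod.ext_iff]; tauto
  rw [e1, e2, h1]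

theorem IsMarkov.mono {p : Ω → ℝ} (hp : ∀ s, 0 ≤ p s) {A : Ω → α} {B : Ω → β} {C : Ω → γ}
    {A' : Ω → α'} {B' : Ω → β'} (h : IsMarkov p A C B)
    (hA : ∀ s t, A s = A t → A' s = A' t) (hB : ∀ s t, B s = B t → B' s = B' t) :
    IsMarkov p A' C B' :=
  (isMarkov_iff_condMutualInfo_eq_zero hp).2
    (condMutualInfo_eq_zero_mono hp (condMutualInfo_eq_zero_of_isMarkov hp h) hA hB)

theorem isMarkov_of_law_eq_mul {p : Ω → ℝ} {A : Ω → α} {B : Ω → β} {C : Ω → γ} (f : α → β → ℝ)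
    (g : β → γ → ℝ) (h : ∀ a b c, law p (fun s => (A s, B s, C s)) (a, b, c) = f a b * g b c) :
    IsMarkov p A B C := by
  have hBC : ∀ b c, law p (fun s => (B s, C s)) (b, c) = (∑ a, f a b) * g b c := fun b c => by
    rw [← sum_law_fst p A fun s => (B s, C s), Finset.sum_mul]
    exact Finset.sum_congr rfl fun a _ => h a b c
  have hB : ∀ b, law p B b = (∑ a, f a b) * ∑ c, g b c := fun b => by
    rw [← sum_law_snd p B C, Finset.mul_sum]
    exact Finset.sum_congr rfl fun c _ => hBC b c
  have hAB : ∀ a b, law p (fun s => (A s, B s)) (a, b) = f a b * ∑ c, g b c := fun a b => by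
    rw [← sum_law_snd p (fun s => (A s, B s)) C, Finset.mul_sum]
    refine Finset.sum_congr rfl fun c _ => ?_
    rw [← h a b c]
    exact law_congr_apply fun s => by simp only [Prod.ext_iff]; tauto
  intro a b c
  rw [h, hB, hAB, hBC]
  ring

theorem law_apply_of_injective {p : Ω → ℝ} {A : Ω → α} (hA : Function.Injective A) (s : Ω) :
    law p A (A s) = p s := by
  classical
  unfold law
  rw [Finset.sum_eq_single s] <;> simp +contextual [hA.eq_iff]

theorem isMarkov_channelJoint {X C U : Type*} [Fintype X] [Fintype C] [Fintype U] (P : U → ℝ)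
    (v : U → X) (q : X → C → ℝ) :
    IsMarkov (channelJoint P v q) (fun t => t.2) (fun t => v t.1) (fun t => t.1) := by
  classical
  refine isMarkov_of_law_eq_mul (fun c x => q x c) (fun x u => if v u = x then P u else 0) ?_
  intro c x u
  by_cases h : v u = x
  · subst h
    have hinj : Function.Injective fun t : U × C => (t.2, v t.1, t.1) := fun s t h => by
      simp only [Prod.ext_iff] at h ⊢; tauto
    rw [law_apply_of_injective hinj (u, c)]
    simp [channelJoint, mul_comm]
  · rw [if_neg h, mul_zero, law]
    refine Finset.sum_eq_zero fun t _ => if_neg fun ht => h ?_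
    simp only [Prod.ext_iff] at ht
    rw [← ht.2.2, ht.2.1]

end MarkovCriteria

/-! ### Continuity of information quantities in the channel. -/

section Continuity

variable {T Ω α β : Type*} [TopologicalSpace T] [Fintype Ω] [Fintype α] [Fintype β]

theorem continuous_entropyOf {p : T → Ω → ℝ} (hp : Continuous p) (A : Ω → α) :
    Continuous fun t => entropyOf (p t) A := by
  classical
  unfold entropyOf law
  refine continuous_finsetSum _ fun a _ => Real.continuous_negMulLog.comp
    (continuous_finsetSum _ fun s _ => ?_)
  split_ifs
  · exact (continuous_apply s).comp hp
  · exact continuous_const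

theorem continuous_condEntropyOf {p : T → Ω → ℝ} (hp : Continuous p) (A : Ω → α) (B : Ω → β) :
    Continuous fun t => condEntropyOf (p t) A B :=
  (continuous_entropyOf hp _).sub (continuous_entropyOf hp _)

theorem continuous_expect {p : T → Ω → ℝ} (hp : Continuous p) (g : Ω → ℝ) :
    Continuous fun t => expect (p t) g :=
  continuous_finsetSum _ fun s _ => ((continuous_apply s).comp hp).mul continuous_const

theorem continuous_channelJoint {U X C : Type*} (P : U → ℝ) (v : U → X) :
    Continuous fun q : X → C → ℝ => channelJoint P v q :=
  continuous_pi fun t => continuous_const.mul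
    ((continuous_apply t.2).comp (continuous_apply (v t.1)))

end Continuity

/-! ### Perfect scalability forces a factored test channel. -/

section Converse

variable {X Y₁ Y₂ Z₁ Z₂ : Type*} [Fintype X] [Fintype Y₁] [Fintype Y₂] [Fintype Z₁]
  [Fintype Z₂] [DecidableEq Y₁] [DecidableEq Y₂]

/-- The outer bound is attained by one test channel with strategies as outputs. -/
theorem exists_channel_of_siAchievable {P : X × Y₁ × Y₂ → ℝ}
    (hP : P ∈ stdSimplex ℝ (X × Y₁ × Y₂)) {d₁ : X → Z₁ → ℝ} {d₂ : X → Z₂ → ℝ} {D₁ D₂ R₁ R₂ : ℝ}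
    (h : SIAchievable P d₁ d₂ D₁ D₂ R₁ R₂) :
    ∃ q : X → (Y₁ → Z₁) × (Y₂ → Z₂) → ℝ, (∀ x, q x ∈ stdSimplex ℝ ((Y₁ → Z₁) × (Y₂ → Z₂))) ∧
      condEntropyOf P (fun u => u.1) (fun u => u.2.1) -
        condEntropyOf (channelJoint P (fun s => s.1) q) (fun t => t.1.1)
          (fun t => (t.2.1, t.1.2.1)) ≤ R₁ ∧
      condEntropyOf P (fun u => (u.1, u.2.1)) (fun u => u.2.2) -
        (condEntropyOf (channelJoint P (fun s => s.1) q) (fun t => t.1.2.1)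
          (fun t => (t.2.2, t.1.2.2)) +
        condEntropyOf (channelJoint P (fun s => s.1) q) (fun t => t.1.1)
          (fun t => (t.2, t.1.2))) ≤ R₁ + R₂ ∧
      expect (channelJoint P (fun s => s.1) q) (fun t => d₁ t.1.1 (t.2.1 t.1.2.1)) ≤ D₁ ∧
      expect (channelJoint P (fun s => s.1) q) (fun t => d₂ t.1.1 (t.2.2 t.1.2.2)) ≤ D₂ := by
  have hX : Nonempty X := by
    by_contra hne
    rw [not_nonempty_iff] at hne
    have := hP.2
    simp at this
  set K : Set (X → (Y₁ → Z₁) × (Y₂ → Z₂) → ℝ) :=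
    Set.univ.pi fun _ => stdSimplex ℝ ((Y₁ → Z₁) × (Y₂ → Z₂)) with hK
  have hKc : IsCompact K := isCompact_univ_pi fun _ => isCompact_stdSimplex ℝ _
  set F₁ : (X → (Y₁ → Z₁) × (Y₂ → Z₂) → ℝ) → ℝ := fun q =>
    condEntropyOf P (fun u => u.1) (fun u => u.2.1) -
        condEntropyOf (channelJoint P (fun s => s.1) q) (fun t => t.1.1)
          (fun t => (t.2.1, t.1.2.1)) with hF₁
  set F₂ : (X → (Y₁ → Z₁) × (Y₂ → Z₂) → ℝ) → ℝ := fun q =>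
    condEntropyOf P (fun u => (u.1, u.2.1)) (fun u => u.2.2) -
        (condEntropyOf (channelJoint P (fun s => s.1) q) (fun t => t.1.2.1)
          (fun t => (t.2.2, t.1.2.2)) +
        condEntropyOf (channelJoint P (fun s => s.1) q) (fun t => t.1.1)
          (fun t => (t.2, t.1.2))) with hF₂
  set E₁ : (X → (Y₁ → Z₁) × (Y₂ → Z₂) → ℝ) → ℝ := fun q =>
    expect (channelJoint P (fun s => s.1) q) (fun t => d₁ t.1.1 (t.2.1 t.1.2.1)) with hE₁
  set E₂ : (X → (Y₁ → Z₁) × (Y₂ → Z₂) → ℝ) → ℝ := fun q =>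
    expect (channelJoint P (fun s => s.1) q) (fun t => d₂ t.1.1 (t.2.2 t.1.2.2)) with hE₂
  have hcJ := continuous_channelJoint (C := (Y₁ → Z₁) × (Y₂ → Z₂)) P
    (fun s : X × Y₁ × Y₂ => s.1)
  have cF₁ : Continuous F₁ := continuous_const.sub (continuous_condEntropyOf hcJ _ _)
  have cF₂ : Continuous F₂ := continuous_const.sub
    ((continuous_condEntropyOf hcJ _ _).add (continuous_condEntropyOf hcJ _ _))
  have cE₁ : Continuous E₁ := continuous_expect hcJ _
  have cE₂ : Continuous E₂ := continuous_expect hcJ _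
  -- Codes with tolerance 1/(k+1) and positive block length; the sum of two rates doubles the
  -- tolerance.
  have hseq : ∀ k : ℕ, ∃ q ∈ K, F₁ q ≤ R₁ + 1 / ((k : ℝ) + 1) ∧
      F₂ q ≤ R₁ + R₂ + 2 * (1 / ((k : ℝ) + 1)) ∧
      E₁ q ≤ D₁ + 1 / ((k : ℝ) + 1) ∧ E₂ q ≤ D₂ + 1 / ((k : ℝ) + 1) := by
    intro k
    obtain ⟨N, hN⟩ := h (1 / ((k : ℝ) + 1)) (by positivity)
    obtain ⟨M₁, M₂, C, c1, c2, c3, c4⟩ := hN (N + 1) (Nat.le_succ N)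
    -- The encoder takes a value, so the message set is nonempty and the logarithm of the product
    -- splits.
    have hM₁ : (M₁ : ℝ) ≠ 0 := by
      have := (C.enc₁ fun _ => hX.some).pos
      exact_mod_cast this.ne'
    have hM₂ : (M₂ : ℝ) ≠ 0 := by
      have := (C.enc₂ fun _ => hX.some).pos
      exact_mod_cast this.ne'
    obtain ⟨q, hq, q1, q2, q3, q4⟩ := C.exists_single_letter hP (Nat.succ_pos N) d₁ d₂
    refine ⟨q, fun x _ => hq x, q1.trans c3, q2.trans ?_, q3.le.trans c1, q4.le.trans c2⟩
    rw [Real.log_mul hM₁ hM₂, mul_add]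
    linarith
  choose q hqK q1 q2 q3 q4 using hseq
  obtain ⟨q₀, hq₀, φ, hφ, hlim⟩ := hKc.tendsto_subseq hqK
  have he : Filter.Tendsto (fun k => 1 / ((φ k : ℝ) + 1)) Filter.atTop (nhds 0) :=
    tendsto_one_div_add_atTop_nhds_zero_nat.comp hφ.tendsto_atTop
  refine ⟨q₀, fun x => hq₀ x (Set.mem_univ x), ?_, ?_, ?_, ?_⟩
  · have := he.const_add R₁
    rw [add_zero] at this
    exact le_of_tendsto_of_tendsto' ((cF₁.tendsto q₀).comp hlim) this fun k => q1 (φ k)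
  · have := (he.const_mul 2).const_add (R₁ + R₂)
    rw [mul_zero, add_zero] at this
    exact le_of_tendsto_of_tendsto' ((cF₂.tendsto q₀).comp hlim) this fun k => q2 (φ k)
  · have := he.const_add D₁
    rw [add_zero] at this
    exact le_of_tendsto_of_tendsto' ((cE₁.tendsto q₀).comp hlim) this fun k => q3 (φ k)
  · have := he.const_add D₂
    rw [add_zero] at this
    exact le_of_tendsto_of_tendsto' ((cE₂.tendsto q₀).comp hlim) this fun k => q4 (φ k)

/-- By the Markov property P(x,y₁,y₂) P(y₁) = P(x,y₁) P(y₁,y₂), so any y₂ with P(y₁,y₂) > 0 can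
accompany the given y₁. -/
theorem exists_side_letter {P : X × Y₁ × Y₂ → ℝ} (hP : P ∈ stdSimplex ℝ (X × Y₁ × Y₂))
    (hMarkov : IsMarkov P (fun s => s.1) (fun s => s.2.1) (fun s => s.2.2))
    (hSupport : ∃ y₁ : Y₁, ∀ x : X, 0 < law P (fun s => (s.1, s.2.1)) (x, y₁)) :
    ∃ y : Y₁ × Y₂, ∀ x, 0 < P (x, y) := by
  obtain ⟨y₁, hy₁⟩ := hSupport
  have hne : Nonempty (X × Y₁ × Y₂) := by
    by_contra hne
    rw [not_nonempty_iff] at hne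
    have := hP.2
    simp at this
  have hpos : 0 < law P (fun s => s.2.1) y₁ :=
    (hy₁ hne.some.1).trans_le (law_mono_apply hP.1 fun t h => (Prod.ext_iff.1 h).2)
  have h1 := hpos
  rw [← sum_law_snd P (fun s => s.2.1) (fun s => s.2.2)] at h1
  obtain ⟨y₂, -, hy₂⟩ := Finset.exists_lt_of_sum_lt (f := fun _ : Y₂ => (0 : ℝ)) (by simpa using h1)
  refine ⟨(y₁, y₂), fun x => ?_⟩
  have h2 := hMarkov x y₁ y₂
  have h3 : law P (fun s => (s.1, s.2.1, s.2.2)) (x, y₁, y₂) = P (x, y₁, y₂) :=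
    congrFun (law_id P) _
  rw [h3] at h2
  have h4 : 0 < P (x, y₁, y₂) * law P (fun s => s.2.1) y₁ := h2 ▸ mul_pos (hy₁ x) hy₂
  exact pos_of_mul_pos_left h4 hpos.le

/-- When the outer bound is tight, the test channel factors through its second output. -/
theorem exists_factorization {W₁ W₂ : Type*} [Fintype W₁] [Fintype W₂] {P : X × Y₁ × Y₂ → ℝ}
    (hP : P ∈ stdSimplex ℝ (X × Y₁ × Y₂)) {y : Y₁ × Y₂} (hy : ∀ x, 0 < P (x, y))
    {q : X → W₁ × W₂ → ℝ} (hq : ∀ x, q x ∈ stdSimplex ℝ (W₁ × W₂))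
    (h0 : condMutualInfo (channelJoint P (fun s => s.1) q) (fun t => t.1.1) (fun t => t.2.1)
      (fun t => (t.2.2, t.1.2)) = 0) :
    ∃ (u : W₁ → W₂ → ℝ) (k : W₂ → X → ℝ), (∀ a b, 0 ≤ u a b) ∧ (∀ b x, 0 ≤ k b x) ∧
      ∀ x a b, q x (a, b) = u a b * k b x := by
  classical
  set J := channelJoint P (fun s => s.1) q with hJ
  have hJ0 : ∀ s, 0 ≤ J s := (channelJoint_mem_stdSimplex hP (fun s => s.1) hq).1
  have hm := isMarkov_of_condMutualInfo_eq_zero hJ0 h0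
  set k : W₂ → X → ℝ := fun b x => ∑ a, q x (a, b) with hk
  have hk0 : ∀ b x, 0 ≤ k b x := fun b x => Finset.sum_nonneg fun a _ => (hq x).1 _
  set τ : W₂ → ℝ := fun b => law J (fun t => (t.2.2, t.1.2)) (b, y) with hτ
  set σ : W₁ → W₂ → ℝ := fun a b => law J (fun t => (t.2.1, t.2.2, t.1.2)) (a, b, y) with hσ
  have e1 : ∀ x a b, law J (fun t => (t.1.1, t.2.1, t.2.2, t.1.2)) (x, a, b, y) =
      P (x, y) * q x (a, b) := by
    intro x a b
    have hinj : Function.Injective fun t : (X × Y₁ × Y₂) × (W₁ × W₂) =>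
        (t.1.1, t.2.1, t.2.2, t.1.2) := fun s t h => by
      simp only [Prod.ext_iff] at h ⊢; tauto
    exact law_apply_of_injective hinj ((x, y), (a, b))
  have e2 : ∀ x b, law J (fun t => (t.1.1, t.2.2, t.1.2)) (x, b, y) = P (x, y) * k b x := by
    intro x b
    rw [← sum_law_snd J (fun t => (t.1.1, t.2.2, t.1.2)) (fun t => t.2.1), hk, Finset.mul_sum]
    refine Finset.sum_congr rfl fun a _ => ?_
    rw [← e1]
    exact law_congr_apply fun s => by simp only [Prod.ext_iff]; tauto
  have e3 : ∀ b, τ b = ∑ x, P (x, y) * k b x := by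
    intro b
    rw [hτ]
    dsimp only
    rw [← sum_law_fst J (fun t => t.1.1) (fun t => (t.2.2, t.1.2))]
    exact Finset.sum_congr rfl fun x _ => e2 x b
  -- Conditional independence at the fixed side pair `y`; the factor P(x,y) is positive for every
  -- `x` and cancels. Then `u` is σ/τ, the conditional law of the first output given the second and
  -- `y`.
  have hmain : ∀ x a b, q x (a, b) * τ b = k b x * σ a b := by
    intro x a b
    have := hm x a (b, y)
    rw [e1, e2] at this
    have hxy := hy x
    refine mul_left_cancel₀ hxy.ne' ?_
    linarith
  refine ⟨fun a b => σ a b / τ b, k, fun a b => div_nonneg (law_nonneg hJ0 _ _)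
    (law_nonneg hJ0 _ _), hk0, fun x a b => ?_⟩
  -- A second output of probability zero at `y` has probability zero given every `x`, so both sides
  -- vanish.
  by_cases hτb : τ b = 0
  · have h1 : P (x, y) * k b x = 0 := by
      rw [e3] at hτb
      exact (Finset.sum_eq_zero_iff_of_nonneg fun x _ => mul_nonneg (hP.1 _) (hk0 b x)).1 hτb x
        (Finset.mem_univ x)
    have h2 : k b x = 0 := (mul_eq_zero.1 h1).resolve_left (hy x).ne'
    have h3 : q x (a, b) = 0 :=
      (Finset.sum_eq_zero_iff_of_nonneg fun a _ => (hq x).1 (a, b)).1 h2 a (Finset.mem_univ a)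
    rw [h2, h3, mul_zero]
  · have := hmain x a b
    field_simp
    linarith

/-- Perfect scalability yields test channels, with strategies as outputs, that form a Markov
string. -/
theorem PerfectlyScalable.exists_markov_channel {P : X × Y₁ × Y₂ → ℝ}
    (hP : P ∈ stdSimplex ℝ (X × Y₁ × Y₂)) {d₁ : X → Z₁ → ℝ} {d₂ : X → Z₂ → ℝ}
    (hd₁ : ∀ x z, 0 ≤ d₁ x z) (hd₂ : ∀ x z, 0 ≤ d₂ x z)
    (hMarkov : IsMarkov P (fun s => s.1) (fun s => s.2.1) (fun s => s.2.2))
    (hSupport : ∃ y₁ : Y₁, ∀ x : X, 0 < law P (fun s => (s.1, s.2.1)) (x, y₁))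
    {D₁ D₂ : ℝ} (h : PerfectlyScalable P d₁ d₂ D₁ D₂) :
    ∃ (u : (Y₁ → Z₁) → (Y₂ → Z₂) → ℝ) (k : (Y₂ → Z₂) → X → ℝ), (∀ a b, 0 ≤ u a b) ∧
      (∀ b x, 0 ≤ k b x) ∧ (∀ x, ∑ a, ∑ b, u a b * k b x = 1) ∧
      wzRate₁ P d₁ D₁ = condMutualInfo (channelJoint P (fun s => s.1)
          fun x (w : (Y₁ → Z₁) × (Y₂ → Z₂)) => u w.1 w.2 * k w.2 x)
        (fun t => t.1.1) (fun t => t.2.1) (fun t => t.1.2.1) ∧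
      wzRate₂ P d₂ D₂ = condMutualInfo (channelJoint P (fun s => s.1)
          fun x (w : (Y₁ → Z₁) × (Y₂ → Z₂)) => u w.1 w.2 * k w.2 x)
        (fun t => t.1.1) (fun t => t.2.2) (fun t => t.1.2.2) ∧
      expect (channelJoint P (fun s => s.1)
          fun x (w : (Y₁ → Z₁) × (Y₂ → Z₂)) => u w.1 w.2 * k w.2 x)
        (fun t => d₁ t.1.1 (t.2.1 t.1.2.1)) ≤ D₁ ∧
      expect (channelJoint P (fun s => s.1)
          fun x (w : (Y₁ → Z₁) × (Y₂ → Z₂)) => u w.1 w.2 * k w.2 x)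
        (fun t => d₂ t.1.1 (t.2.2 t.1.2.2)) ≤ D₂ := by
  obtain ⟨R₁, R₂, hR₁, hR₂, hach⟩ := h
  obtain ⟨q, hq, b1, b2, b3, b4⟩ := exists_channel_of_siAchievable hP hach
  set J := channelJoint P (fun s => s.1) q with hJ
  have hJs : J ∈ stdSimplex ℝ _ := channelJoint_mem_stdSimplex hP (fun s => s.1) hq
  have hA : ∀ x, 0 < law J (fun t => t.1.1) x := fun x => by
    have := law_channelJoint_source P (fun s => s.1) hq (fun s => s.1)
    rw [hJ, this]
    exact law_fst_pos_of_support hP.1 hSupport x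
  have hm : IsMarkov J (fun t => t.2) (fun t => t.1.1) (fun t => t.1) := isMarkov_channelJoint _ _ _
  -- Each marginal test channel is admissible for its own Wyner-Ziv problem, so its mutual
  -- information is at least the optimal rate.
  have w1 := wzRate_le_of_achievable (wzAchievable_of_joint hJs (fun t => t.2.1) (fun t => t.1.1)
    (fun t => t.1.2.1) hA (hm.mono hJs.1 (fun s t h => congrArg Prod.fst h)
      fun s t h => by rw [h]) hd₁ (fun x => x.1 x.2) b3)
  have w2 := wzRate_le_of_achievable (wzAchievable_of_joint hJs (fun t => t.2.2) (fun t => t.1.1)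
    (fun t => t.1.2.2) hA (hm.mono hJs.1 (fun s t h => congrArg Prod.snd h)
      fun s t h => by rw [h]) hd₂ (fun x => x.1 x.2) b4)
  rw [law_channelJoint_source P (fun s => s.1) hq (fun s => (s.1, s.2.1))] at w1
  rw [law_channelJoint_source P (fun s => s.1) hq (fun s => (s.1, s.2.2))] at w2
  change wzRate₁ P d₁ D₁ ≤ _ at w1
  change wzRate₂ P d₂ D₂ ≤ _ at w2
  rw [hR₁, EReal.coe_le_coe_iff] at w1
  rw [hR₂, EReal.coe_le_coe_iff] at w2
  have s1 : condEntropyOf P (fun u => u.1) (fun u => u.2.1) =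
      condEntropyOf J (fun t => t.1.1) (fun t => t.1.2.1) := by
    have := law_channelJoint_source P (fun s => s.1) hq (fun s => s)
    rw [law_id] at this
    conv_lhs => rw [← this]
    rw [condEntropyOf_law]
  have s2 : condEntropyOf P (fun u => (u.1, u.2.1)) (fun u => u.2.2) =
      condEntropyOf J (fun t => (t.1.1, t.1.2.1)) (fun t => t.1.2.2) := by
    have := law_channelJoint_source P (fun s => s.1) hq (fun s => s)
    rw [law_id] at this
    conv_lhs => rw [← this]
    rw [condEntropyOf_law]
  rw [s1] at b1
  rw [s2] at b2
  have i1 : condMutualInfo J (fun t => t.1.1) (fun t => t.2.1) (fun t => t.1.2.1) = R₁ := by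
    refine le_antisymm ?_ w1
    rw [condMutualInfo_eq_sub]
    exact b1
  have c1 := condMutualInfo_mono hJs.1 (A := fun t => (t.1.1, t.1.2.1)) (B := fun t => t.2.2)
    (A' := fun t => t.1.1) (B' := fun t => t.2.2) (fun t => t.1.2.2)
    (fun s t h => (Prod.mk.inj h).1) fun s t h => h
  have c2 := condMutualInfo_eq_sub J (fun t => (t.1.1, t.1.2.1)) (fun t => t.2.2)
    (fun t => t.1.2.2)
  rw [condEntropyOf_prod (p := J) (fun t => t.1.1) (fun t => t.1.2.1) (fun t => (t.2.2, t.1.2.2))] at c2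
  have c3 := condMutualInfo_eq_sub J (fun t => t.1.1) (fun t => t.2.1) (fun t => (t.2.2, t.1.2))
  have c4 : condEntropyOf J (fun t => t.1.1) (fun t => (t.1.2.1, t.2.2, t.1.2.2)) =
      condEntropyOf J (fun t => t.1.1) (fun t => (t.2.2, t.1.2)) :=
    condEntropyOf_congr J (fun s t => by simp only [Prod.ext_iff]; tauto) fun s t _ => Iff.rfl
  have c5 : condEntropyOf J (fun t => t.1.1) (fun t => (t.2.1, t.2.2, t.1.2)) =
      condEntropyOf J (fun t => t.1.1) (fun t => (t.2, t.1.2)) :=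
    condEntropyOf_congr J (fun s t => by simp only [Prod.ext_iff]; tauto) fun s t _ => Iff.rfl
  have c6 := condMutualInfo_nonneg hJs.1 (fun t => t.1.1) (fun t => t.2.1) (fun t => (t.2.2, t.1.2))
  -- Squeeze: R₂ ≤ I(X;W₂|Y₂) ≤ I(X,Y₁;W₂|Y₂) ≤ R₂ - I(X;W₁|W₂,Y₁,Y₂).
  have i0 : condMutualInfo J (fun t => t.1.1) (fun t => t.2.1) (fun t => (t.2.2, t.1.2)) = 0 := by
    linarith
  have i2 : condMutualInfo J (fun t => t.1.1) (fun t => t.2.2) (fun t => t.1.2.2) = R₂ := by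
    linarith
  obtain ⟨y, hy⟩ := exists_side_letter hP hMarkov hSupport
  obtain ⟨u, k, hu, hk, huk⟩ := exists_factorization hP hy hq i0
  have hqe : q = fun x w => u w.1 w.2 * k w.2 x := by
    funext x w
    exact huk x w.1 w.2
  refine ⟨u, k, hu, hk, fun x => ?_, ?_, ?_, ?_, ?_⟩
  · have := (hq x).2
    rw [Fintype.sum_prod_type] at this
    simpa only [huk] using this
  · rw [← hqe, hR₁, ← hJ, i1]
  · rw [← hqe, hR₂, ← hJ, i2]
  · rw [← hqe]; exact b3
  · rw [← hqe]; exact b4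

end Converse

/-! ### Carathéodory's theorem for cones. -/

section ConicCaratheodory

variable {ι κ : Type*} [Fintype ι] [Fintype κ]

/-- Carathéodory's theorem for cones: a nonnegative combination of vectors of `ℝ^κ` is one of at
most `card κ` of them. -/
theorem exists_conic_reduction (V : ι → κ → ℝ) :
    ∃ (n : ℕ) (e : Fin n → ι) (r : Fin n → ℝ), n ≤ Fintype.card κ ∧ (∀ i, 0 ≤ r i) ∧
      ∀ j, ∑ i, r i * V (e i) j = ∑ i, V i j := by
  classical
  have hex : ∃ n : ℕ, ∃ (e : Fin n → ι) (r : Fin n → ℝ), (∀ i, 0 ≤ r i) ∧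
      ∀ j, ∑ i, r i * V (e i) j = ∑ i, V i j := by
    refine ⟨Fintype.card ι, (Fintype.equivFin ι).symm, fun _ => 1, fun _ => zero_le_one,
      fun j => ?_⟩
    simp only [one_mul]
    exact Equiv.sum_comp (Fintype.equivFin ι).symm fun i => V i j
  obtain ⟨e, r, hr, hV⟩ := Nat.find_spec hex
  refine ⟨Nat.find hex, e, r, ?_, hr, hV⟩
  by_contra hlt
  push Not at hlt
  -- The number of vectors is minimal; more than card κ of them would be dependent, and moving along
  -- the dependence removes one.
  have hmin := @Nat.find_min _ _ hex
  generalize Nat.find hex = n at *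
  have hdep : ¬ LinearIndependent ℝ fun i => V (e i) := fun hli => by
    have := hli.fintype_card_le_finrank
    simp only [Fintype.card_fin, Module.finrank_fintype_fun_eq_card] at this
    omega
  obtain ⟨g, hg, i₁, hi₁⟩ := Fintype.not_linearIndependent_iff.1 hdep
  obtain ⟨g, hg, i₁, hi₁⟩ : ∃ g : Fin n → ℝ, (∑ i, g i • V (e i) = 0) ∧ ∃ i, 0 < g i := by
    rcases lt_or_gt_of_ne hi₁ with h | h
    · exact ⟨-g, by simpa [Finset.sum_neg_distrib] using hg, i₁, by simpa using h⟩
    · exact ⟨g, hg, i₁, h⟩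
  -- The smallest ratio r/g over positive g is the largest step that keeps all coefficients
  -- nonnegative, and it makes coefficient `i₀` zero.
  obtain ⟨i₀, hi₀, hle⟩ := Finset.exists_min_image (Finset.univ.filter fun i => 0 < g i)
    (fun i => r i / g i) ⟨i₁, by simpa using hi₁⟩
  simp only [Finset.mem_filter, Finset.mem_univ, true_and] at hi₀ hle
  set c := r i₀ / g i₀ with hc
  have hc0 : 0 ≤ c := div_nonneg (hr i₀) hi₀.le
  obtain ⟨m, rfl⟩ : ∃ m, n = m + 1 := ⟨n - 1, by have := i₀.pos; omega⟩
  refine hmin (Nat.lt_succ_self m) ⟨fun i => e (i₀.succAbove i),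
    fun i => r (i₀.succAbove i) - c * g (i₀.succAbove i), fun i => ?_, fun j => ?_⟩
  · rcases lt_or_ge 0 (g (i₀.succAbove i)) with h | h
    · have := hle _ h
      rw [le_div_iff₀ h] at this
      linarith
    · have := hr (i₀.succAbove i)
      nlinarith
  · have h0 : r i₀ - c * g i₀ = 0 := by
      rw [hc, div_mul_cancel₀ _ hi₀.ne', sub_self]
    have h1 : ∑ i, (r i - c * g i) * V (e i) j = ∑ i, V i j := by
      have := congrFun hg j
      simp only [Finset.sum_apply, Pi.smul_apply, smul_eq_mul, Pi.zero_apply] at this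
      simp only [sub_mul, mul_assoc, Finset.sum_sub_distrib, ← Finset.mul_sum, this, hV]
      ring
    rw [← h1, Fin.sum_univ_succAbove _ i₀, h0]
    ring

end ConicCaratheodory

/-! ### Rate and distortion as sums over output letters. -/

section ChannelFunctionals

variable {X Y Z : Type*} [Fintype X] [Fintype Y]

/-- The contribution of a single output letter to the conditional entropy of the source given the
output and the side information; `κ x` is the probability of the letter given `x`. -/
def letterEntropy (p : X × Y → ℝ) (κ : X → ℝ) : ℝ :=
  ∑ y, (∑ x, Real.negMulLog (κ x * p (x, y)) - Real.negMulLog (∑ x, κ x * p (x, y)))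

/-- The contribution of a single output letter, decoded by `g`, to the expected distortion. -/
def letterDistortion (p : X × Y → ℝ) (d : X → Z → ℝ) (g : Y → Z) (κ : X → ℝ) : ℝ :=
  ∑ x, ∑ y, κ x * p (x, y) * d x (g y)

/-- The terms with log r cancel between the joint and the marginal part. This homogeneity makes
rates linear in the weights of a conic combination. -/
theorem letterEntropy_smul (p : X × Y → ℝ) (r : ℝ) (κ : X → ℝ) :
    letterEntropy p (fun x => r * κ x) = r * letterEntropy p κ := by
  unfold letterEntropy
  rw [Finset.mul_sum]
  refine Finset.sum_congr rfl fun y _ => ?_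
  have : ∀ t : X → ℝ, ∑ x, Real.negMulLog (r * t x) - Real.negMulLog (∑ x, r * t x) =
      r * (∑ x, Real.negMulLog (t x) - Real.negMulLog (∑ x, t x)) := fun t => by
    rw [← Finset.mul_sum]
    simp only [Real.negMulLog_mul, Finset.sum_add_distrib, ← Finset.mul_sum, ← Finset.sum_mul]
    ring
  simpa only [mul_assoc] using this fun x => κ x * p (x, y)

theorem letterDistortion_smul (p : X × Y → ℝ) (d : X → Z → ℝ) (g : Y → Z) (r : ℝ) (κ : X → ℝ) :
    letterDistortion p d g (fun x => r * κ x) = r * letterDistortion p d g κ := by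
  simp only [letterDistortion, Finset.mul_sum, mul_assoc]

variable {Ω W : Type*} [Fintype Ω] [Fintype W]

/-- The rate depends on the joint law only through the marginal channel `m`, and additively in its
output letters. -/
theorem condMutualInfo_eq_sub_sum_letterEntropy {Q : Ω → ℝ} {A : Ω → X} {V : Ω → W} {B : Ω → Y}
    {p : X × Y → ℝ} {m : W → X → ℝ} (hm : ∀ x, ∑ w, m w x = 1)
    (h : ∀ x w y, law Q (fun s => (A s, V s, B s)) (x, w, y) = m w x * p (x, y)) :
    condMutualInfo Q A V B = condEntropyOf p (fun s => s.1) (fun s => s.2) -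
      ∑ w, letterEntropy p (m w) := by
  have h1 : law Q (fun s => (A s, B s)) = p := by
    funext ⟨x, y⟩
    rw [← sum_law_snd Q (fun s => (A s, B s)) V]
    have : ∀ w, law Q (fun s => ((A s, B s), V s)) ((x, y), w) = m w x * p (x, y) := fun w => by
      rw [← h]
      exact law_congr_apply fun s => by simp only [Prod.ext_iff]; tauto
    simp only [this, ← Finset.sum_mul, hm, one_mul]
  have h2 : ∀ w y, law Q (fun s => (V s, B s)) (w, y) = ∑ x, m w x * p (x, y) := fun w y => by
    rw [← sum_law_fst Q A fun s => (V s, B s)]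
    exact Finset.sum_congr rfl fun x _ => h x w y
  rw [condMutualInfo_eq_sub, ← h1, condEntropyOf_law, h1]
  congr 1
  unfold condEntropyOf entropyOf letterEntropy
  simp only [Fintype.sum_prod_type, h, h2]
  rw [Finset.sum_comm, ← Finset.sum_sub_distrib]
  refine Finset.sum_congr rfl fun w _ => ?_
  rw [Finset.sum_comm, ← Finset.sum_sub_distrib]

theorem expect_eq_sum_letterDistortion {Q : Ω → ℝ} {A : Ω → X} {V : Ω → W} {B : Ω → Y}
    {p : X × Y → ℝ} {m : W → X → ℝ} (d : X → Z → ℝ) (f : W × Y → Z)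
    (h : ∀ x w y, law Q (fun s => (A s, V s, B s)) (x, w, y) = m w x * p (x, y)) :
    expect Q (fun s => d (A s) (f (V s, B s))) =
      ∑ w, letterDistortion p d (fun y => f (w, y)) (m w) := by
  have := expect_law Q (fun s => (A s, V s, B s)) fun t => d t.1 (f t.2)
  rw [← this]
  unfold expect letterDistortion
  simp only [Fintype.sum_prod_type, h]
  rw [Finset.sum_comm]

/-- Provides the product form required by the rate and distortion formulas above, with the other
output summed out. -/
theorem law_marginal_channel {A S C : Type*} [Fintype A] [Fintype S] [Fintype C] {Q : Ω → ℝ}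
    {V : Ω → A} {V' : Ω → C} {G : Ω → S} {P : S → ℝ} {v : S → X} {q : A → C → X → ℝ}
    (h : ∀ a c s, law Q (fun t => (V t, V' t, G t)) (a, c, s) = q a c (v s) * P s) (g : S → Y)
    (x : X) (a : A) (y : Y) :
    law Q (fun t => (v (G t), V t, g (G t))) (x, a, y) =
      (∑ c, q a c x) * law P (fun s => (v s, g s)) (x, y) := by
  classical
  have h1 := congrFun (law_law Q (fun t => (V t, V' t, G t)) fun r => (v r.2.2, r.1, g r.2.2))
    (x, a, y)
  rw [← h1]
  unfold law at h ⊢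
  simp only [Fintype.sum_prod_type, h]
  rw [Finset.sum_eq_single a]
  · rw [Finset.sum_mul]
    refine Finset.sum_congr rfl fun c _ => ?_
    rw [Finset.mul_sum]
    refine Finset.sum_congr rfl fun s _ => ?_
    by_cases hs : v s = x
    · subst hs
      by_cases hy : g s = y <;> simp [hy]
    · simp [hs]
  · intro b _ hb
    simp [hb]
  · simp

end ChannelFunctionals

/-! ### Reduction of the two auxiliary alphabets. -/

section CardinalityReduction

variable {X Y Z Y₁ Y₂ Z₁ Z₂ W W₁ W₂ : Type*} [Fintype X] [Fintype Y] [Fintype Z] [Fintype Y₁]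
  [Fintype Y₂] [Fintype Z₁] [Fintype Z₂] [Fintype W] [Fintype W₁] [Fintype W₂]

/-- Optimality as an inequality for every admissible channel. Two such inequalities turn equality of
a sum of rates into equality of each rate. -/
theorem wzRate_le_sub_sum_letterEntropy {p : X × Y → ℝ} (hp : p ∈ stdSimplex ℝ (X × Y))
    (hpos : ∀ x, 0 < law p (fun s => s.1) x) {d : X → Z → ℝ} (hd : ∀ x z, 0 ≤ d x z)
    {m : W → X → ℝ} (hm0 : ∀ w x, 0 ≤ m w x) (hm : ∀ x, ∑ w, m w x = 1) (f : W × Y → Z) {D : ℝ}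
    (hD : ∑ w, letterDistortion p d (fun y => f (w, y)) (m w) ≤ D) :
    wzRate p d D ≤ ((condEntropyOf p (fun s => s.1) (fun s => s.2) -
      ∑ w, letterEntropy p (m w) : ℝ) : EReal) := by
  have hq : ∀ x, (fun w => m w x) ∈ stdSimplex ℝ W := fun x => ⟨fun w => hm0 w x, hm x⟩
  have hQ := channelJoint_mem_stdSimplex hp (fun s => s.1) hq
  set Q := channelJoint p (fun s => s.1) fun x w => m w x with hQdef
  have hl : ∀ x w y, law Q (fun t => (t.1.1, t.2, t.1.2)) (x, w, y) = m w x * p (x, y) := by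
    intro x w y
    have hinj : Function.Injective fun t : (X × Y) × W => (t.1.1, t.2, t.1.2) := fun s t h => by
      simp only [Prod.ext_iff] at h ⊢; tauto
    exact (law_apply_of_injective hinj ((x, y), w)).trans (mul_comm _ _)
  have hfst : law Q (fun t => t.1.1) = law p fun s => s.1 :=
    law_channelJoint_source p (fun s => s.1) hq fun s => s.1
  have hsrc : law Q (fun t => (t.1.1, t.1.2)) = p :=
    (law_channelJoint_source p (fun s => s.1) hq fun s => (s.1, s.2)).trans (law_id p)
  have hE := expect_eq_sum_letterDistortion d f hl
  have hach := wzAchievable_of_joint hQ (fun t => t.2) (fun t => t.1.1) (fun t => t.1.2)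
    (fun x => by rw [hfst]; exact hpos x)
    ((isMarkov_channelJoint p (fun s => s.1) fun x w => m w x).mono hQ.1 (fun _ _ h => h)
      fun s t h => by rw [h]) hd f (hE.trans_le hD)
  rw [hsrc, condMutualInfo_eq_sub_sum_letterEntropy hm hl] at hach
  exact wzRate_le_of_achievable hach

/-- Optimal test channels `u a b * k b x` for the two stages, with outputs `(a, b)` and source
letter `x`, described by their marginal channels. -/
structure IsScalableChannel (P : X × Y₁ × Y₂ → ℝ) (d₁ : X → Z₁ → ℝ) (d₂ : X → Z₂ → ℝ) (D₁ D₂ : ℝ)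
    (u : W₁ → W₂ → ℝ) (k : W₂ → X → ℝ) (f₁ : W₁ × Y₁ → Z₁) (f₂ : W₂ × Y₂ → Z₂) : Prop where
  u_nonneg : ∀ a b, 0 ≤ u a b
  k_nonneg : ∀ b x, 0 ≤ k b x
  sum_eq_one : ∀ x, ∑ a, ∑ b, u a b * k b x = 1
  rate₁ : wzRate₁ P d₁ D₁ = ((condEntropyOf (law P fun s => (s.1, s.2.1)) (fun s => s.1)
    (fun s => s.2) - ∑ a, letterEntropy (law P fun s => (s.1, s.2.1))
      (fun x => ∑ b, u a b * k b x) : ℝ) : EReal)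
  rate₂ : wzRate₂ P d₂ D₂ = ((condEntropyOf (law P fun s => (s.1, s.2.2)) (fun s => s.1)
    (fun s => s.2) - ∑ b, letterEntropy (law P fun s => (s.1, s.2.2))
      (fun x => ∑ a, u a b * k b x) : ℝ) : EReal)
  dist₁ : ∑ a, letterDistortion (law P fun s => (s.1, s.2.1)) d₁ (fun y => f₁ (a, y))
    (fun x => ∑ b, u a b * k b x) ≤ D₁
  dist₂ : ∑ b, letterDistortion (law P fun s => (s.1, s.2.2)) d₂ (fun y => f₂ (b, y))
    (fun x => ∑ a, u a b * k b x) ≤ D₂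

variable {P : X × Y₁ × Y₂ → ℝ} {d₁ : X → Z₁ → ℝ} {d₂ : X → Z₂ → ℝ} {D₁ D₂ : ℝ}
  {u : W₁ → W₂ → ℝ} {k : W₂ → X → ℝ} {f₁ : W₁ × Y₁ → Z₁} {f₂ : W₂ × Y₂ → Z₂}

/-- The first output of optimal test channels can be restricted to `card X + 3` letters. -/
theorem IsScalableChannel.exists_first_reduction (hP : P ∈ stdSimplex ℝ (X × Y₁ × Y₂))
    (hpos : ∀ x, 0 < law P (fun s => s.1) x) (hd₁ : ∀ x z, 0 ≤ d₁ x z) (hd₂ : ∀ x z, 0 ≤ d₂ x z)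
    (h : IsScalableChannel P d₁ d₂ D₁ D₂ u k f₁ f₂) :
    ∃ (n : ℕ) (v : Fin n → W₂ → ℝ) (g : Fin n × Y₁ → Z₁), n ≤ Fintype.card X + 3 ∧
      IsScalableChannel P d₁ d₂ D₁ D₂ v k g f₂ := by
  set p₁ := law P fun s => (s.1, s.2.1) with hp₁
  set p₂ := law P fun s => (s.1, s.2.2) with hp₂
  -- Three coordinates besides the normalizations at each `x`: both distortions, and the sum of the
  -- two letter entropies in place of each separately.
  obtain ⟨n, e, r, hn, hr, hV⟩ := exists_conic_reduction
    fun (a : W₁) (j : Option (Option (Option X))) =>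
    j.elim (letterEntropy p₁ (fun x => ∑ b, u a b * k b x) + ∑ b, u a b * letterEntropy p₂ (k b))
      fun j => j.elim (letterDistortion p₁ d₁ (fun y => f₁ (a, y)) (fun x => ∑ b, u a b * k b x))
        fun j => j.elim (∑ b, u a b * letterDistortion p₂ d₂ (fun y => f₂ (b, y)) (k b))
          fun x => ∑ b, u a b * k b x
  have hVH := hV none
  have hVD₁ := hV (some none)
  have hVD₂ := hV (some (some none))
  have hVx := fun x => hV (some (some (some x)))
  simp only [Option.elim_none, Option.elim_some] at hVH hVD₁ hVD₂ hVx
  -- Only rows of `u` are selected and rescaled; `k` is untouched, so the product form persists.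
  set v : Fin n → W₂ → ℝ := fun i b => r i * u (e i) b with hv
  have hm₁ : ∀ i x, ∑ b, v i b * k b x = r i * ∑ b, u (e i) b * k b x := fun i x => by
    rw [Finset.mul_sum]
    exact Finset.sum_congr rfl fun b _ => mul_assoc _ _ _
  have hv0 : ∀ i b, 0 ≤ v i b := fun i b => mul_nonneg (hr i) (h.u_nonneg _ _)
  have hsum : ∀ x, ∑ i, ∑ b, v i b * k b x = 1 := fun x => by
    simp only [hm₁]
    rw [hVx, h.sum_eq_one]
  -- In the marginal channel of the second output, letter `b` is a multiple of `k b`. By homogeneity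
  -- its functionals are linear in `u`.
  have hcol : ∀ {ι : Type} [Fintype ι] (t : ι → W₂ → ℝ) (b : W₂),
      (fun x => ∑ i, t i b * k b x) = fun x => (∑ i, t i b) * k b x := fun t b => by
    funext x
    rw [Finset.sum_mul]
  have hcol' : ∀ b : W₂, (fun x => ∑ a, u a b * k b x) = fun x => (∑ a, u a b) * k b x :=
    fun b => by
      funext x
      rw [Finset.sum_mul]
  have hswap : ∀ φ : W₂ → ℝ, ∑ b, (∑ i, v i b) * φ b = ∑ i, r i * ∑ b, u (e i) b * φ b :=
    fun φ => by
      simp only [Finset.sum_mul, Finset.mul_sum, hv, mul_assoc]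
      exact Finset.sum_comm
  have hswap' : ∀ φ : W₂ → ℝ, ∑ b, (∑ a, u a b) * φ b = ∑ a, ∑ b, u a b * φ b := fun φ => by
    simp only [Finset.sum_mul]
    exact Finset.sum_comm
  have hD₁ : ∑ i, letterDistortion p₁ d₁ (fun y => f₁ (e i, y)) (fun x => ∑ b, v i b * k b x) ≤
      D₁ := by
    simp only [hm₁, letterDistortion_smul]
    rw [hVD₁]
    exact h.dist₁
  have hD₂ : ∑ b, letterDistortion p₂ d₂ (fun y => f₂ (b, y)) (fun x => ∑ i, v i b * k b x) ≤
      D₂ := by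
    have := h.dist₂
    simp only [hcol', letterDistortion_smul] at this
    simp only [hcol, letterDistortion_smul]
    rw [hswap, hVD₂, ← hswap']
    exact this
  have hH : ∑ i, letterEntropy p₁ (fun x => ∑ b, v i b * k b x) +
      ∑ b, letterEntropy p₂ (fun x => ∑ i, v i b * k b x) =
      ∑ a, letterEntropy p₁ (fun x => ∑ b, u a b * k b x) +
      ∑ b, letterEntropy p₂ (fun x => ∑ a, u a b * k b x) := by
    simp only [hcol', hcol, hm₁, letterEntropy_smul]
    rw [hswap, hswap', ← Finset.sum_add_distrib, ← Finset.sum_add_distrib, ← hVH]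
    exact Finset.sum_congr rfl fun i _ => (mul_add _ _ _).symm
  -- The new channels satisfy the distortion constraints, so neither rate falls below its optimum;
  -- their sum is unchanged, hence both remain optimal.
  have r1 := wzRate_le_sub_sum_letterEntropy (law_mem_stdSimplex hP fun s => (s.1, s.2.1))
    (fun x => by rw [law_law]; exact hpos x) hd₁
    (fun i x => Finset.sum_nonneg fun b _ => mul_nonneg (hv0 i b) (h.k_nonneg b x)) hsum
    (fun t => f₁ (e t.1, t.2)) hD₁
  have r2 := wzRate_le_sub_sum_letterEntropy (law_mem_stdSimplex hP fun s => (s.1, s.2.2))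
    (fun x => by rw [law_law]; exact hpos x) hd₂
    (fun b x => Finset.sum_nonneg fun i _ => mul_nonneg (hv0 i b) (h.k_nonneg b x))
    (fun x => by rw [Finset.sum_comm]; exact hsum x) f₂ hD₂
  have h1 := h.rate₁
  have h2 := h.rate₂
  rw [wzRate₁] at h1
  rw [wzRate₂] at h2
  rw [h1, EReal.coe_le_coe_iff] at r1
  rw [h2, EReal.coe_le_coe_iff] at r2
  refine ⟨n, v, fun t => f₁ (e t.1, t.2), by simpa [add_assoc] using hn, hv0, h.k_nonneg, hsum,
    ?_, ?_, hD₁, hD₂⟩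
  · rw [wzRate₁, h1, EReal.coe_eq_coe_iff]
    linarith
  · rw [wzRate₂, h2, EReal.coe_eq_coe_iff]
    linarith

/-- The second output of optimal test channels can be restricted to `card X * card W₁ + 2`
letters. -/
theorem IsScalableChannel.exists_second_reduction
    (h : IsScalableChannel P d₁ d₂ D₁ D₂ u k f₁ f₂) :
    ∃ (n : ℕ) (v : W₁ → Fin n → ℝ) (l : Fin n → X → ℝ) (g : Fin n × Y₂ → Z₂),
      n ≤ Fintype.card X * Fintype.card W₁ + 2 ∧ IsScalableChannel P d₁ d₂ D₁ D₂ v l f₁ g := by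
  set p₂ := law P fun s => (s.1, s.2.2) with hp₂
  -- Preserving all joint masses of (a, x) fixes the stage-one marginal channel exactly, so only the
  -- entropy and the distortion of stage two need further coordinates.
  obtain ⟨n, e, r, hn, hr, hV⟩ := exists_conic_reduction
    fun (b : W₂) (j : Option (Option (X × W₁))) =>
    j.elim (letterEntropy p₂ (fun x => ∑ a, u a b * k b x))
      fun j => j.elim (letterDistortion p₂ d₂ (fun y => f₂ (b, y)) (fun x => ∑ a, u a b * k b x))
        fun t => u t.2 b * k b t.1
  have hVH := hV none
  have hVD := hV (some none)
  have hVx := fun a x => hV (some (some (x, a)))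
  simp only [Option.elim_none, Option.elim_some] at hVH hVD hVx
  have hm₁ : ∀ a x, ∑ j, r j * u a (e j) * k (e j) x = ∑ b, u a b * k b x := fun a x => by
    simp only [mul_assoc]
    exact hVx a x
  have hm₂ : ∀ j x, ∑ a, r j * u a (e j) * k (e j) x = r j * ∑ a, u a (e j) * k (e j) x :=
    fun j x => by simp only [mul_assoc, Finset.mul_sum]
  refine ⟨n, fun a j => r j * u a (e j), fun j => k (e j), fun t => f₂ (e t.1, t.2),
    by simpa [add_assoc] using hn, fun a j => mul_nonneg (hr j) (h.u_nonneg _ _),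
    fun j => h.k_nonneg _, fun x => ?_, ?_, ?_, ?_, ?_⟩
  · simp only [hm₁, h.sum_eq_one]
  · simp only [hm₁, h.rate₁]
  · simp only [hm₂, letterEntropy_smul]
    rw [h.rate₂, hVH]
  · simp only [hm₁, h.dist₁]
  · simp only [hm₂, letterDistortion_smul]
    rw [hVD]
    exact h.dist₂

/-- The joint mass u(a,b) k(b,x) P(x,y₁,y₂) splits at b and at x by inspection; splitting at y₁ uses
the Markov property of the source. -/
theorem IsScalableChannel.hasMarkovTestChannels {n₁ n₂ : ℕ} {u : Fin n₁ → Fin n₂ → ℝ}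
    {k : Fin n₂ → X → ℝ} {f₁ : Fin n₁ × Y₁ → Z₁} {f₂ : Fin n₂ × Y₂ → Z₂}
    (hP : P ∈ stdSimplex ℝ (X × Y₁ × Y₂))
    (hMarkov : IsMarkov P (fun s => s.1) (fun s => s.2.1) (fun s => s.2.2))
    (h : IsScalableChannel P d₁ d₂ D₁ D₂ u k f₁ f₂) :
    HasMarkovTestChannels P d₁ d₂ D₁ D₂ n₁ n₂ := by
  set Q : Fin n₁ × Fin n₂ × X × Y₁ × Y₂ → ℝ := fun t => u t.1 t.2.1 * k t.2.1 t.2.2.1 * P t.2.2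
    with hQ
  have hlaw : law Q (fun t => (t.1, t.2.1, t.2.2)) = Q := law_id Q
  have hl : ∀ a b s, law Q (fun t => (t.1, t.2.1, t.2.2)) (a, b, s) = u a b * k b s.1 * P s :=
    fun a b s => congrFun hlaw (a, b, s)
  have hl' : ∀ b a s, law Q (fun t => (t.2.1, t.1, t.2.2)) (b, a, s) = u a b * k b s.1 * P s :=
    fun b a s => by
      rw [← hl]
      exact law_congr_apply fun t => by simp only [Prod.ext_iff]; tauto
  have hsrc : law Q (fun t => t.2.2) = P := by
    funext s
    rw [← sum_law_fst Q (fun t => t.2.1) (fun t => t.2.2)]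
    have : ∀ b, law Q (fun t => (t.2.1, t.2.2)) (b, s) = ∑ a, u a b * k b s.1 * P s := fun b => by
      rw [← sum_law_fst Q (fun t => t.1) (fun t => (t.2.1, t.2.2))]
      exact Finset.sum_congr rfl fun a _ => hl a b s
    simp only [this]
    rw [Finset.sum_comm]
    simp only [← Finset.sum_mul, h.sum_eq_one, one_mul]
  have hQs : Q ∈ stdSimplex ℝ (Fin n₁ × Fin n₂ × X × Y₁ × Y₂) :=
    ⟨fun t => mul_nonneg (mul_nonneg (h.u_nonneg _ _) (h.k_nonneg _ _)) (hP.1 _), by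
      rw [← sum_law Q (fun t => t.2.2), hsrc, hP.2]⟩
  have m1 := law_marginal_channel (v := fun s : X × Y₁ × Y₂ => s.1)
    (q := fun a b x => u a b * k b x) hl (fun s => s.2.1)
  have m2 := law_marginal_channel (v := fun s : X × Y₁ × Y₂ => s.1)
    (q := fun b a x => u a b * k b x) hl' (fun s => s.2.2)
  refine ⟨Q, hQs, f₁, f₂, hsrc, ⟨?_, ?_, ?_⟩, ?_, ?_, ?_, ?_⟩
  · exact isMarkov_of_law_eq_mul u (fun b s => k b s.1 * P s) fun a b s => by
      rw [← mul_assoc]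
      exact hl a b s
  · refine isMarkov_of_law_eq_mul (fun t x => u t.1 t.2 * k t.2 x) (fun x y => P (x, y)) ?_
    rintro ⟨a, b⟩ x y
    rw [← hl a b (x, y)]
    exact law_congr_apply fun t => by simp only [Prod.ext_iff]; tauto
  · refine isMarkov_of_law_eq_mul
      (fun t y => u t.1 t.2.1 * k t.2.1 t.2.2 * law P (fun s => (s.1, s.2.1)) (t.2.2, y))
      (fun y z => law P (fun s => (s.2.1, s.2.2)) (y, z) / law P (fun s => s.2.1) y) ?_
    rintro ⟨a, b, x⟩ y z
    have h1 : law Q (fun t => ((t.1, t.2.1, t.2.2.1), t.2.2.2.1, t.2.2.2.2)) ((a, b, x), y, z) =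
        u a b * k b x * P (x, y, z) := by
      rw [← hl a b (x, y, z)]
      exact law_congr_apply fun t => by simp only [Prod.ext_iff]; tauto
    refine h1.trans ?_
    have h2 := hMarkov x y z
    rw [show law P (fun s => (s.1, s.2.1, s.2.2)) (x, y, z) = P (x, y, z) from
      congrFun (law_id P) _] at h2
    -- The second factor divides by P(y₁); when that is zero, the mass P(x,y₁,y₂) is zero as well.
    by_cases hy : law P (fun s => s.2.1) y = 0
    · have h3 : P (x, y, z) = 0 :=
        le_antisymm ((le_law_apply hP.1 (fun s => s.2.1) (x, y, z)).trans hy.le) (hP.1 _)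
      rw [h3, hy]
      simp
    · dsimp only at h2 ⊢
      rw [mul_assoc (u a b * k b x), ← mul_div_assoc, ← h2, mul_div_cancel_right₀ _ hy]
  · rw [h.rate₁, EReal.coe_eq_coe_iff]
    exact (condMutualInfo_eq_sub_sum_letterEntropy h.sum_eq_one m1).symm
  · rw [h.rate₂, EReal.coe_eq_coe_iff]
    exact (condMutualInfo_eq_sub_sum_letterEntropy
      (fun x => by rw [Finset.sum_comm]; exact h.sum_eq_one x) m2).symm
  · exact (expect_eq_sum_letterDistortion d₁ f₁ m1).trans_le h.dist₁
  · exact (expect_eq_sum_letterDistortion d₂ f₂ m2).trans_le h.dist₂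

/-- Perfect scalability provides optimal test channels with strategies as outputs. -/
theorem PerfectlyScalable.exists_isScalableChannel [DecidableEq Y₁] [DecidableEq Y₂]
    (hP : P ∈ stdSimplex ℝ (X × Y₁ × Y₂)) (hd₁ : ∀ x z, 0 ≤ d₁ x z) (hd₂ : ∀ x z, 0 ≤ d₂ x z)
    (hMarkov : IsMarkov P (fun s => s.1) (fun s => s.2.1) (fun s => s.2.2))
    (hSupport : ∃ y₁ : Y₁, ∀ x : X, 0 < law P (fun s => (s.1, s.2.1)) (x, y₁))
    (h : PerfectlyScalable P d₁ d₂ D₁ D₂) :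
    ∃ (u : (Y₁ → Z₁) → (Y₂ → Z₂) → ℝ) (k : (Y₂ → Z₂) → X → ℝ),
      IsScalableChannel P d₁ d₂ D₁ D₂ u k (fun t => t.1 t.2) (fun t => t.1 t.2) := by
  obtain ⟨u, k, hu, hk, hs, h1, h2, e1, e2⟩ := h.exists_markov_channel hP hd₁ hd₂ hMarkov hSupport
  set J := channelJoint P (fun s => s.1) fun x (w : (Y₁ → Z₁) × (Y₂ → Z₂)) => u w.1 w.2 * k w.2 x
    with hJ
  have hl : ∀ a b s, law J (fun t => (t.2.1, t.2.2, t.1)) (a, b, s) = u a b * k b s.1 * P s := by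
    intro a b s
    have hinj : Function.Injective fun t : (X × Y₁ × Y₂) × (Y₁ → Z₁) × (Y₂ → Z₂) =>
        (t.2.1, t.2.2, t.1) := fun s t h => by
      simp only [Prod.ext_iff] at h ⊢; tauto
    exact (law_apply_of_injective hinj (s, a, b)).trans (mul_comm _ _)
  have hl' : ∀ b a s, law J (fun t => (t.2.2, t.2.1, t.1)) (b, a, s) = u a b * k b s.1 * P s :=
    fun b a s => by
      rw [← hl]
      exact law_congr_apply fun t => by simp only [Prod.ext_iff]; tauto
  have m1 := law_marginal_channel (v := fun s : X × Y₁ × Y₂ => s.1)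
    (q := fun a b x => u a b * k b x) hl (fun s => s.2.1)
  have m2 := law_marginal_channel (v := fun s : X × Y₁ × Y₂ => s.1)
    (q := fun b a x => u a b * k b x) hl' (fun s => s.2.2)
  refine ⟨u, k, hu, hk, hs, ?_, ?_, ?_, ?_⟩
  · rw [h1, condMutualInfo_eq_sub_sum_letterEntropy hs m1]
  · rw [h2, condMutualInfo_eq_sub_sum_letterEntropy
      (fun x => by rw [Finset.sum_comm]; exact hs x) m2]
  · exact (expect_eq_sum_letterDistortion d₁ (fun t : (Y₁ → Z₁) × Y₁ => t.1 t.2) m1).symm.trans_le e1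
  · exact (expect_eq_sum_letterDistortion d₂ (fun t : (Y₂ → Z₂) × Y₂ => t.1 t.2) m2).symm.trans_le e2

end CardinalityReduction

end

theorem theorem5 {X Y₁ Y₂ Z₁ Z₂ : Type*}
    [Fintype X] [Fintype Y₁] [Fintype Y₂] [Fintype Z₁] [Fintype Z₂]
    (P : X × Y₁ × Y₂ → ℝ) (hP : P ∈ stdSimplex ℝ (X × Y₁ × Y₂))
    (d₁ : X → Z₁ → ℝ) (d₂ : X → Z₂ → ℝ)
    (hd₁ : ∀ x z, 0 ≤ d₁ x z) (hd₂ : ∀ x z, 0 ≤ d₂ x z)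
    (hMarkov : IsMarkov P (fun s => s.1) (fun s => s.2.1) (fun s => s.2.2))
    (hSupport : ∃ y₁ : Y₁, ∀ x : X, 0 < law P (fun s => (s.1, s.2.1)) (x, y₁))
    (D₁ D₂ : ℝ) :
    (PerfectlyScalable P d₁ d₂ D₁ D₂ ↔
      ∃ k₁ k₂ : ℕ,
        k₁ ≤ Fintype.card X + 3 ∧
        k₂ ≤ Fintype.card X * (Fintype.card X + 3) + 2 ∧
        HasMarkovTestChannels P d₁ d₂ D₁ D₂ k₁ k₂) ∧
    (∀ k₁ k₂ : ℕ, HasMarkovTestChannels P d₁ d₂ D₁ D₂ k₁ k₂ →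
      PerfectlyScalable P d₁ d₂ D₁ D₂) := by
  classical
  refine ⟨⟨fun h => ?_, fun ⟨_, _, _, _, h⟩ =>
    perfectlyScalable_of_hasMarkovTestChannels hP hd₁ hd₂ hSupport h⟩,
    fun _ _ h => perfectlyScalable_of_hasMarkovTestChannels hP hd₁ hd₂ hSupport h⟩
  obtain ⟨u, k, huk⟩ := h.exists_isScalableChannel hP hd₁ hd₂ hMarkov hSupport
  obtain ⟨n₁, v, g₁, hn₁, hv⟩ :=
    huk.exists_first_reduction hP (law_fst_pos_of_support hP.1 hSupport) hd₁ hd₂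
  obtain ⟨n₂, w, l, g₂, hn₂, hw⟩ := hv.exists_second_reduction
  rw [Fintype.card_fin] at hn₂
  exact ⟨n₁, n₂, hn₁, hn₂.trans (Nat.add_le_add_right (Nat.mul_le_mul_left _ hn₁) 2),
    hw.hasMarkovTestChannels hP hMarkov⟩
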